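/- Let $M$ be a smooth (paracompact, Hausdorff) manifold of even dimension $n\ge 2$ with a semi-Riemannian metric $g$ of arbitrary signature, oriented, with volume form $\mu$. Let $\xi$ be a smooth complex vector bundle of finite rank over $M$ with a smooth Clifford action $\gamma$ of $(T^*M,g)$, i.e. $\gamma(\alpha)\gamma(\beta)+\gamma(\beta)\gamma(\alpha)=2\epsilon\, g(\alpha,\beta)$ with a fixed sign $\epsilon\in\{1,-1\}$. Let $\gamma_M$ be the multiple of $\gamma(\mu)=\frac1{n!}\mu_{i_1\dots i_n}\gamma(e^{i_1})\cdots\gamma(e^{i_n})$, by a fourth root of unity, that satisfies $\gamma_M^2=1$. Identify $\mathrm{End}(\xi)=\mathrm{Cl}^{\mathbb C}\otimes\mathrm{End}_{\mathrm{Cl}}(\xi)$, so that $\phi\in\mathrm{End}_{\mathrm{Cl}}(\xi)$ is an endomorphism that commutes with $\gamma(\alpha)$ for all $\alpha$ and $\gamma_M\otimes\phi=\gamma_M\circ\phi$. Let $\chi$ be a smooth section of $\mathrm{End}_{\mathrm{Cl}}(\xi)$ with $\chi^2=1$, and grade $\xi$ by $\Gamma=\gamma_M\otimes\chi$; $\mathrm{End}^-_{\mathrm{Cl}}(\xi)$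 consists of the $\phi\in\mathrm{End}_{\mathrm{Cl}}(\xi)$ with $\Gamma\phi=-\phi\Gamma$. A Dirac type operator is a complex linear operator $D'$ on the smooth sections of $\xi$ that is odd ($D'\Gamma=-\Gamma D'$) and satisfies $[D',f]=\gamma(df)$ for all smooth real functions $f$. A Clifford connection is a connection $A$ on $\xi$ whose covariant derivative $\partial_A$ satisfies $[\partial_{A,X},\gamma(\alpha)]=\gamma(\nabla_X\alpha)$ for all vector fields $X$ and one-forms $\alpha$, where $\nabla$ is the Levi-Civita connection; put $/\!\!\!\partial_A=\gamma\circ\partial_A$. The Bochner-Laplacian of $D'$ is $\triangle=\epsilon\,\mathrm{tr}_g(\hat\nabla^{T^*M\otimes\xi}\circ\hat\nabla)$ for the unique connection $\hat\nabla$ on $\xi$ such that $D'^2-\triangle$ is of order zero, i.e. a section of $\mathrm{End}(\xi)$. The operator $D'$ is of simple type if $\hat\nabla$ is a Clifford connection. The Dirac form of $D'$ is $\varpi=\Theta\wedge(D'-\gamma\circ\hat\nabla)$, where $\Theta(X)=\frac{\epsilon}{n}\gamma(X^\flat)$ and $(\Theta\wedge\Psi)(X)=\Theta(X)\circ\Psi$.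 For a Dirac type operator $D'$ the following are equivalent: 1. $D'$ is of simple type; 2. $D'=/\!\!\!\partial_A+\gamma_M\otimes\phi$ for a Clifford connection $A$ and a smooth section $\phi$ of $\mathrm{End}^-_{\mathrm{Cl}}(\xi)$; 3. the Dirac form of $D'$ is $\Theta\wedge(\gamma_M\otimes\phi)$ for a smooth section $\phi$ of $\mathrm{End}^-_{\mathrm{Cl}}(\xi)$. Moreover, a section $\phi$ of $\mathrm{End}^-_{\mathrm{Cl}}(\xi)$ satisfies the equation in 2 for some Clifford connection $A$ if and only if it satisfies the one in 3, and if $D'$ is of simple type, then $\phi$ and $A$ are uniquely determined by $D'$. -/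

import Mathlib

open Bundle
open scoped Manifold ContDiff

noncomputable section

namespace SimpleType

/-! ## Semi-Riemannian geometry on a smooth `n`-manifold -/

section Geometry

variable {n : ℕ} {M : Type*} [TopologicalSpace M] [ChartedSpace (EuclideanSpace ℝ (Fin n)) M]

/-- The coordinate basis of `T_x M` given by the preferred chart at `x`. -/
def frame (x : M) (i : Fin n) : TangentSpace (𝓡 n) x :=
  (EuclideanSpace.single i (1 : ℝ) : EuclideanSpace ℝ (Fin n))

/-- The basis of `T_x^* M` dual to `frame x`. -/
def coframe (x : M) (i : Fin n) : TangentSpace (𝓡 n) x →L[ℝ] ℝ :=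
  (EuclideanSpace.proj i : EuclideanSpace ℝ (Fin n) →L[ℝ] ℝ)

variable [IsManifold (𝓡 n) ∞ M]

/-- Smoothness of a vector field. -/
def SmoothField (X : ∀ x : M, TangentSpace (𝓡 n) x) : Prop :=
  ContMDiff (𝓡 n) ((𝓡 n).prod 𝓘(ℝ, EuclideanSpace ℝ (Fin n))) ∞
    (fun x ↦ TotalSpace.mk' (EuclideanSpace ℝ (Fin n)) x (X x))

variable (n M) in
/-- A smooth semi-Riemannian metric (of arbitrary signature) on `M`. -/
structure SemiRiemannianMetric where
  inner (x : M) : TangentSpace (𝓡 n) x →L[ℝ] TangentSpace (𝓡 n) x →L[ℝ] ℝ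
  symm (x : M) (u v : TangentSpace (𝓡 n) x) : inner x u v = inner x v u
  nondegenerate (x : M) (u : TangentSpace (𝓡 n) x) : (∀ v, inner x u v = 0) → u = 0
  contMDiff : ContMDiff (𝓡 n) ((𝓡 n).prod
      𝓘(ℝ, EuclideanSpace ℝ (Fin n) →L[ℝ] EuclideanSpace ℝ (Fin n) →L[ℝ] ℝ)) ∞
    (fun x ↦ TotalSpace.mk'
      (EuclideanSpace ℝ (Fin n) →L[ℝ] EuclideanSpace ℝ (Fin n) →L[ℝ] ℝ) x (inner x))

namespace SemiRiemannianMetric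

variable (g : SemiRiemannianMetric n M)

/-- The matrix `g_{ij}(x)` in the coordinate basis at `x`; its inverse is `g^{ij}(x)`. -/
def gram (x : M) : Matrix (Fin n) (Fin n) ℝ :=
  Matrix.of fun i j ↦ g.inner x (frame x i) (frame x j)

/-- The right-hand side of the Koszul formula,
`X g(Y,Z) + Y g(X,Z) - Z g(X,Y) + g([X,Y],Z) - g([X,Z],Y) - g([Y,Z],X)`, at `x`. -/
def koszul (X Y Z : ∀ x : M, TangentSpace (𝓡 n) x) (x : M) : ℝ :=
  mvfderiv (𝓡 n) (fun y ↦ g.inner y (Y y) (Z y)) x (X x)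
    + mvfderiv (𝓡 n) (fun y ↦ g.inner y (X y) (Z y)) x (Y x)
    - mvfderiv (𝓡 n) (fun y ↦ g.inner y (X y) (Y y)) x (Z x)
    + g.inner x (VectorField.mlieBracket (𝓡 n) X Y x) (Z x)
    - g.inner x (VectorField.mlieBracket (𝓡 n) X Z x) (Y x)
    - g.inner x (VectorField.mlieBracket (𝓡 n) Y Z x) (X x)

/-- The Levi-Civita derivative `∇_u Y ∈ T_x M` of a vector field `Y` in the direction
`u ∈ T_x M`: the vector determined by `2 g(∇_u Y, w) = koszul(u, Y, w)`. The formula is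
tensorial in `u` and `w`, which are therefore extended arbitrarily near `x`. -/
def leviCivita (Y : ∀ x : M, TangentSpace (𝓡 n) x) (x : M) (u : TangentSpace (𝓡 n) x) :
    TangentSpace (𝓡 n) x :=
  ∑ k, (∑ l, (g.gram x)⁻¹ k l *
    (g.koszul (FiberBundle.extend (EuclideanSpace ℝ (Fin n)) u) Y
      (FiberBundle.extend (EuclideanSpace ℝ (Fin n)) (frame x l)) x / 2)) • frame x k

/-- A semi-Riemannian volume form of `(M, g)`: a smooth `n`-form taking the values `±1` on
orthonormal bases. Such forms correspond to the orientations of `M`. -/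
structure VolumeForm where
  toFun (x : M) : (TangentSpace (𝓡 n) x) [⋀^Fin n]→ₗ[ℝ] ℝ
  sq_eq (x : M) (v : Fin n → TangentSpace (𝓡 n) x) :
    (toFun x v) ^ 2 = |(Matrix.of fun i j ↦ g.inner x (v i) (v j)).det|
  smooth (X : Fin n → ∀ x : M, TangentSpace (𝓡 n) x) (hX : ∀ i, SmoothField (X i)) :
    ContMDiff (𝓡 n) 𝓘(ℝ) ∞ (fun x ↦ toFun x (fun i ↦ X i x))

end SemiRiemannianMetric

end Geometry

/-! ## Clifford module bundles, connections and Dirac type operators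

`V` is a smooth complex vector bundle over `M` with typical fibre `F`. -/

section Bundles

variable {n : ℕ} {M : Type*} [TopologicalSpace M] [ChartedSpace (EuclideanSpace ℝ (Fin n)) M]
  (F : Type*) [NormedAddCommGroup F] [NormedSpace ℂ F]
  {V : M → Type*} [TopologicalSpace (TotalSpace F V)]
  [∀ x, AddCommGroup (V x)] [∀ x, Module ℂ (V x)] [∀ x, TopologicalSpace (V x)]
  [FiberBundle F V]

/-- Smoothness of a section of `V`. -/
def SmoothSection (s : ∀ x : M, V x) : Prop :=
  ContMDiff (𝓡 n) ((𝓡 n).prod 𝓘(ℝ, F)) ∞ (fun x ↦ TotalSpace.mk' F x (s x))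

/-- A field of fibrewise linear maps is a smooth section of `End(V)`: it maps smooth sections
to smooth sections. -/
def SmoothEnd (φ : ∀ x : M, Module.End ℂ (V x)) : Prop :=
  ∀ s : ∀ x : M, V x, SmoothSection (n := n) F s →
    SmoothSection (n := n) F (fun x ↦ φ x (s x))

variable [IsManifold (𝓡 n) ∞ M]

variable (V) in
/-- A Clifford action of `(T^*M, g)` on `V`, with either sign convention
`γ(α)γ(β) + γ(β)γ(α) = ± 2 g(α, β)`. Covectors are written as `u^♭ = g(u, ·)`. -/
structure CliffordAction (g : SemiRiemannianMetric n M) where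
  sign : ℤˣ
  act (x : M) : (TangentSpace (𝓡 n) x →L[ℝ] ℝ) →ₗ[ℝ] Module.End ℂ (V x)
  clifford (x : M) (u v : TangentSpace (𝓡 n) x) :
    act x (g.inner x u) * act x (g.inner x v) + act x (g.inner x v) * act x (g.inner x u)
      = ((2 * (sign : ℤ) * g.inner x u v : ℝ) : ℂ) • (1 : Module.End ℂ (V x))
  smooth (X : ∀ x : M, TangentSpace (𝓡 n) x) (s : ∀ x : M, V x) :
    SmoothField X → SmoothSection (n := n) F s →
      SmoothSection (n := n) F (fun x ↦ act x (g.inner x (X x)) (s x))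

namespace CliffordAction

variable {F} {g : SemiRiemannianMetric n M} (γ : CliffordAction F V g)

/-- The action `γ(μ) = (1/n!) ∑ μ_{i₁…iₙ} γ(e^{i₁}) ⋯ γ(e^{iₙ})` of the volume form. -/
def volume (μ : g.VolumeForm) (x : M) : Module.End ℂ (V x) :=
  ((n.factorial : ℂ))⁻¹ • ∑ σ : Equiv.Perm (Fin n),
    ((μ.toFun x (fun i ↦ frame x (σ i)) : ℝ) : ℂ) •
      (List.ofFn fun i ↦ γ.act x (coframe x (σ i))).prod

/-- The grading involution `γ_M`: the multiple of `γ(μ)` with square `1`. Here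
`γ(μ)² = (-1)^{n/2 + q}` where `q` is the number of negative directions of `g`, and the sign of
`det (g_{ij})` is `(-1)^q`. -/
def chirality (μ : g.VolumeForm) (x : M) : Module.End ℂ (V x) :=
  (if 0 < (g.gram x).det then Complex.I ^ (n / 2) else Complex.I ^ (n / 2 + 1)) • γ.volume μ x

/-- `φ` belongs to `End_Cl(V) = 1 ⊗ End_Cl(V) ⊆ Cl ⊗ End_Cl(V) = End(V)`. -/
def CommutesWithClifford (φ : ∀ x : M, Module.End ℂ (V x)) : Prop :=
  ∀ (x : M) (α : TangentSpace (𝓡 n) x →L[ℝ] ℝ), Commute (γ.act x α) (φ x)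

/-- `χ` is a smooth involution in `End_Cl(V)`, so that `Γ = γ_M ⊗ χ` is a grading of `V`. -/
structure IsTwistInvolution (χ : ∀ x : M, Module.End ℂ (V x)) : Prop where
  smooth : SmoothEnd (n := n) F χ
  commutes : γ.CommutesWithClifford χ
  sq (x : M) : χ x * χ x = 1

/-- The total grading `Γ = γ_M ⊗ χ`. -/
def grading (μ : g.VolumeForm) (χ : ∀ x : M, Module.End ℂ (V x)) (x : M) :
    Module.End ℂ (V x) :=
  γ.chirality μ x * χ x

/-- `φ` is a section of `End^-_Cl(V)`: smooth, in `End_Cl(V)` and odd with respect to `Γ`. -/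
structure IsOddTwist (μ : g.VolumeForm) (χ φ : ∀ x : M, Module.End ℂ (V x)) : Prop where
  smooth : SmoothEnd (n := n) F φ
  commutes : γ.CommutesWithClifford φ
  odd (x : M) : γ.grading μ χ x * φ x = -(φ x * γ.grading μ χ x)

/-- `D` (used on smooth sections only) is a Dirac type operator: a complex linear operator on
smooth sections with `[D, f] = γ(df)` for all smooth `f`, odd with respect to `Γ`. -/
structure IsDiracType (μ : g.VolumeForm) (χ : ∀ x : M, Module.End ℂ (V x))
    (D : (∀ x : M, V x) → ∀ x : M, V x) : Prop where
  smooth (s : ∀ x : M, V x) : SmoothSection (n := n) F s → SmoothSection (n := n) F (D s)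
  map_add (s t : ∀ x : M, V x) : SmoothSection (n := n) F s → SmoothSection (n := n) F t →
    D (fun x ↦ s x + t x) = fun x ↦ D s x + D t x
  map_smul (c : ℂ) (s : ∀ x : M, V x) : SmoothSection (n := n) F s →
    D (fun x ↦ c • s x) = fun x ↦ c • D s x
  symbol (f : M → ℝ) (s : ∀ x : M, V x) : ContMDiff (𝓡 n) 𝓘(ℝ) ∞ f →
    SmoothSection (n := n) F s →
    D (fun x ↦ f x • s x) = fun x ↦ f x • D s x + γ.act x (mvfderiv (𝓡 n) f x) (s x)
  odd (s : ∀ x : M, V x) : SmoothSection (n := n) F s →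
    D (fun x ↦ γ.grading μ χ x (s x)) = fun x ↦ -(γ.grading μ χ x (D s x))

variable [∀ x, IsTopologicalAddGroup (V x)] [∀ x, ContinuousSMul ℝ (V x)] [VectorBundle ℝ F V]

/-- A smooth connection on the complex vector bundle `V`. -/
structure _root_.SimpleType.IsConnection (A : CovariantDerivative (𝓡 n) F V) : Prop where
  smooth : CovariantDerivative.ContMDiffCovariantDerivative A ∞
  map_smul (c : ℂ) (s : ∀ x : M, V x) : SmoothSection (n := n) F s →
    ∀ (x : M) (u : TangentSpace (𝓡 n) x), A (fun y ↦ c • s y) x u = c • A s x u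

/-- A Clifford connection: `[∇_u, γ(Y^♭)] = γ((∇_u Y)^♭)` with the Levi-Civita derivative of
the vector field `Y` on the right. -/
structure IsCliffordConnection (A : CovariantDerivative (𝓡 n) F V) : Prop where
  isConnection : IsConnection A
  compatible (Y : ∀ x : M, TangentSpace (𝓡 n) x) (s : ∀ x : M, V x) :
    SmoothField Y → SmoothSection (n := n) F s → ∀ (x : M) (u : TangentSpace (𝓡 n) x),
      A (fun y ↦ γ.act y (g.inner y (Y y)) (s y)) x u
        = γ.act x (g.inner x (Y x)) (A s x u) + γ.act x (g.inner x (g.leviCivita Y x u)) (s x)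

/-- The operator `γ ∘ ∇`, i.e. `∑ i, γ(e^i) ∇_{e_i}`. -/
def dirac (A : CovariantDerivative (𝓡 n) F V) (s : ∀ x : M, V x) (x : M) : V x :=
  ∑ i, γ.act x (coframe x i) (A s x (frame x i))

variable (g) in
/-- The second covariant derivative `(∇^{T^*M ⊗ V} ∘ ∇) s` on `u, v ∈ T_x M`, that is
`∇_u ∇_Y s - ∇_{∇_u Y} s` for any extension `Y` of `v` to a vector field near `x`. -/
def _root_.SimpleType.hessian (A : CovariantDerivative (𝓡 n) F V) (s : ∀ x : M, V x) (x : M)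
    (u v : TangentSpace (𝓡 n) x) : V x :=
  A (fun y ↦ A s y (FiberBundle.extend (EuclideanSpace ℝ (Fin n)) v y)) x u
    - A s x (g.leviCivita (FiberBundle.extend (EuclideanSpace ℝ (Fin n)) v) x u)

/-- The Bochner-Laplacian `± tr_g (∇^{T^*M ⊗ V} ∘ ∇)` of a connection; the sign is the one of
the Clifford relation, so that its principal symbol is the one of `D²`. -/
def bochnerLaplacian (A : CovariantDerivative (𝓡 n) F V) (s : ∀ x : M, V x) (x : M) : V x :=
  ((γ.sign : ℤ) : ℝ) •
    ∑ i, ∑ j, (g.gram x)⁻¹ i j • hessian g A s x (frame x i) (frame x j)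

/-- `A` is the connection defining the Bochner-Laplacian of `D`: the operator `D² - △_A` is a
section of `End(V)`. -/
def IsBochnerConnection (D : (∀ x : M, V x) → ∀ x : M, V x)
    (A : CovariantDerivative (𝓡 n) F V) : Prop :=
  IsConnection A ∧ ∃ R : ∀ x : M, Module.End ℂ (V x), SmoothEnd (n := n) F R ∧
    ∀ s : ∀ x : M, V x, SmoothSection (n := n) F s →
      ∀ x, D (D s) x - γ.bochnerLaplacian A s x = R x (s x)

/-- `D` is of simple type: its Bochner-Laplacian is defined by a Clifford connection. -/
def IsSimpleType (D : (∀ x : M, V x) → ∀ x : M, V x) : Prop :=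
  ∃ A : CovariantDerivative (𝓡 n) F V, γ.IsCliffordConnection A ∧ γ.IsBochnerConnection D A

/-- `D = γ ∘ ∇^A + γ_M ⊗ φ`. -/
def IsSum (μ : g.VolumeForm) (D : (∀ x : M, V x) → ∀ x : M, V x)
    (A : CovariantDerivative (𝓡 n) F V) (φ : ∀ x : M, Module.End ℂ (V x)) : Prop :=
  ∀ s : ∀ x : M, V x, SmoothSection (n := n) F s →
    ∀ x, D s x = γ.dirac A s x + γ.chirality μ x (φ x (s x))

/-- The normalized soldering form `Θ(u) = ± γ(u^♭) / n`, a right inverse of `γ`. -/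
def theta (x : M) (u : TangentSpace (𝓡 n) x) : Module.End ℂ (V x) :=
  ((((γ.sign : ℤ) : ℝ) / n : ℝ) : ℂ) • γ.act x (g.inner x u)

/-- The Dirac form of `D` is the `End(V)`-valued one-form `θ`: for the connection `A` defining
the Bochner-Laplacian of `D` one has `Θ ∧ (D - γ ∘ ∇^A) = θ`. -/
def HasDiracForm (D : (∀ x : M, V x) → ∀ x : M, V x)
    (θ : ∀ x : M, TangentSpace (𝓡 n) x → Module.End ℂ (V x)) : Prop :=
  (∃ A : CovariantDerivative (𝓡 n) F V, γ.IsBochnerConnection D A) ∧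
  ∀ A : CovariantDerivative (𝓡 n) F V, γ.IsBochnerConnection D A →
    ∀ s : ∀ x : M, V x, SmoothSection (n := n) F s →
      ∀ (x : M) (u : TangentSpace (𝓡 n) x),
        γ.theta x u (D s x - γ.dirac A s x) = θ x u (s x)

end CliffordAction

end Bundles

end SimpleType

end

/-! For every connection A, a Dirac type operator D has the same symbol as `γ ∘ ∇^A`, so `D = γ ∘
∇^A + Φ` with a field of endomorphisms Φ. Write ε for the sign of the Clifford relation. The
commutator of D² with a function f is the anticommutator of D with γ(grad f), while that of the
Bochner-Laplacian is `2ε ∇_{grad f} + ε tr Hess f` (`bochnerLaplacian_smul`). So A is the Bochner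
connection exactly when these agree. The anticommutator of `γ ∘ ∇^A` with γ(grad f) is the same
expression plus the Clifford contraction of the defect `[∇^A, γ] - γ(∇)` (`dirac_cl_grad`). For the
Bochner connection, therefore, the anticommutator of Φ with γ(v) and the contracted defect add up to
zero (`anticomm_add_defect`).

If A is a Clifford connection, its defect vanishes, and A is the Bochner connection if and only if Φ
anticommutes with γ. In even dimension γ_M anticommutes with γ as well and squares to 1, so this
means Φ = γ_M φ with φ in End_Cl.

If instead the Dirac form is given, Φ = γ_M φ for the Bochner connection, because Θ(u) is injective
for some u at each point. Then Φ anticommutes with γ and the contracted defect vanishes.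
Differentiating the Clifford relation gives a further symmetry of the defect, and
`eq_zero_of_clifford_contraction` shows that both conditions together force the defect to be zero:
the Bochner connection is a Clifford connection.

Uniqueness and oddness both rest on `eq_zero_of_sum_cl_mul`: a one-form that commutes with γ while
its contraction anticommutes, or the other way round, is zero. For uniqueness it is applied to the
difference of two Clifford connections, for oddness to `[∇^A, Γ]`, whose contraction is minus the
anticommutator of Φ and Γ. -/

set_option linter.unusedSectionVars false

noncomputable section

namespace SimpleType

/-! ## Algebra of anticommuting families -/

section Algebra

/-- A sum of commuting idempotents has no negative eigenvalue. -/
theorem eq_zero_of_sum_idempotents_eq_neg_smul {ι W : Type*} [AddCommGroup W] [Module ℝ W]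
    (s : Finset ι) (P : ι → Module.End ℝ W) (hP : ∀ i w, P i (P i w) = P i w)
    (hcomm : ∀ i j w, P i (P j w) = P j (P i w)) (c : ℝ) (hc : 0 < c) (w : W)
    (h : ∑ i ∈ s, P i w = -c • w) : w = 0 := by
  classical
  induction s using Finset.induction_on generalizing c w with
  | empty =>
    rw [Finset.sum_empty, eq_comm, smul_eq_zero] at h
    exact h.resolve_left (by linarith)
  | insert a s ha ih =>
    rw [Finset.sum_insert ha] at h
    -- Applying `P a` to the equation moves its own term to the right: the other idempotents act on
    -- `P a w` with eigenvalue `-(c + 1)`. Hence the induction runs over all `c`.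
    have h1 : P a w = 0 := by
      refine ih (c + 1) (by linarith) (P a w) ?_
      have h2 := congrArg (P a) h
      rw [map_add, hP, map_sum, map_smul] at h2
      simp_rw [hcomm _ a]
      rw [← eq_sub_iff_add_eq'] at h2
      rw [h2]
      module
    rw [h1, zero_add] at h
    exact ih c hc w h

variable {A : Type*} [Ring A] [Algebra ℝ A]

/-- A derivation-like family `T i j = "[∇_i, γ_j]"` with vanishing Clifford contraction is zero. -/
theorem eq_zero_of_clifford_contraction {ι : Type*} [Fintype ι] [DecidableEq ι]
    (γ : ι → A) (q : ι → ℝ) (hq : ∀ i, q i ≠ 0)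
    (hγ : ∀ i j, γ i * γ j + γ j * γ i = (if i = j then 2 * q i else 0) • (1 : A))
    (T : ι → ι → A) (h1 : ∀ k, ∑ i, (q i)⁻¹ • (γ i * T i k) = 0)
    (h2 : ∀ i j k, γ j * T i k + T i k * γ j + (γ k * T i j + T i j * γ k) = 0) :
    ∀ j k, T j k = 0 := by
  have hsq : ∀ i, γ i * γ i = q i • (1 : A) := fun i ↦ by
    have := hγ i i
    rw [if_pos rfl, mul_smul, two_smul, ← two_smul ℝ, ← two_smul ℝ] at this
    exact smul_right_injective A (two_ne_zero (α := ℝ)) this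
  have hanti : ∀ i j, i ≠ j → γ i * γ j = -(γ j * γ i) := fun i j hij ↦ by
    have := hγ i j
    rw [if_neg hij, zero_smul] at this
    exact eq_neg_of_add_eq_zero_left this
  -- Moving `γ j` to the front leaves only the term `i = j`, since the rest is `γ j` times a sum
  -- that vanishes by `h1`.
  have hcon : ∀ j k, ∑ i, (q i)⁻¹ • (γ i * (γ j * T i k)) = (2 : ℝ) • T j k := fun j k ↦ by
    have : ∀ i, (q i)⁻¹ • (γ i * (γ j * T i k))
        = (if i = j then (2 : ℝ) • T j k else 0) - γ j * ((q i)⁻¹ • (γ i * T i k)) := fun i ↦ by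
      rw [← mul_assoc, eq_sub_of_add_eq (hγ i j), sub_mul, smul_sub, mul_smul_comm, mul_assoc]
      congr 1
      split_ifs with h
      · subst h
        rw [smul_mul_assoc, one_mul, smul_smul]
        congr 1
        field_simp [hq i]
      · simp
    rw [Finset.sum_congr rfl fun i _ ↦ this i, Finset.sum_sub_distrib, ← Finset.mul_sum, h1]
    simp
  have hcon' : ∀ j k, ∑ i, (q i)⁻¹ • (γ i * (γ j * T i k + T i k * γ j)) = (2 : ℝ) • T j k :=
    fun j k ↦ by
      have : ∀ i, (q i)⁻¹ • (γ i * (γ j * T i k + T i k * γ j))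
          = (q i)⁻¹ • (γ i * (γ j * T i k)) + ((q i)⁻¹ • (γ i * T i k)) * γ j := fun i ↦ by
        rw [mul_add, smul_add, smul_mul_assoc, mul_assoc (γ i) (T i k)]
      rw [Finset.sum_congr rfl fun i _ ↦ this i, Finset.sum_add_distrib, hcon, ← Finset.sum_mul,
        h1, zero_mul, add_zero]
  -- Contracting `h2` with `γ i` gives `2 T j k + 2 T k j = 0`.
  have hT : ∀ j k, T j k = -T k j := fun j k ↦ by
    have h3 : ∑ i, (q i)⁻¹ • (γ i * (γ j * T i k + T i k * γ j + (γ k * T i j + T i j * γ k)))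
        = 0 := Finset.sum_eq_zero fun i _ ↦ by rw [h2, mul_zero, smul_zero]
    simp_rw [mul_add (γ _) (γ j * T _ k + T _ k * γ j), smul_add] at h3
    rw [Finset.sum_add_distrib, hcon', hcon', ← smul_add, smul_eq_zero] at h3
    exact eq_neg_of_add_eq_zero_left (h3.resolve_left two_ne_zero)
  -- By `hT` and `h2`, the anticommutator of `γ i` and `T j k` changes sign under two transpositions
  -- of its indices, hence is totally antisymmetric.
  have hX : ∀ i j k, γ i * T j k + T j k * γ i = -(γ j * T i k + T i k * γ j) := fun i j k ↦ by
    have e1 := eq_neg_of_add_eq_zero_left (h2 j i k)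
    have e2 := eq_neg_of_add_eq_zero_left (h2 i k j)
    rw [e1, hT j i, ← e2]
    simp only [mul_neg, neg_mul]
    abel
  intro j k
  -- `c i` is conjugation by `γ i`, whose inverse is `(q i)⁻¹ • γ i`. These are commuting
  -- involutions, so the `(1 + c i) / 2` are commuting idempotents.
  let c : ι → Module.End ℝ A := fun i ↦
    (q i)⁻¹ • (LinearMap.mulLeft ℝ (γ i) * LinearMap.mulRight ℝ (γ i))
  have hc : ∀ i w, c i w = (q i)⁻¹ • (γ i * (w * γ i)) := fun i w ↦ rfl
  have hcc : ∀ i w, c i (c i w) = w := fun i w ↦ by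
    have : γ i * (γ i * (w * γ i) * γ i) = (q i * q i) • w := by
      calc _ = (γ i * γ i) * w * (γ i * γ i) := by noncomm_ring
        _ = _ := by rw [hsq]; simp [smul_smul]
    rw [hc, hc, smul_mul_assoc, mul_smul_comm, this, smul_smul, smul_smul]
    convert one_smul ℝ w
    field_simp [hq i]
  have hcomm : ∀ i j w, c i (c j w) = c j (c i w) := fun i j w ↦ by
    by_cases hij : i = j
    · rw [hij]
    simp only [hc, smul_mul_assoc, mul_smul_comm]
    rw [smul_comm]
    congr 2
    calc γ i * (γ j * (w * γ j) * γ i) = (γ i * γ j) * w * (γ j * γ i) := by noncomm_ring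
      _ = (γ j * γ i) * w * (γ i * γ j) := by
        rw [hanti i j hij, hanti j i (Ne.symm hij)]
        simp
      _ = γ j * (γ i * (w * γ i) * γ j) := by noncomm_ring
  refine eq_zero_of_sum_idempotents_eq_neg_smul Finset.univ (fun i ↦ (2 : ℝ)⁻¹ • (1 + c i))
    (fun i w ↦ ?_) (fun i l w ↦ ?_) 1 one_pos (T j k) ?_
  · simp only [LinearMap.smul_apply, LinearMap.add_apply, Module.End.one_apply, map_smul, map_add,
      hcc]
    module
  · simp only [LinearMap.smul_apply, LinearMap.add_apply, Module.End.one_apply, map_smul, map_add,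
      hcomm i l]
    module
  -- The left side is `∑ (1 + c i)` applied to `T j k`, and antisymmetry evaluates it to `-2 T j k`.
  -- So `T j k` would belong to the eigenvalue `-1` of a sum of commuting idempotents.
  · have h4 : ∑ i, (q i)⁻¹ • (γ i * (γ i * T j k + T j k * γ i)) = -((2 : ℝ) • T j k) := by
      rw [← hcon', ← Finset.sum_neg_distrib]
      exact Finset.sum_congr rfl fun i _ ↦ by rw [hX, mul_neg, smul_neg]
    have h5 : ∀ i, ((2 : ℝ)⁻¹ • (1 + c i)) (T j k)
        = (2 : ℝ)⁻¹ • ((q i)⁻¹ • (γ i * (γ i * T j k + T j k * γ i))) := fun i ↦ by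
      change (2 : ℝ)⁻¹ • (T j k + c i (T j k)) = _
      rw [hc, mul_add, ← mul_assoc (γ i) (γ i), hsq, smul_mul_assoc, one_mul, smul_add (q i)⁻¹,
        smul_smul (q i)⁻¹, inv_mul_cancel₀ (hq i), one_smul]
    rw [Finset.sum_congr rfl fun i _ ↦ h5 i, ← Finset.smul_sum, h4]
    module

/-- Adjacent transpositions suffice, since they generate the permutation group. Exchanging the first
two factors is one anticommutation; any later exchange fixes the head and takes place in the tail.
-/
theorem prod_ofFn_swap_succ (n : ℕ) (f : Fin (n + 1) → A)
    (hf : ∀ i j, i ≠ j → f i * f j = -(f j * f i)) (k : Fin n) :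
    (List.ofFn fun i ↦ f (Equiv.swap k.castSucc k.succ i)).prod = -(List.ofFn f).prod := by
  induction n with
  | zero => exact k.elim0
  | succ n ih =>
    induction k using Fin.cases with
    | zero =>
      have h : ∀ i : Fin n, Equiv.swap (0 : Fin (n + 2)) 1 i.succ.succ = i.succ.succ := fun i ↦
        Equiv.swap_apply_of_ne_of_ne (Fin.succ_ne_zero _) (by simp [Fin.ext_iff])
      simp only [List.ofFn_succ, List.prod_cons, Fin.castSucc_zero, Fin.succ_zero_eq_one', h,
        Equiv.swap_apply_left]
      rw [Equiv.swap_apply_right, ← mul_assoc, ← mul_assoc,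
        hf 1 0 (by simp), neg_mul]
    | succ k =>
      have h0 : Equiv.swap k.succ.castSucc k.succ.succ (0 : Fin (n + 2)) = 0 :=
        Equiv.swap_apply_of_ne_of_ne (by simp [Fin.ext_iff]) (by simp [Fin.ext_iff])
      have h : ∀ i : Fin (n + 1), Equiv.swap k.succ.castSucc k.succ.succ i.succ
          = (Equiv.swap k.castSucc k.succ i).succ := fun i ↦ by
        simp only [Equiv.swap_apply_def, ← Fin.succ_castSucc, Fin.succ_inj]
        split_ifs <;> rfl
      rw [List.ofFn_succ, List.ofFn_succ (f := f), List.prod_cons, List.prod_cons, h0]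
      simp_rw [h]
      rw [ih (fun i ↦ f i.succ) (fun i j hij ↦ hf _ _ (by simpa using hij)) k, mul_neg]

/-- Reordering a product of pairwise anticommuting elements. -/
theorem prod_ofFn_perm (n : ℕ) (f : Fin n → A) (hf : ∀ i j, i ≠ j → f i * f j = -(f j * f i))
    (σ : Equiv.Perm (Fin n)) :
    (List.ofFn fun i ↦ f (σ i)).prod = ((Equiv.Perm.sign σ : ℤ) : ℝ) • (List.ofFn f).prod := by
  cases n with
  | zero => simp [Subsingleton.elim σ 1]
  | succ n =>
    have hσ : σ ∈ Submonoid.closure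
        (Set.range fun i : Fin n ↦ Equiv.swap i.castSucc i.succ) := by
      rw [Equiv.Perm.mclosure_swap_castSucc_succ]; trivial
    induction hσ using Submonoid.closure_induction_right with
    | one => simp
    | mul_right σ _ τ hτ ih =>
      obtain ⟨k, rfl⟩ := hτ
      have := prod_ofFn_swap_succ n (fun i ↦ f (σ i)) (fun i j hij ↦ hf _ _ (by simpa using hij)) k
      simp only [Equiv.Perm.mul_apply]
      rw [this, ih, Equiv.Perm.sign_mul, Equiv.Perm.sign_swap (by simp [Fin.ext_iff])]
      simp

theorem mul_prod_ofFn_of_anticomm (n : ℕ) (f : Fin n → A) (a : A)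
    (hf : ∀ i, f i * a = -(a * f i)) :
    (List.ofFn f).prod * a = (-1 : ℝ) ^ n • (a * (List.ofFn f).prod) := by
  induction n with
  | zero => simp
  | succ n ih =>
    rw [List.ofFn_succ, List.prod_cons, mul_assoc, ih _ fun i ↦ hf _, mul_smul_comm, ← mul_assoc,
      hf, pow_succ]
    simp [mul_assoc]

/-- A member of an anticommuting family (anti)commutes with the product of the family. -/
theorem mul_prod_ofFn_add (n : ℕ) (f : Fin n → A) (hf : ∀ i j, i ≠ j → f i * f j = -(f j * f i))
    (k : Fin n) :
    f k * (List.ofFn f).prod + (-1 : ℝ) ^ n • ((List.ofFn f).prod * f k) = 0 := by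
  induction n with
  | zero => exact k.elim0
  | succ n ih =>
    rw [List.ofFn_succ, List.prod_cons]
    induction k using Fin.cases with
    | zero =>
      rw [mul_assoc (f 0), mul_prod_ofFn_of_anticomm n _ (f 0) fun i ↦ hf _ _ (Fin.succ_ne_zero _),
        mul_smul_comm, smul_smul, pow_succ, mul_right_comm, ← mul_pow]
      simp
    | succ k =>
      have := ih (fun i ↦ f i.succ) (fun i j hij ↦ hf _ _ (by simpa using hij)) k
      rw [← mul_assoc, hf _ _ (Fin.succ_ne_zero k), neg_mul, mul_assoc,
        eq_neg_of_add_eq_zero_left this, pow_succ]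
      simp [mul_assoc]

/-- The square of a product of pairwise anticommuting elements. -/
theorem prod_ofFn_mul_self (n : ℕ) (f : Fin n → A) (hf : ∀ i j, i ≠ j → f i * f j = -(f j * f i))
    (q : Fin n → ℝ) (hq : ∀ i, f i * f i = q i • (1 : A)) :
    (List.ofFn f).prod * (List.ofFn f).prod = ((-1 : ℝ) ^ n.choose 2 * ∏ i, q i) • (1 : A) := by
  induction n with
  | zero => simp
  | succ n ih =>
    have := ih (fun i ↦ f i.succ) (fun i j hij ↦ hf _ _ (by simpa using hij)) (fun i ↦ q i.succ)
      fun i ↦ hq _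
    rw [List.ofFn_succ, List.prod_cons, mul_assoc, ← mul_assoc _ (f 0),
      mul_prod_ofFn_of_anticomm n _ (f 0) fun i ↦ hf _ _ (Fin.succ_ne_zero _), smul_mul_assoc,
      mul_assoc, this, mul_smul_comm, ← mul_assoc, hq, Fin.prod_univ_succ,
      Nat.choose_succ_succ' n 1, Nat.choose_one_right, pow_add]
    simp only [smul_smul, mul_smul_comm, mul_one]
    congr 1
    ring

end Algebra

/-! ## Smooth sections of vector bundles -/

section SmoothSections

open Filter
open scoped Topology

variable {n : ℕ} {M : Type*} [TopologicalSpace M] [ChartedSpace (EuclideanSpace ℝ (Fin n)) M]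
  [IsManifold (𝓡 n) ∞ M] [T2Space M]
  {F : Type*} [NormedAddCommGroup F] [NormedSpace ℝ F]
  {V : M → Type*} [TopologicalSpace (TotalSpace F V)]
  [∀ x, AddCommGroup (V x)] [∀ x, Module ℝ (V x)] [∀ x, TopologicalSpace (V x)]
  [FiberBundle F V] [VectorBundle ℝ F V]

/-- A smooth cutoff function at `x` with support in a given neighbourhood. -/
theorem exists_cutoff (x : M) {u : Set M} (hu : u ∈ 𝓝 x) :
    ∃ ψ : M → ℝ, ContMDiff (𝓡 n) 𝓘(ℝ) ∞ ψ ∧ tsupport ψ ⊆ u ∧ ψ =ᶠ[𝓝 x] 1 := by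
  obtain ⟨ψ, -, hψ⟩ := (SmoothBumpFunction.nhds_basis_tsupport (I := 𝓡 n) x).mem_iff.1 hu
  exact ⟨ψ, ψ.contMDiff, hψ, ψ.eventuallyEq_one⟩

/-- Operators such as `D` are controlled on global smooth sections only; a cutoff makes a local
section global without changing its germ at `x`. -/
theorem exists_contMDiff_section_eventuallyEq (x : M) (s : ∀ y, V y) {u : Set M} (hu : u ∈ 𝓝 x)
    (hs : ContMDiffOn (𝓡 n) ((𝓡 n).prod 𝓘(ℝ, F)) ∞ (fun y ↦ TotalSpace.mk' F y (s y)) u) :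
    ∃ t : ∀ y, V y,
      ContMDiff (𝓡 n) ((𝓡 n).prod 𝓘(ℝ, F)) ∞ (fun y ↦ TotalSpace.mk' F y (t y)) ∧
      ∀ᶠ y in 𝓝 x, t y = s y := by
  obtain ⟨ψ, hψ, hsupp, hone⟩ := exists_cutoff (n := n) x (interior_mem_nhds.2 hu)
  refine ⟨ψ • s, hψ.contMDiffOn.smul_section_of_tsupport isOpen_interior hsupp
    (hs.mono interior_subset), ?_⟩
  filter_upwards [hone] with y hy
  simp [hy]

variable [ContMDiffVectorBundle ∞ F V (𝓡 n)]

/-- Every vector is the value of a smooth section, which may be chosen to coincide with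
`FiberBundle.extend` near the base point. -/
theorem exists_contMDiff_extend (x : M) (v : V x) :
    ∃ t : ∀ y, V y,
      ContMDiff (𝓡 n) ((𝓡 n).prod 𝓘(ℝ, F)) ∞ (fun y ↦ TotalSpace.mk' F y (t y)) ∧
      (∀ᶠ y in 𝓝 x, t y = FiberBundle.extend F v y) ∧ t x = v := by
  obtain ⟨u, hu, hs⟩ := FiberBundle.exists_contMDiffOn_extend (k := ∞) (𝓡 n) F v
  obtain ⟨t, ht, h⟩ := exists_contMDiff_section_eventuallyEq x _ hu hs
  exact ⟨t, ht, h, by simpa using h.self_of_nhds⟩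

/-- An operation on smooth sections that is additive and homogeneous for smooth functions at `x`
vanishes on the sections that vanish at `x`. -/
theorem eq_zero_of_tensorial [FiniteDimensional ℝ F] {W : Type*} [AddCommGroup W] [Module ℝ W]
    (x : M) (P : (∀ y, V y) → W)
    (hadd : ∀ s t : ∀ y, V y,
      ContMDiff (𝓡 n) ((𝓡 n).prod 𝓘(ℝ, F)) ∞ (fun y ↦ TotalSpace.mk' F y (s y)) →
      ContMDiff (𝓡 n) ((𝓡 n).prod 𝓘(ℝ, F)) ∞ (fun y ↦ TotalSpace.mk' F y (t y)) →
      P (fun y ↦ s y + t y) = P s + P t)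
    (hsmul : ∀ (f : M → ℝ) (s : ∀ y, V y), ContMDiff (𝓡 n) 𝓘(ℝ) ∞ f →
      ContMDiff (𝓡 n) ((𝓡 n).prod 𝓘(ℝ, F)) ∞ (fun y ↦ TotalSpace.mk' F y (s y)) →
      P (fun y ↦ f y • s y) = f x • P s)
    (s : ∀ y, V y)
    (hs : ContMDiff (𝓡 n) ((𝓡 n).prod 𝓘(ℝ, F)) ∞ (fun y ↦ TotalSpace.mk' F y (s y)))
    (hx : s x = 0) : P s = 0 := by
  classical
  let e := trivializationAt F V x
  let b := Module.Basis.ofVectorSpace ℝ F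
  have hxe : x ∈ e.baseSet := FiberBundle.mem_baseSet_trivializationAt F V x
  obtain ⟨ψ, hψ, hsupp, hone⟩ := exists_cutoff (n := n) x (e.open_baseSet.mem_nhds hxe)
  have hψx : ψ x = 1 := hone.self_of_nhds
  -- One factor `ψ` makes the frame sections global and another the coefficients, which is why `ψ ^
  -- 2` occurs in the decomposition `hdec`.
  let E := fun i y ↦ ψ y • e.localFrame b i y
  let c := fun i y ↦ ψ y * e.localFrameCoeff (𝓡 n) b i y (s y)
  have hE : ∀ i, ContMDiff (𝓡 n) ((𝓡 n).prod 𝓘(ℝ, F)) ∞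
      (fun y ↦ TotalSpace.mk' F y (E i y)) := fun i ↦
    hψ.contMDiffOn.smul_section_of_tsupport e.open_baseSet hsupp
      (e.contMDiffOn_localFrame_baseSet ∞ b i)
  have hc : ∀ i, ContMDiff (𝓡 n) 𝓘(ℝ) ∞ (c i) := fun i ↦ by
    refine contMDiff_of_tsupport fun y hy ↦ ?_
    have hye : y ∈ e.baseSet := hsupp (tsupport_mul_subset_left hy)
    exact hψ.contMDiffAt.mul (contMDiffAt_localFrameCoeff b hye (hs y) i)
  have hsum : ∀ (I : Finset (Module.Basis.ofVectorSpaceIndex ℝ F)),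
      ContMDiff (𝓡 n) ((𝓡 n).prod 𝓘(ℝ, F)) ∞
        (fun y ↦ TotalSpace.mk' F y (∑ i ∈ I, c i y • E i y)) ∧
      P (fun y ↦ ∑ i ∈ I, c i y • E i y) = 0 := fun I ↦ by
    induction I using Finset.induction_on with
    | empty =>
      have h0 : ContMDiff (𝓡 n) ((𝓡 n).prod 𝓘(ℝ, F)) ∞
          (fun y ↦ TotalSpace.mk' F y (0 : V y)) := (contMDiff_zeroSection ℝ V).of_le le_top
      refine ⟨by simpa using h0, ?_⟩
      have := hsmul (fun _ ↦ 0) _ contMDiff_const h0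
      simpa using this
    | insert a I ha ih =>
      simp only [Finset.sum_insert ha]
      have h1 : ContMDiff (𝓡 n) ((𝓡 n).prod 𝓘(ℝ, F)) ∞
          (fun y ↦ TotalSpace.mk' F y (c a y • E a y)) := (hc a).smul_section (hE a)
      refine ⟨h1.add_section ih.1, ?_⟩
      rw [hadd _ _ h1 ih.1, ih.2, hsmul _ _ (hc a) (hE a)]
      simp [c, hx]
  -- `P` kills the first summand because `1 - ψ ^ 2` vanishes at `x`, and the second because `s x =
  -- 0` makes every `c i` vanish at `x`.
  have hdec : s = fun y ↦ (1 - ψ y * ψ y) • s y + ∑ i, c i y • E i y := by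
    funext y
    by_cases hy : y ∈ e.baseSet
    · have h1 := e.eq_sum_localFrameCoeff_smul (I := 𝓡 n) (s := s) (b := b) hy
      have h2 : ∑ i, c i y • E i y = (ψ y * ψ y) • s y := by
        conv_rhs => rw [h1, Finset.smul_sum]
        refine Finset.sum_congr rfl fun i _ ↦ ?_
        simp only [c, E, smul_smul]
        congr 1
        ring
      rw [h2]
      module
    · have h1 : ψ y = 0 := by
        by_contra h
        exact hy (hsupp (subset_tsupport _ h))
      simp [c, E, h1]
  have h1 : ContMDiff (𝓡 n) 𝓘(ℝ) ∞ (fun y ↦ 1 - ψ y * ψ y) :=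
    contMDiff_const.sub (hψ.mul hψ)
  have h3 : ContMDiff (𝓡 n) ((𝓡 n).prod 𝓘(ℝ, F)) ∞
      (fun y ↦ TotalSpace.mk' F y ((1 - ψ y * ψ y) • s y)) := h1.smul_section hs
  rw [hdec, hadd _ _ h3 (hsum Finset.univ).1, (hsum Finset.univ).2, hsmul _ _ h1 hs, hψx]
  simp

/-- A smooth function with prescribed differential at a point. -/
theorem exists_contMDiff_mvfderiv_eq (x : M) (α : TangentSpace (𝓡 n) x →L[ℝ] ℝ) :
    ∃ f : M → ℝ, ContMDiff (𝓡 n) 𝓘(ℝ) ∞ f ∧ mvfderiv (𝓡 n) f x = α := by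
  obtain ⟨ψ, hψ, hsupp, hone⟩ := exists_cutoff (n := n) x
    ((chartAt (EuclideanSpace ℝ (Fin n)) x).open_source.mem_nhds (mem_chart_source _ x))
  let β : EuclideanSpace ℝ (Fin n) →L[ℝ] ℝ := α
  let h : M → ℝ := fun y ↦ β (extChartAt (𝓡 n) x y)
  have hh : ∀ y ∈ (chartAt (EuclideanSpace ℝ (Fin n)) x).source,
      ContMDiffAt (𝓡 n) 𝓘(ℝ) ∞ h y := fun y hy ↦
    β.contMDiff.contMDiffAt.comp y (contMDiffAt_extChartAt' hy)
  refine ⟨fun y ↦ ψ y * h y, contMDiff_of_tsupport fun y hy ↦ ?_, ?_⟩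
  · exact hψ.contMDiffAt.mul
      (hh y (hsupp (tsupport_mul_subset_left hy)))
  · have h1 : (fun y ↦ ψ y * h y) =ᶠ[𝓝 x] h := by
      filter_upwards [hone] with y hy
      simp [hy]
    -- The tangent space at `x` is identified with the model through the preferred chart at `x`, in
    -- which `h` is the linear function `β` itself.
    have h3 : writtenInExtChartAt (𝓡 n) 𝓘(ℝ) x h =ᶠ[𝓝 (extChartAt (𝓡 n) x x)] β := by
      filter_upwards [extChartAt_target_mem_nhds (I := 𝓡 n) x] with y hy
      simp only [writtenInExtChartAt, h, Function.comp_apply, extChartAt_model_space_eq_id]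
      rw [(extChartAt (𝓡 n) x).right_inv hy]
      rfl
    have h2 : HasMFDerivAt (𝓡 n) 𝓘(ℝ) h x β :=
      ⟨(hh x (mem_chart_source _ x)).continuousAt,
        (β.hasFDerivAt.congr_of_eventuallyEq h3).hasFDerivWithinAt⟩
    ext v
    simp only [mvfderiv, h1.mfderiv_eq, h2.mfderiv]
    rfl

end SmoothSections

/-! ## Semi-Riemannian metrics -/

section Metric

open Filter
open scoped Topology

variable {n : ℕ} {M : Type*} [TopologicalSpace M] [ChartedSpace (EuclideanSpace ℝ (Fin n)) M]

/-- `frame x` as a basis. -/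
def frameBasis (x : M) : Module.Basis (Fin n) ℝ (TangentSpace (𝓡 n) x) :=
  (EuclideanSpace.basisFun (Fin n) ℝ).toBasis

@[simp]
theorem frameBasis_apply (x : M) (i : Fin n) : frameBasis x i = frame x i := by
  change (EuclideanSpace.basisFun (Fin n) ℝ).toBasis i = _
  simp [frame]

theorem finiteDimensional_tangentSpace (x : M) :
    FiniteDimensional ℝ (TangentSpace (𝓡 n) x) :=
  (frameBasis x).finiteDimensional_of_finite

theorem coframe_frame (x : M) (i j : Fin n) :
    coframe x i (frame x j) = if i = j then 1 else 0 := by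
  change (EuclideanSpace.proj i : EuclideanSpace ℝ (Fin n) →L[ℝ] ℝ)
    (EuclideanSpace.single j (1 : ℝ)) = _
  simp

variable [IsManifold (𝓡 n) ∞ M]

namespace SemiRiemannianMetric

variable (g : SemiRiemannianMetric n M)

/-- The Gram matrix of a family of tangent vectors. -/
def gramOf {x : M} (b : Fin n → TangentSpace (𝓡 n) x) : Matrix (Fin n) (Fin n) ℝ :=
  Matrix.of fun i j ↦ g.inner x (b i) (b j)

theorem gram_eq_gramOf (x : M) : g.gram x = g.gramOf (frame x) := rfl

/-- The metric at `x` as a bilinear form. -/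
def form (x : M) : LinearMap.BilinForm ℝ (TangentSpace (𝓡 n) x) :=
  LinearMap.mk₂ ℝ (fun u v ↦ g.inner x u v) (by simp) (by simp) (by simp) (by simp)

@[simp]
theorem form_apply (x : M) (u v : TangentSpace (𝓡 n) x) : g.form x u v = g.inner x u v := rfl

theorem gramOf_eq_toMatrix {x : M} (b : Module.Basis (Fin n) ℝ (TangentSpace (𝓡 n) x)) :
    g.gramOf b = LinearMap.BilinForm.toMatrix b (g.form x) := by
  ext i j
  simp [gramOf]

theorem form_nondegenerate (x : M) : (g.form x).Nondegenerate := by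
  refine ⟨fun u h ↦ g.nondegenerate x u h, fun u h ↦ g.nondegenerate x u fun v ↦ ?_⟩
  rw [g.symm]
  exact h v

theorem det_gramOf_ne_zero {x : M} (b : Module.Basis (Fin n) ℝ (TangentSpace (𝓡 n) x)) :
    (g.gramOf b).det ≠ 0 := by
  rw [gramOf_eq_toMatrix]
  exact (LinearMap.BilinForm.nondegenerate_iff_det_ne_zero b).1 (g.form_nondegenerate x)

theorem det_gram_ne_zero (x : M) : (g.gram x).det ≠ 0 := by
  have := g.det_gramOf_ne_zero (frameBasis x)
  rwa [show (⇑(frameBasis x) : Fin n → TangentSpace (𝓡 n) x) = frame x from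
    funext (frameBasis_apply x)] at this

theorem ext_inner {x : M} {u v : TangentSpace (𝓡 n) x}
    (h : ∀ w, g.inner x u w = g.inner x v w) : u = v := by
  refine sub_eq_zero.1 (g.nondegenerate x _ fun w ↦ ?_)
  simp [h w]

/-- A family with nonsingular Gram matrix is a basis. -/
theorem exists_basis_of_det_ne_zero {x : M} (b : Fin n → TangentSpace (𝓡 n) x)
    (h : (g.gramOf b).det ≠ 0) :
    ∃ b' : Module.Basis (Fin n) ℝ (TangentSpace (𝓡 n) x), ⇑b' = b := by
  have := finiteDimensional_tangentSpace (n := n) x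
  have hli : LinearIndependent ℝ b := by
    rw [Fintype.linearIndependent_iff]
    intro c hc
    have h1 : Matrix.vecMul c (g.gramOf b) = 0 := by
      funext j
      have : g.inner x (∑ i, c i • b i) (b j) = 0 := by rw [hc]; simp
      simpa [Matrix.vecMul, dotProduct, gramOf] using this
    have h2 := Matrix.eq_zero_of_vecMul_eq_zero h h1
    exact fun i ↦ congrFun h2 i
  have hcard : Fintype.card (Fin n) = Module.finrank ℝ (TangentSpace (𝓡 n) x) :=
    (Module.finrank_eq_card_basis (frameBasis x)).symm
  -- `basisOfLinearIndependentOfCardEqFinrank` needs a nonempty index type.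
  cases n with
  | zero =>
    refine ⟨frameBasis x, funext fun i ↦ i.elim0⟩
  | succ m => exact ⟨basisOfLinearIndependentOfCardEqFinrank hli hcard, by simp⟩

theorem exists_orthogonal_basis (x : M) :
    ∃ (e : Module.Basis (Fin n) ℝ (TangentSpace (𝓡 n) x)) (d : Fin n → ℝ),
      (∀ i, d i ≠ 0) ∧ ∀ i j, g.inner x (e i) (e j) = if i = j then d i else 0 := by
  have := finiteDimensional_tangentSpace (n := n) x
  have hfin : Module.finrank ℝ (TangentSpace (𝓡 n) x) = n := by
    rw [Module.finrank_eq_card_basis (frameBasis x), Fintype.card_fin]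
  obtain ⟨v, hv⟩ := LinearMap.BilinForm.exists_orthogonal_basis
    (B := g.form x) ⟨fun u v ↦ g.symm x u v⟩
  let e := v.reindex (finCongr hfin)
  have he : ∀ i j, i ≠ j → g.inner x (e i) (e j) = 0 := fun i j hij ↦ by
    have := hv (i := (finCongr hfin).symm i) (j := (finCongr hfin).symm j) (by simpa using hij)
    simpa [e] using this
  have hg : ∀ i j, g.inner x (e i) (e j) = if i = j then g.inner x (e i) (e i) else 0 :=
    fun i j ↦ by
      split_ifs with h
      · rw [h]
      · exact he i j h
  refine ⟨e, fun i ↦ g.inner x (e i) (e i), fun i hi ↦ ?_, hg⟩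
  -- A null vector in an orthogonal basis would be a zero row of the Gram matrix.
  refine g.det_gramOf_ne_zero e (Matrix.det_eq_zero_of_row_eq_zero i fun j ↦ ?_)
  simp [gramOf, hg i j, hi]

variable {W : Type*} [AddCommGroup W] [Module ℝ W]

/-- The metric contraction `∑ g^{ij} B(e_i, e_j)` of a bilinear map. -/
def contract (x : M) (B : TangentSpace (𝓡 n) x →ₗ[ℝ] TangentSpace (𝓡 n) x →ₗ[ℝ] W) : W :=
  ∑ i, ∑ j, (g.gram x)⁻¹ i j • B (frame x i) (frame x j)

/-- The Gram matrix changes by congruence, and its inverse contragrediently to the basis vectors.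
This lets orthogonal bases, and smooth local frames, replace the coordinate basis `frame x`. -/
theorem contract_eq_of_basis {x : M} (b : Module.Basis (Fin n) ℝ (TangentSpace (𝓡 n) x))
    (B : TangentSpace (𝓡 n) x →ₗ[ℝ] TangentSpace (𝓡 n) x →ₗ[ℝ] W) :
    g.contract x B = ∑ i, ∑ j, (g.gramOf b)⁻¹ i j • B (b i) (b j) := by
  let Q := b.toMatrix (frame x)
  let G := g.gramOf b
  have hf : ∀ j, frame x j = ∑ i, Q i j • b i := fun j ↦ (b.sum_toMatrix_smul_self _ j).symm
  have hQ : IsUnit Q.det := by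
    have : Q = b.toMatrix (frameBasis x) := by
      ext i j
      simp [Q, Module.Basis.toMatrix_apply]
    rw [this]
    exact Matrix.isUnit_det_of_right_inverse (b.toMatrix_mul_toMatrix_flip (frameBasis x))
  have hG : IsUnit G.det := (g.det_gramOf_ne_zero b).isUnit
  have hgram : g.gram x = Q.transpose * G * Q := by
    ext i j
    simp only [gram, Matrix.of_apply, hf, map_sum, map_smul, sum_apply,
      smul_apply, smul_eq_mul, Matrix.mul_apply, Matrix.transpose_apply,
      Finset.sum_mul, G, gramOf, Finset.mul_sum]
    exact Finset.sum_congr rfl fun k _ ↦ Finset.sum_congr rfl fun l _ ↦ by ring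
  have hinv : Q * (g.gram x)⁻¹ * Q.transpose = G⁻¹ := by
    rw [hgram, Matrix.mul_inv_rev, Matrix.mul_inv_rev, ← Matrix.mul_assoc,
      Matrix.mul_nonsing_inv _ hQ, Matrix.one_mul, Matrix.mul_assoc,
      Matrix.nonsing_inv_mul _ (by rwa [Matrix.det_transpose]), Matrix.mul_one]
  have h1 : ∀ i j, (g.gram x)⁻¹ i j • B (frame x i) (frame x j)
      = ∑ k, ∑ l, (Q k i * (g.gram x)⁻¹ i j * Q l j) • B (b k) (b l) := fun i j ↦ by
    simp only [hf, map_sum, map_smul, LinearMap.sum_apply, LinearMap.smul_apply, Finset.smul_sum,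
      smul_smul]
    rw [Finset.sum_comm]
    exact Finset.sum_congr rfl fun k _ ↦ Finset.sum_congr rfl fun l _ ↦ by congr 1; ring
  have h2 : ∀ k l, (g.gramOf b)⁻¹ k l = ∑ i, ∑ j, Q k i * (g.gram x)⁻¹ i j * Q l j :=
    fun k l ↦ by
      change G⁻¹ k l = _
      rw [← hinv]
      simp only [Matrix.mul_apply, Matrix.transpose_apply, Finset.sum_mul]
      rw [Finset.sum_comm]
  simp only [contract, h1, h2, Finset.sum_smul]
  calc _ = ∑ i, ∑ k, ∑ j, ∑ l, (Q k i * (g.gram x)⁻¹ i j * Q l j) • B (b k) (b l) :=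
        Finset.sum_congr rfl fun i _ ↦ Finset.sum_comm
    _ = ∑ k, ∑ i, ∑ j, ∑ l, (Q k i * (g.gram x)⁻¹ i j * Q l j) • B (b k) (b l) :=
        Finset.sum_comm
    _ = ∑ k, ∑ i, ∑ l, ∑ j, (Q k i * (g.gram x)⁻¹ i j * Q l j) • B (b k) (b l) :=
        Finset.sum_congr rfl fun k _ ↦ Finset.sum_congr rfl fun i _ ↦ Finset.sum_comm
    _ = _ := Finset.sum_congr rfl fun k _ ↦ Finset.sum_comm

theorem contract_eq_of_orthogonal {x : M} (e : Module.Basis (Fin n) ℝ (TangentSpace (𝓡 n) x))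
    (d : Fin n → ℝ) (hd : ∀ i, d i ≠ 0)
    (he : ∀ i j, g.inner x (e i) (e j) = if i = j then d i else 0)
    (B : TangentSpace (𝓡 n) x →ₗ[ℝ] TangentSpace (𝓡 n) x →ₗ[ℝ] W) :
    g.contract x B = ∑ i, (d i)⁻¹ • B (e i) (e i) := by
  have hG : g.gramOf e = Matrix.diagonal d := by
    ext i j
    rw [gramOf, Matrix.of_apply, he, Matrix.diagonal_apply]
  have hinv : (g.gramOf e)⁻¹ = Matrix.diagonal fun i ↦ (d i)⁻¹ := by
    rw [hG]
    refine Matrix.inv_eq_right_inv ?_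
    rw [Matrix.diagonal_mul_diagonal, ← Matrix.diagonal_one]
    congr 1
    funext i
    exact mul_inv_cancel₀ (hd i)
  rw [contract_eq_of_basis g e, hinv]
  refine Finset.sum_congr rfl fun i _ ↦ ?_
  rw [Finset.sum_eq_single i (fun j _ hj ↦ by simp [hj.symm]) (by simp)]
  simp

theorem eq_sum_of_orthogonal {x : M} (e : Module.Basis (Fin n) ℝ (TangentSpace (𝓡 n) x))
    (d : Fin n → ℝ) (hd : ∀ i, d i ≠ 0)
    (he : ∀ i j, g.inner x (e i) (e j) = if i = j then d i else 0)
    (w : TangentSpace (𝓡 n) x) : w = ∑ i, ((d i)⁻¹ * g.inner x (e i) w) • e i := by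
  conv_lhs => rw [← e.sum_repr w]
  refine Finset.sum_congr rfl fun i _ ↦ ?_
  congr 1
  conv_rhs => rw [← e.sum_repr w]
  simp only [map_sum, map_smul, he, smul_eq_mul]
  simp [mul_comm, hd i]

/-- Contracting with the metric. -/
theorem contract_inner_smul {x : M} (w : TangentSpace (𝓡 n) x)
    (a : TangentSpace (𝓡 n) x →ₗ[ℝ] W) (B : TangentSpace (𝓡 n) x →ₗ[ℝ] TangentSpace (𝓡 n) x →ₗ[ℝ] W)
    (hB : ∀ u v, B u v = g.inner x u w • a v) : g.contract x B = a w := by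
  obtain ⟨e, d, hd, he⟩ := g.exists_orthogonal_basis x
  rw [g.contract_eq_of_orthogonal e d hd he]
  conv_rhs => rw [g.eq_sum_of_orthogonal e d hd he w]
  simp [hB, smul_smul]

theorem coframe_eq_sum (x : M) (i : Fin n) :
    coframe x i = ∑ j, (g.gram x)⁻¹ i j • g.inner x (frame x j) := by
  refine ContinuousLinearMap.coe_injective ((frameBasis x).ext fun k ↦ ?_)
  have h := congrFun (congrFun (Matrix.nonsing_inv_mul _ (g.det_gram_ne_zero x).isUnit) i) k
  rw [Matrix.mul_apply, Matrix.one_apply] at h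
  simp only [frameBasis_apply, ContinuousLinearMap.coe_coe, coframe_frame, ← h]
  simp [gram]

end SemiRiemannianMetric

end Metric

/-! ### Smoothness of frames, contractions and gradients. -/

section MetricSmoothness

open Filter
open scoped Topology

variable {n : ℕ} {M : Type*} [TopologicalSpace M] [ChartedSpace (EuclideanSpace ℝ (Fin n)) M]

theorem contMDiffAt_det {m : ℕ} {x : M} (G : M → Matrix (Fin m) (Fin m) ℝ)
    (hG : ∀ i j, ContMDiffAt (𝓡 n) 𝓘(ℝ) ∞ (fun y ↦ G y i j) x) :
    ContMDiffAt (𝓡 n) 𝓘(ℝ) ∞ (fun y ↦ (G y).det) x := by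
  simp only [Matrix.det_apply']
  exact contMDiffAt_finsetSum fun σ _ ↦ contMDiffAt_const.mul
    (contMDiffAt_finsetProd fun i _ ↦ hG _ _)

/-- By Cramer's rule the entries are determinants divided by a nonvanishing determinant. -/
theorem contMDiffAt_inv_apply {m : ℕ} {x : M} (G : M → Matrix (Fin m) (Fin m) ℝ)
    (hG : ∀ i j, ContMDiffAt (𝓡 n) 𝓘(ℝ) ∞ (fun y ↦ G y i j) x) (hx : (G x).det ≠ 0)
    (i j : Fin m) : ContMDiffAt (𝓡 n) 𝓘(ℝ) ∞ (fun y ↦ (G y)⁻¹ i j) x := by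
  have h : (fun y ↦ (G y)⁻¹ i j) = fun y ↦ ((G y).det)⁻¹ * (G y).adjugate i j := by
    funext y
    rw [Matrix.inv_def, Matrix.smul_apply, Ring.inverse_eq_inv', smul_eq_mul]
  rw [h]
  refine ((contMDiffAt_det G hG).inv₀ hx).mul ?_
  simp only [Matrix.adjugate_apply]
  refine contMDiffAt_det _ fun k l ↦ ?_
  simp only [Matrix.updateRow_apply]
  split_ifs
  · exact contMDiffAt_const
  · exact hG k l

variable [IsManifold (𝓡 n) ∞ M]

namespace SemiRiemannianMetric

variable (g : SemiRiemannianMetric n M)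

theorem contMDiffAt_inner {x : M} {X Y : ∀ y : M, TangentSpace (𝓡 n) y}
    (hX : ContMDiffAt (𝓡 n) ((𝓡 n).prod 𝓘(ℝ, EuclideanSpace ℝ (Fin n))) ∞
      (fun y ↦ TotalSpace.mk' (EuclideanSpace ℝ (Fin n)) y (X y)) x)
    (hY : ContMDiffAt (𝓡 n) ((𝓡 n).prod 𝓘(ℝ, EuclideanSpace ℝ (Fin n))) ∞
      (fun y ↦ TotalSpace.mk' (EuclideanSpace ℝ (Fin n)) y (Y y)) x) :
    ContMDiffAt (𝓡 n) 𝓘(ℝ) ∞ (fun y ↦ g.inner y (X y) (Y y)) x := by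
  have : ContMDiffAt (𝓡 n) ((𝓡 n).prod 𝓘(ℝ)) ∞
      (fun y ↦ TotalSpace.mk' ℝ (E := Bundle.Trivial M ℝ) y (g.inner y (X y) (Y y))) x :=
    ContMDiffAt.clm_bundle_apply₂ (F₁ := EuclideanSpace ℝ (Fin n))
      (F₂ := EuclideanSpace ℝ (Fin n)) g.contMDiff.contMDiffAt hX hY
  simp only [contMDiffAt_totalSpace] at this
  exact this.2

theorem contMDiff_inner {X Y : ∀ y : M, TangentSpace (𝓡 n) y} (hX : SmoothField X)
    (hY : SmoothField Y) : ContMDiff (𝓡 n) 𝓘(ℝ) ∞ (fun y ↦ g.inner y (X y) (Y y)) :=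
  fun x ↦ g.contMDiffAt_inner (hX x) (hY x)

theorem mdifferentiableAt_inner {x : M} {X Y : ∀ y : M, TangentSpace (𝓡 n) y}
    (hX : MDifferentiableAt (𝓡 n) ((𝓡 n).prod 𝓘(ℝ, EuclideanSpace ℝ (Fin n)))
      (fun y ↦ TotalSpace.mk' (EuclideanSpace ℝ (Fin n)) y (X y)) x)
    (hY : MDifferentiableAt (𝓡 n) ((𝓡 n).prod 𝓘(ℝ, EuclideanSpace ℝ (Fin n)))
      (fun y ↦ TotalSpace.mk' (EuclideanSpace ℝ (Fin n)) y (Y y)) x) :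
    MDifferentiableAt (𝓡 n) 𝓘(ℝ) (fun y ↦ g.inner y (X y) (Y y)) x := by
  have : MDifferentiableAt (𝓡 n) ((𝓡 n).prod 𝓘(ℝ))
      (fun y ↦ TotalSpace.mk' ℝ (E := Bundle.Trivial M ℝ) y (g.inner y (X y) (Y y))) x :=
    MDifferentiableAt.clm_bundle_apply₂ (F₁ := EuclideanSpace ℝ (Fin n))
      (F₂ := EuclideanSpace ℝ (Fin n)) (g.contMDiff.mdifferentiableAt (by simp)) hX hY
  rw [mdifferentiableAt_totalSpace] at this
  exact this.2

/-- Every covector is of the form `g(u, ·)`. -/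
theorem exists_inner_eq (x : M) (α : TangentSpace (𝓡 n) x →L[ℝ] ℝ) :
    ∃ u, g.inner x u = α := by
  obtain ⟨e, d, hd, he⟩ := g.exists_orthogonal_basis x
  refine ⟨∑ i, ((d i)⁻¹ * α (e i)) • e i,
    ContinuousLinearMap.coe_injective (e.ext fun j ↦ ?_)⟩
  simp only [ContinuousLinearMap.coe_coe, map_sum, map_smul, sum_apply, smul_apply, he, smul_eq_mul]
  simp [mul_comm, hd j]

/-- The gradient of a function. -/
def grad (f : M → ℝ) (x : M) : TangentSpace (𝓡 n) x :=
  (g.exists_inner_eq x (mvfderiv (𝓡 n) f x)).choose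

theorem inner_grad (f : M → ℝ) (x : M) : g.inner x (g.grad f x) = mvfderiv (𝓡 n) f x :=
  (g.exists_inner_eq x (mvfderiv (𝓡 n) f x)).choose_spec

variable [T2Space M]

/-- Smooth vector fields that form a basis near a given point. -/
theorem exists_smooth_frame (x : M) :
    ∃ X : Fin n → ∀ y : M, TangentSpace (𝓡 n) y, (∀ i, SmoothField (X i)) ∧
      (∀ i, X i x = frame x i) ∧ ∀ᶠ y in 𝓝 x, (g.gramOf fun i ↦ X i y).det ≠ 0 := by
  choose X hX _ hXx using fun i ↦
    exists_contMDiff_extend (n := n) (F := EuclideanSpace ℝ (Fin n)) x (frame (n := n) x i)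
  refine ⟨X, hX, hXx, ?_⟩
  have hc : ContMDiffAt (𝓡 n) 𝓘(ℝ) ∞ (fun y ↦ (g.gramOf fun i ↦ X i y).det) x :=
    contMDiffAt_det _ fun i j ↦ g.contMDiffAt_inner (hX i x) (hX j x)
  refine hc.continuousAt.eventually_ne ?_
  simp only [hXx]
  exact g.det_gram_ne_zero x

/-- The contraction of a smooth bundle-valued bilinear form is smooth. -/
theorem contMDiff_contract {F : Type*} [NormedAddCommGroup F] [NormedSpace ℝ F]
    {V : M → Type*} [TopologicalSpace (TotalSpace F V)]
    [∀ x, AddCommGroup (V x)] [∀ x, Module ℝ (V x)] [∀ x, TopologicalSpace (V x)]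
    [FiberBundle F V] [VectorBundle ℝ F V]
    (B : ∀ y : M, TangentSpace (𝓡 n) y →ₗ[ℝ] TangentSpace (𝓡 n) y →ₗ[ℝ] V y)
    (hB : ∀ X Y : ∀ y : M, TangentSpace (𝓡 n) y, SmoothField X → SmoothField Y →
      ContMDiff (𝓡 n) ((𝓡 n).prod 𝓘(ℝ, F)) ∞ (fun y ↦ TotalSpace.mk' F y (B y (X y) (Y y)))) :
    ContMDiff (𝓡 n) ((𝓡 n).prod 𝓘(ℝ, F)) ∞ (fun y ↦ TotalSpace.mk' F y (g.contract y (B y))) := by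
  intro x
  obtain ⟨X, hX, hXx, hdet⟩ := g.exists_smooth_frame x
  -- The basis `frame y` comes from the preferred chart at `y` and need not depend continuously on
  -- `y`; basis independence allows the smooth frame `X` instead.
  have h : ∀ᶠ y in 𝓝 x, g.contract y (B y)
      = ∑ i, ∑ j, (g.gramOf fun i ↦ X i y)⁻¹ i j • B y (X i y) (X j y) := by
    filter_upwards [hdet] with y hy
    obtain ⟨b, hb⟩ := g.exists_basis_of_det_ne_zero _ hy
    rw [g.contract_eq_of_basis b, hb]
  have hs : ContMDiffAt (𝓡 n) ((𝓡 n).prod 𝓘(ℝ, F)) ∞ (fun y ↦ TotalSpace.mk' F y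
      (∑ i, ∑ j, (g.gramOf fun i ↦ X i y)⁻¹ i j • B y (X i y) (X j y))) x := by
    refine ContMDiffAt.sum_section fun i _ ↦ ContMDiffAt.sum_section fun j _ ↦ ?_
    exact (contMDiffAt_inv_apply _ (fun i j ↦ g.contMDiffAt_inner (hX i x) (hX j x))
      hdet.self_of_nhds i j).smul_section (hB _ _ (hX i) (hX j) x)
  refine hs.congr_of_eventuallyEq ?_
  filter_upwards [h] with y hy
  rw [hy]

/-- A vector field is smooth if its inner products with smooth vector fields are. -/
theorem smoothField_of_inner (Y : ∀ y : M, TangentSpace (𝓡 n) y)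
    (hY : ∀ Z : ∀ y : M, TangentSpace (𝓡 n) y, SmoothField Z →
      ContMDiff (𝓡 n) 𝓘(ℝ) ∞ (fun y ↦ g.inner y (Y y) (Z y))) : SmoothField Y := by
  -- Contracting `g(u, Y) v` over `u` and `v` returns `Y`, and this form is smooth on smooth fields
  -- by assumption.
  let B := fun y : M ↦ LinearMap.mk₂ ℝ
    (fun u v : TangentSpace (𝓡 n) y ↦ g.inner y u (Y y) • v) (fun u v w ↦ by simp [add_smul])
    (fun c u v ↦ by simp [mul_smul]) (fun u v w ↦ by simp) (fun c u v ↦ smul_comm _ _ _)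
  have h := g.contMDiff_contract (F := EuclideanSpace ℝ (Fin n)) B fun X Z hX hZ ↦ by
    have h1 := hY X hX
    simp only [fun y ↦ g.symm y (Y y) (X y)] at h1
    exact h1.smul_section hZ
  have h2 : ∀ y, g.contract y (B y) = Y y := fun y ↦
    g.contract_inner_smul (Y y) LinearMap.id (B y) fun u v ↦ rfl
  simp only [h2] at h
  exact h

end SemiRiemannianMetric

theorem contMDiffAt_mvfderiv {x : M} {f : M → ℝ} (hf : ContMDiffAt (𝓡 n) 𝓘(ℝ) ∞ f x)
    {X : ∀ y : M, TangentSpace (𝓡 n) y}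
    (hX : ContMDiffAt (𝓡 n) ((𝓡 n).prod 𝓘(ℝ, EuclideanSpace ℝ (Fin n))) ∞
      (fun y ↦ TotalSpace.mk' (EuclideanSpace ℝ (Fin n)) y (X y)) x) :
    ContMDiffAt (𝓡 n) 𝓘(ℝ) ∞ (fun y ↦ mvfderiv (𝓡 n) f y (X y)) x := by
  have h := ContMDiffAt.clm_apply_of_inCoordinates (F₂ := ℝ) (E₂ := TangentSpace 𝓘(ℝ)) (b₂ := f)
    (hf.mfderiv_const (m := ∞) (by simp)) hX hf
  rw [contMDiffAt_totalSpace] at h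
  have h2 := h.2
  simp only [trivializationAt_model_space_apply] at h2
  exact h2

namespace SemiRiemannianMetric

variable (g : SemiRiemannianMetric n M) [T2Space M]

theorem smoothField_grad {f : M → ℝ} (hf : ContMDiff (𝓡 n) 𝓘(ℝ) ∞ f) :
    SmoothField (g.grad f) := by
  refine g.smoothField_of_inner _ fun Z hZ x ↦ ?_
  simp only [inner_grad]
  exact contMDiffAt_mvfderiv (hf x) (hZ x)

end SemiRiemannianMetric

end MetricSmoothness

/-! ## The Levi-Civita connection -/

section LeviCivita

open Filter VectorField
open scoped Topology

variable {n : ℕ} {M : Type*} [TopologicalSpace M] [ChartedSpace (EuclideanSpace ℝ (Fin n)) M]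
  [IsManifold (𝓡 n) ∞ M]

theorem isManifold_minSmoothness (k : ℕ) : IsManifold (𝓡 n) (minSmoothness ℝ k) M := by
  rw [minSmoothness_of_isRCLikeNormedField]
  exact IsManifold.of_le (n := ∞) (mod_cast le_top)

theorem smoothField_mlieBracket {X Y : ∀ y : M, TangentSpace (𝓡 n) y} (hX : SmoothField X)
    (hY : SmoothField Y) : SmoothField (mlieBracket (𝓡 n) X Y) := by
  have : IsManifold (𝓡 n) (minSmoothness ℝ 2) M := isManifold_minSmoothness 2
  have : IsManifold (𝓡 n) (((⊤ : ℕ∞) : WithTop ℕ∞) + 1) M := by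
    rw [show ((⊤ : ℕ∞) : WithTop ℕ∞) + 1 = ∞ from rfl]
    infer_instance
  exact fun y ↦ (hX y).mlieBracket_vectorField (n := ⊤) (m := ⊤) (hY y) (by simp)

/-- Differentiability of a vector field at a point. -/
abbrev FieldDiffAt (X : ∀ y : M, TangentSpace (𝓡 n) y) (x : M) : Prop :=
  MDifferentiableAt (𝓡 n) ((𝓡 n).prod 𝓘(ℝ, EuclideanSpace ℝ (Fin n)))
    (fun y ↦ TotalSpace.mk' (EuclideanSpace ℝ (Fin n)) y (X y)) x

namespace SemiRiemannianMetric

variable (g : SemiRiemannianMetric n M) {x : M} {X X' Y Y' Z Z' : ∀ y : M, TangentSpace (𝓡 n) y}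

theorem mvfderiv_inner_add_left (hX : FieldDiffAt X x) (hX' : FieldDiffAt X' x)
    (hY : FieldDiffAt Y x) (u : TangentSpace (𝓡 n) x) :
    mvfderiv (𝓡 n) (fun y ↦ g.inner y ((X + X') y) (Y y)) x u
      = mvfderiv (𝓡 n) (fun y ↦ g.inner y (X y) (Y y)) x u
        + mvfderiv (𝓡 n) (fun y ↦ g.inner y (X' y) (Y y)) x u := by
  have : (fun y ↦ g.inner y ((X + X') y) (Y y))
      = (fun y ↦ g.inner y (X y) (Y y)) + fun y ↦ g.inner y (X' y) (Y y) := by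
    funext y; simp
  rw [this, mvfderiv_add (g.mdifferentiableAt_inner hX hY) (g.mdifferentiableAt_inner hX' hY)]
  rfl

theorem mvfderiv_inner_smul_left {f : M → ℝ} (hf : MDifferentiableAt (𝓡 n) 𝓘(ℝ) f x)
    (hX : FieldDiffAt X x)
    (hY : FieldDiffAt Y x) (u : TangentSpace (𝓡 n) x) :
    mvfderiv (𝓡 n) (fun y ↦ g.inner y ((f • X) y) (Y y)) x u
      = f x * mvfderiv (𝓡 n) (fun y ↦ g.inner y (X y) (Y y)) x u
        + mvfderiv (𝓡 n) f x u * g.inner x (X x) (Y x) := by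
  have : (fun y ↦ g.inner y ((f • X) y) (Y y)) = f * fun y ↦ g.inner y (X y) (Y y) := by
    funext y; simp
  rw [this, mvfderiv_mul hf (g.mdifferentiableAt_inner hX hY)]
  simp [mul_comm]

theorem inner_comm_fun (X Y : ∀ y : M, TangentSpace (𝓡 n) y) :
    (fun y ↦ g.inner y (X y) (Y y)) = fun y ↦ g.inner y (Y y) (X y) :=
  funext fun y ↦ g.symm y _ _

/-- The derivatives of `f` produced by differentiating inner products cancel against those produced
by the Lie brackets. -/
theorem koszul_tensorial_left (hY : FieldDiffAt Y x) (hZ : FieldDiffAt Z x) :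
    TensorialAt (𝓡 n) (EuclideanSpace ℝ (Fin n)) (fun X ↦ g.koszul X Y Z x) x where
  smul {f X} hf hX := by
    simp only [koszul]
    rw [g.mvfderiv_inner_smul_left hf hX hZ, g.mvfderiv_inner_smul_left hf hX hY,
      mlieBracket_smul_left hf hX, mlieBracket_smul_left hf hX]
    simp
    ring
  add {X X'} hX hX' := by
    simp only [koszul]
    rw [g.mvfderiv_inner_add_left hX hX' hZ, g.mvfderiv_inner_add_left hX hX' hY,
      mlieBracket_add_left hX hX', mlieBracket_add_left hX hX']
    simp
    ring

theorem koszul_tensorial_right (hX : FieldDiffAt X x) (hY : FieldDiffAt Y x) :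
    TensorialAt (𝓡 n) (EuclideanSpace ℝ (Fin n)) (fun Z ↦ g.koszul X Y Z x) x where
  smul {f Z} hf hZ := by
    simp only [koszul]
    rw [g.inner_comm_fun Y, g.inner_comm_fun X (f • Z), g.mvfderiv_inner_smul_left hf hZ hX,
      g.mvfderiv_inner_smul_left hf hZ hY,
      mlieBracket_smul_right hf hZ, mlieBracket_smul_right hf hZ,
      g.inner_comm_fun Y Z, g.inner_comm_fun X Z, g.symm x (Z x) (X x), g.symm x (Z x) (Y x)]
    simp [g.symm x (Z x)]
    ring
  add {Z Z'} hZ hZ' := by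
    simp only [koszul]
    rw [g.inner_comm_fun Y, g.inner_comm_fun X (Z + Z'), g.mvfderiv_inner_add_left hZ hZ' hX,
      g.mvfderiv_inner_add_left hZ hZ' hY,
      mlieBracket_add_right hZ hZ', mlieBracket_add_right hZ hZ',
      g.inner_comm_fun Y Z, g.inner_comm_fun X Z, g.inner_comm_fun Y Z', g.inner_comm_fun X Z']
    simp
    ring

theorem koszul_add_middle (hX : FieldDiffAt X x) (hY : FieldDiffAt Y x)
    (hY' : FieldDiffAt Y' x) (hZ : FieldDiffAt Z x) :
    g.koszul X (Y + Y') Z x = g.koszul X Y Z x + g.koszul X Y' Z x := by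
  simp only [koszul]
  rw [g.mvfderiv_inner_add_left hY hY' hZ, g.inner_comm_fun X (Y + Y'),
    g.mvfderiv_inner_add_left hY hY' hX, mlieBracket_add_right hY hY', mlieBracket_add_left hY hY',
    g.inner_comm_fun Y X, g.inner_comm_fun Y' X]
  simp
  ring

/-- In the middle slot the terms in `Z f` cancel but those in `X f` double: this is where the
Leibniz rule of `leviCivita` comes from. -/
theorem koszul_smul_middle {f : M → ℝ} (hf : MDifferentiableAt (𝓡 n) 𝓘(ℝ) f x)
    (hX : FieldDiffAt X x)
    (hY : FieldDiffAt Y x) (hZ : FieldDiffAt Z x) :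
    g.koszul X (f • Y) Z x
      = f x * g.koszul X Y Z x + 2 * (mvfderiv (𝓡 n) f x (X x) * g.inner x (Y x) (Z x)) := by
  simp only [koszul]
  rw [g.mvfderiv_inner_smul_left hf hY hZ, g.inner_comm_fun X (f • Y),
    g.mvfderiv_inner_smul_left hf hY hX, mlieBracket_smul_right hf hY, mlieBracket_smul_left hf hY,
    g.inner_comm_fun Y X]
  simp [g.symm x (Y x) (X x)]
  ring

/-- The Levi-Civita derivative satisfies the Koszul formula for all differentiable fields. -/
theorem inner_leviCivita (hX : FieldDiffAt X x) (hY : FieldDiffAt Y x) (hZ : FieldDiffAt Z x) :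
    2 * g.inner x (g.leviCivita Y x (X x)) (Z x) = g.koszul X Y Z x := by
  have hU : ∀ u : TangentSpace (𝓡 n) x,
      FieldDiffAt (FiberBundle.extend (EuclideanSpace ℝ (Fin n)) u) x := fun u ↦
    FiberBundle.mdifferentiableAt_extend (𝓡 n) (EuclideanSpace ℝ (Fin n)) u
  -- The definition of `leviCivita` extends both outer arguments. In the last slot the tensor `L`
  -- removes the dependence on the extension; in the first slot `U` is exchanged for `X` at the end,
  -- by tensoriality.
  let U : ∀ y : M, TangentSpace (𝓡 n) y := FiberBundle.extend (EuclideanSpace ℝ (Fin n)) (X x)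
  let L := TensorialAt.mkHom _ x (g.koszul_tensorial_right (X := U) (hU _) hY)
  have hL : ∀ {Z : ∀ y : M, TangentSpace (𝓡 n) y}, FieldDiffAt Z x → L (Z x) = g.koszul U Y Z x :=
    fun hZ ↦ TensorialAt.mkHom_apply _ hZ
  have h1 : (2 : ℝ) • g.inner x (g.leviCivita Y x (X x)) = L := by
    refine ContinuousLinearMap.coe_injective ((frameBasis x).ext fun m ↦ ?_)
    have h2 : ∀ l, g.koszul U Y
        (FiberBundle.extend (EuclideanSpace ℝ (Fin n)) (frame x l)) x = L (frame x l) := fun l ↦ by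
      rw [← hL (hU _), FiberBundle.extend_apply_self]
    have h3 : ∀ l, ∑ k, (g.gram x)⁻¹ k l * g.inner x (frame x k) (frame x m)
        = if m = l then 1 else 0 := fun l ↦ by
      have h := congrFun (congrFun (Matrix.mul_nonsing_inv _ (g.det_gram_ne_zero x).isUnit) m) l
      rw [Matrix.mul_apply, Matrix.one_apply] at h
      rw [← h]
      refine Finset.sum_congr rfl fun k _ ↦ ?_
      rw [mul_comm, g.symm]
      rfl
    simp only [frameBasis_apply, ContinuousLinearMap.coe_coe, leviCivita, U] at h2 ⊢
    simp only [h2, map_sum, map_smul, sum_apply, smul_apply, smul_eq_mul, Finset.sum_mul]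
    rw [Finset.sum_comm]
    have h4 : ∀ l, ∑ k, (g.gram x)⁻¹ k l * (L (frame x l) / 2) * g.inner x (frame x k) (frame x m)
        = (if m = l then 1 else 0) * (L (frame x l) / 2) := fun l ↦ by
      rw [← h3, Finset.sum_mul]
      exact Finset.sum_congr rfl fun k _ ↦ by ring
    rw [Finset.sum_congr rfl fun l _ ↦ h4 l]
    simp
    ring
  have h5 := congrArg (fun l ↦ l (Z x)) h1
  simp only [smul_apply, smul_eq_mul, hL hZ] at h5
  rw [h5]
  exact (g.koszul_tensorial_left hY hZ).pointwise (hU _) hX (by simp [U])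

/-- The factor 2 matches the left side of `inner_leviCivita`. -/
theorem leviCivita_ext {u w : TangentSpace (𝓡 n) x}
    (h : ∀ Z : ∀ y : M, TangentSpace (𝓡 n) y, FieldDiffAt Z x →
      2 * g.inner x u (Z x) = 2 * g.inner x w (Z x)) : u = w := by
  refine g.ext_inner fun v ↦ ?_
  have := h _ (FiberBundle.mdifferentiableAt_extend (𝓡 n) (EuclideanSpace ℝ (Fin n)) v)
  rw [FiberBundle.extend_apply_self] at this
  linarith

theorem exists_field (x : M) (u : TangentSpace (𝓡 n) x) :
    ∃ X : ∀ y : M, TangentSpace (𝓡 n) y, FieldDiffAt X x ∧ X x = u :=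
  ⟨_, FiberBundle.mdifferentiableAt_extend (𝓡 n) (EuclideanSpace ℝ (Fin n)) u,
    FiberBundle.extend_apply_self _ _⟩

theorem leviCivita_add_left (hY : FieldDiffAt Y x) (u v : TangentSpace (𝓡 n) x) :
    g.leviCivita Y x (u + v) = g.leviCivita Y x u + g.leviCivita Y x v := by
  obtain ⟨X, hX, rfl⟩ := exists_field x u
  obtain ⟨X', hX', rfl⟩ := exists_field x v
  refine g.leviCivita_ext fun Z hZ ↦ ?_
  have h1 := g.inner_leviCivita (mdifferentiableAt_add_section hX hX') hY hZ
  rw [(g.koszul_tensorial_left hY hZ).add hX hX', ← g.inner_leviCivita hX hY hZ,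
    ← g.inner_leviCivita hX' hY hZ] at h1
  rw [map_add, add_apply, mul_add]
  exact h1

theorem leviCivita_smul_left (hY : FieldDiffAt Y x) (c : ℝ) (u : TangentSpace (𝓡 n) x) :
    g.leviCivita Y x (c • u) = c • g.leviCivita Y x u := by
  obtain ⟨X, hX, rfl⟩ := exists_field x u
  refine g.leviCivita_ext fun Z hZ ↦ ?_
  have hc : MDifferentiableAt (𝓡 n) 𝓘(ℝ) (fun _ : M ↦ c) x := mdifferentiableAt_const
  have h1 := g.inner_leviCivita (hc.smul_section hX) hY hZ
  rw [(g.koszul_tensorial_left hY hZ).smul hc hX, ← g.inner_leviCivita hX hY hZ] at h1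
  rw [map_smul, smul_apply, smul_eq_mul]
  refine h1.trans ?_
  rw [smul_eq_mul]
  ring

theorem leviCivita_add (hY : FieldDiffAt Y x) (hY' : FieldDiffAt Y' x)
    (u : TangentSpace (𝓡 n) x) :
    g.leviCivita (Y + Y') x u = g.leviCivita Y x u + g.leviCivita Y' x u := by
  obtain ⟨X, hX, rfl⟩ := exists_field x u
  refine g.leviCivita_ext fun Z hZ ↦ ?_
  rw [g.inner_leviCivita hX (mdifferentiableAt_add_section hY hY') hZ,
    g.koszul_add_middle hX hY hY' hZ, ← g.inner_leviCivita hX hY hZ,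
    ← g.inner_leviCivita hX hY' hZ]
  simp
  ring

theorem leviCivita_smul {f : M → ℝ} (hf : MDifferentiableAt (𝓡 n) 𝓘(ℝ) f x) (hY : FieldDiffAt Y x)
    (u : TangentSpace (𝓡 n) x) :
    g.leviCivita (f • Y) x u = f x • g.leviCivita Y x u + mvfderiv (𝓡 n) f x u • Y x := by
  obtain ⟨X, hX, rfl⟩ := exists_field x u
  refine g.leviCivita_ext fun Z hZ ↦ ?_
  rw [g.inner_leviCivita hX (hf.smul_section hY) hZ,
    g.koszul_smul_middle hf hX hY hZ, ← g.inner_leviCivita hX hY hZ]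
  simp
  ring

/-- The Levi-Civita connection is metric. -/
theorem mvfderiv_inner (hY : FieldDiffAt Y x) (hZ : FieldDiffAt Z x)
    (u : TangentSpace (𝓡 n) x) :
    mvfderiv (𝓡 n) (fun y ↦ g.inner y (Y y) (Z y)) x u
      = g.inner x (g.leviCivita Y x u) (Z x) + g.inner x (Y x) (g.leviCivita Z x u) := by
  obtain ⟨X, hX, rfl⟩ := exists_field x u
  have h1 := g.inner_leviCivita hX hY hZ
  have h2 := g.inner_leviCivita hX hZ hY
  rw [g.symm x (Y x)]
  -- In the sum of the Koszul expressions for `(X, Y, Z)` and `(X, Z, Y)` everything cancels except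
  -- twice the derivative of `g(Y, Z)` along `X`.
  simp only [koszul] at h1 h2
  rw [g.inner_comm_fun Z Y, mlieBracket_swap_apply (V := Z) (W := Y)] at h2
  simp only [map_neg, neg_apply] at h2
  linarith

/-- The Levi-Civita connection is torsion-free. -/
theorem leviCivita_sub_leviCivita (hX : FieldDiffAt X x) (hY : FieldDiffAt Y x) :
    g.leviCivita Y x (X x) - g.leviCivita X x (Y x) = mlieBracket (𝓡 n) X Y x := by
  refine g.leviCivita_ext fun Z hZ ↦ ?_
  have h1 := g.inner_leviCivita hX hY hZ
  have h2 := g.inner_leviCivita hY hX hZ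
  -- In the difference of the Koszul expressions for `(X, Y, Z)` and `(Y, X, Z)` only `2 g([X, Y],
  -- Z)` remains.
  simp only [koszul] at h1 h2
  rw [g.inner_comm_fun Y X, mlieBracket_swap_apply (V := Y) (W := X)] at h2
  simp only [map_sub, map_neg, neg_apply, sub_apply] at h2 ⊢
  linarith

theorem smoothField_leviCivita [T2Space M] (hX : SmoothField X) (hY : SmoothField Y) :
    SmoothField fun y ↦ g.leviCivita Y y (X y) := by
  refine g.smoothField_of_inner _ fun Z hZ ↦ ?_
  have hd : ∀ {Z : ∀ y : M, TangentSpace (𝓡 n) y}, SmoothField Z → ∀ y, FieldDiffAt Z y :=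
    fun hZ y ↦ hZ.mdifferentiableAt (by simp)
  have hm : ∀ {X Y Z : ∀ y : M, TangentSpace (𝓡 n) y}, SmoothField X → SmoothField Y →
      SmoothField Z → ContMDiff (𝓡 n) 𝓘(ℝ) ∞
        fun y ↦ mvfderiv (𝓡 n) (fun y ↦ g.inner y (Y y) (Z y)) y (X y) := fun hX hY hZ y ↦
    contMDiffAt_mvfderiv (g.contMDiff_inner hY hZ y) (hX y)
  have h : (fun y ↦ g.inner y (g.leviCivita Y y (X y)) (Z y))
      = fun y ↦ 2⁻¹ * g.koszul X Y Z y := by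
    funext y
    rw [← g.inner_leviCivita (hd hX y) (hd hY y) (hd hZ y)]
    ring
  rw [h]
  exact contMDiff_const.mul ((((((hm hX hY hZ).add (hm hY hX hZ)).sub (hm hZ hX hY)).add
    (g.contMDiff_inner (smoothField_mlieBracket hX hY) hZ)).sub
    (g.contMDiff_inner (smoothField_mlieBracket hX hZ) hY)).sub
    (g.contMDiff_inner (smoothField_mlieBracket hY hZ) hX))

end SemiRiemannianMetric

/-- The Lie bracket as a commutator of derivations. -/
theorem mvfderiv_mlieBracket [T2Space M] {f : M → ℝ} (hf : ContMDiff (𝓡 n) 𝓘(ℝ) ∞ f)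
    {X Y : ∀ y : M, TangentSpace (𝓡 n) y} (hX : SmoothField X) (hY : SmoothField Y) (x : M) :
    mvfderiv (𝓡 n) f x (mlieBracket (𝓡 n) X Y x)
      = mvfderiv (𝓡 n) (fun y ↦ mvfderiv (𝓡 n) f y (Y y)) x (X x)
        - mvfderiv (𝓡 n) (fun y ↦ mvfderiv (𝓡 n) f y (X y)) x (Y x) := by
  have : IsManifold (𝓡 n) (minSmoothness ℝ 2) M := isManifold_minSmoothness 2
  have : IsManifold (𝓡 n) (minSmoothness ℝ 3) M := isManifold_minSmoothness 3
  -- The argument needs a field `W` with `W x ≠ 0`; a zero tangent space is trivial.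
  by_cases hall : ∀ u : TangentSpace (𝓡 n) x, u = 0
  · rw [hall (mlieBracket (𝓡 n) X Y x), hall (X x), hall (Y x)]
    simp
  push Not at hall
  obtain ⟨w, hw⟩ := hall
  obtain ⟨W, hW, -, hWx⟩ :=
    exists_contMDiff_extend (n := n) (F := EuclideanSpace ℝ (Fin n)) x w
  have hd : ∀ {Z : ∀ y : M, TangentSpace (𝓡 n) y}, SmoothField Z → ∀ y, FieldDiffAt Z y :=
    fun hZ y ↦ hZ.mdifferentiableAt (by simp)
  have hm : ∀ {X : ∀ y : M, TangentSpace (𝓡 n) y}, SmoothField X → ContMDiff (𝓡 n) 𝓘(ℝ) ∞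
      fun y ↦ mvfderiv (𝓡 n) f y (X y) := fun hX y ↦ contMDiffAt_mvfderiv (hf y) (hX y)
  have hfd : ∀ y, MDifferentiableAt (𝓡 n) 𝓘(ℝ) f y := fun y ↦ hf.mdifferentiableAt (by simp)
  have hfW : SmoothField (f • W) := hf.smul_section hW
  have hbr : ∀ {X : ∀ y : M, TangentSpace (𝓡 n) y}, SmoothField X →
      mlieBracket (𝓡 n) X (f • W)
        = (fun y ↦ mvfderiv (𝓡 n) f y (X y)) • W + f • mlieBracket (𝓡 n) X W := fun hX ↦ by
    funext y
    exact mlieBracket_smul_right (hfd y) (hd hW y)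
  have h2 : ∀ {X Y : ∀ y : M, TangentSpace (𝓡 n) y}, SmoothField X → SmoothField Y →
      mlieBracket (𝓡 n) X (mlieBracket (𝓡 n) Y (f • W)) x
        = mvfderiv (𝓡 n) (fun y ↦ mvfderiv (𝓡 n) f y (Y y)) x (X x) • W x
          + mvfderiv (𝓡 n) f x (Y x) • mlieBracket (𝓡 n) X W x
          + (mvfderiv (𝓡 n) f x (X x) • mlieBracket (𝓡 n) Y W x
          + f x • mlieBracket (𝓡 n) X (mlieBracket (𝓡 n) Y W) x) := fun hX hY ↦ by
    have e1 := (hm hY).mdifferentiableAt (x := x) (by simp)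
    rw [hbr hY, mlieBracket_add_right (e1.smul_section (hd hW x))
      ((hfd x).smul_section (hd (smoothField_mlieBracket hY hW) x)),
      mlieBracket_smul_right e1 (hd hW x),
      mlieBracket_smul_right (hfd x) (hd (smoothField_mlieBracket hY hW) x)]
  have h3 : minSmoothness ℝ 2 ≤ (∞ : WithTop ℕ∞) := by
    rw [minSmoothness_of_isRCLikeNormedField]
    exact WithTop.coe_le_coe.2 (le_top : (2 : ℕ∞) ≤ ⊤)
  -- Expand the Jacobi identity for `f • W` and insert the one for `W`: what remains is the claim
  -- multiplied by `W x`.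
  have hJ := leibniz_identity_mlieBracket_apply (I := 𝓡 n) (x := x) (U := X) (V := Y) (W := f • W)
    ((hX x).of_le h3) ((hY x).of_le h3) ((hfW x).of_le h3)
  have hJ' := leibniz_identity_mlieBracket_apply (I := 𝓡 n) (x := x) (U := X) (V := Y) (W := W)
    ((hX x).of_le h3) ((hY x).of_le h3) ((hW x).of_le h3)
  rw [h2 hX hY, h2 hY hX, hbr (smoothField_mlieBracket hX hY), hJ'] at hJ
  simp only [Pi.add_apply, Pi.smul_apply', hWx] at hJ
  refine smul_left_injective ℝ hw ?_
  simp only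
  rw [← sub_eq_zero] at hJ ⊢
  rw [← neg_eq_zero, ← hJ]
  module

end LeviCivita

/-! ## The chirality operator -/

section Chirality

open Filter
open scoped Topology

variable {n : ℕ} {M : Type*} [TopologicalSpace M] [ChartedSpace (EuclideanSpace ℝ (Fin n)) M]

theorem coe_frameBasis (x : M) : (⇑(frameBasis x) : Fin n → TangentSpace (𝓡 n) x) = frame x :=
  funext (frameBasis_apply x)

/-- In top degree an alternating map is fixed by its value on one basis; this turns changes of basis
into determinants. -/
theorem alternating_eq_det_smul {x : M} {W : Type*} [AddCommGroup W] [Module ℝ W]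
    (f : (TangentSpace (𝓡 n) x) [⋀^Fin n]→ₗ[ℝ] W)
    (b : Module.Basis (Fin n) ℝ (TangentSpace (𝓡 n) x)) (v : Fin n → TangentSpace (𝓡 n) x) :
    f v = b.det v • f b := by
  have : f = (LinearMap.toSpanSingleton ℝ W (f b)).compAlternatingMap b.det := by
    refine Module.Basis.ext_alternating b fun i h ↦ ?_
    let σ : Equiv.Perm (Fin n) := Equiv.ofBijective i (Finite.injective_iff_bijective.1 h)
    change f (b ∘ σ) = b.det (b ∘ σ) • f b
    simp [AlternatingMap.map_perm, Module.Basis.det_self]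
  conv_lhs => rw [this]
  rfl

variable [IsManifold (𝓡 n) ∞ M]

namespace SemiRiemannianMetric

variable (g : SemiRiemannianMetric n M) {x : M}

theorem det_gramOf_eq_mul (b c : Module.Basis (Fin n) ℝ (TangentSpace (𝓡 n) x)) :
    (g.gramOf c).det = b.det c ^ 2 * (g.gramOf b).det := by
  rw [gramOf_eq_toMatrix, gramOf_eq_toMatrix,
    ← LinearMap.BilinForm.toMatrix_mul_basis_toMatrix b c, Matrix.det_mul, Matrix.det_mul,
    Matrix.det_transpose, Module.Basis.det_apply]
  ring

/-- The sign of the determinant of the Gram matrix does not depend on the basis. -/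
theorem det_gramOf_pos_iff (b : Module.Basis (Fin n) ℝ (TangentSpace (𝓡 n) x)) :
    0 < (g.gramOf b).det ↔ 0 < (g.gram x).det := by
  have h := g.det_gramOf_eq_mul b (frameBasis x)
  have h0 := g.det_gramOf_ne_zero (frameBasis x)
  have hb : b.det (frameBasis x) ≠ 0 := fun h1 ↦ h0 (by rw [h, h1]; simp)
  rw [gram_eq_gramOf, ← coe_frameBasis, h]
  exact (mul_pos_iff_of_pos_left (by positivity)).symm

end SemiRiemannianMetric

variable {F : Type*} [NormedAddCommGroup F] [NormedSpace ℂ F]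
  {V : M → Type*} [TopologicalSpace (TotalSpace F V)]
  [∀ x, AddCommGroup (V x)] [∀ x, Module ℂ (V x)] [∀ x, TopologicalSpace (V x)]
  [FiberBundle F V]

namespace CliffordAction

variable {g : SemiRiemannianMetric n M} (γ : CliffordAction F V g) (μ : g.VolumeForm) {x : M}

/-- The Clifford action of tangent vectors. -/
def cl (x : M) : TangentSpace (𝓡 n) x →ₗ[ℝ] Module.End ℂ (V x) :=
  γ.act x ∘ₗ (g.inner x).toLinearMap

theorem cl_apply (u : TangentSpace (𝓡 n) x) : γ.cl x u = γ.act x (g.inner x u) := rfl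

/-- The sign of the Clifford relation as a real number. -/
def sgn : ℝ := ((γ.sign : ℤ) : ℝ)

theorem sgn_mul_self : γ.sgn * γ.sgn = 1 := by
  rcases Int.units_eq_one_or γ.sign with h | h <;> simp [sgn, h]

theorem sgn_ne_zero : γ.sgn ≠ 0 := fun h ↦ by simpa [h] using γ.sgn_mul_self

theorem cl_mul_add (u v : TangentSpace (𝓡 n) x) :
    γ.cl x u * γ.cl x v + γ.cl x v * γ.cl x u = (2 * γ.sgn * g.inner x u v) • 1 := by
  have := γ.clifford x u v
  rw [Complex.coe_smul] at this
  simpa [sgn, cl_apply] using this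

theorem cl_mul_self (u : TangentSpace (𝓡 n) x) :
    γ.cl x u * γ.cl x u = (γ.sgn * g.inner x u u) • 1 := by
  have h := γ.cl_mul_add u u
  rw [← two_smul ℝ, mul_assoc, mul_smul] at h
  exact smul_right_injective _ two_ne_zero h

theorem act_eq_cl (α : TangentSpace (𝓡 n) x →L[ℝ] ℝ) : ∃ u, γ.act x α = γ.cl x u := by
  obtain ⟨u, hu⟩ := g.exists_inner_eq x α
  exact ⟨u, by rw [cl_apply, hu]⟩

/-- The antisymmetrized Clifford product. -/
def clAlt (x : M) : (TangentSpace (𝓡 n) x) [⋀^Fin n]→ₗ[ℝ] Module.End ℂ (V x) :=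
  MultilinearMap.alternatization
    ((MultilinearMap.mkPiAlgebraFin ℝ n (Module.End ℂ (V x))).compLinearMap fun _ ↦ γ.cl x)

theorem clAlt_apply (v : Fin n → TangentSpace (𝓡 n) x) :
    γ.clAlt x v = ∑ σ : Equiv.Perm (Fin n), ((Equiv.Perm.sign σ : ℤ) : ℝ) •
      (List.ofFn fun i ↦ γ.cl x (v (σ i))).prod := by
  simp only [clAlt, MultilinearMap.alternatization_apply, MultilinearMap.domDomCongr_apply,
    MultilinearMap.compLinearMap_apply, MultilinearMap.mkPiAlgebraFin_apply]
  refine Finset.sum_congr rfl fun σ _ ↦ ?_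
  rw [Units.smul_def, Int.cast_smul_eq_zsmul]

/-- The covectors `coframe` are metrically dual to the frame transformed by the inverse Gram matrix,
which contributes the inverse determinant. -/
theorem volume_eq_frame (x : M) :
    γ.volume μ x = ((n.factorial : ℝ)⁻¹ * (μ.toFun x (frame x) * (g.gram x).det⁻¹)) •
      γ.clAlt x (frame x) := by
  let w : Fin n → TangentSpace (𝓡 n) x := fun i ↦ ∑ j, (g.gram x)⁻¹ i j • frame x j
  have hw : ∀ i, γ.act x (coframe x i) = γ.cl x (w i) := fun i ↦ by
    rw [g.coframe_eq_sum, cl_apply]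
    congr 1
    simp [w]
  have hdet : γ.clAlt x w = (g.gram x).det⁻¹ • γ.clAlt x (frame x) := by
    rw [alternating_eq_det_smul _ (frameBasis x) w, coe_frameBasis,
      Module.Basis.det_apply]
    congr 1
    have : (frameBasis x).toMatrix w = ((g.gram x)⁻¹).transpose := by
      ext k i
      have h : ∀ j, (frameBasis x).repr (frame x j) k = if j = k then 1 else 0 := fun j ↦ by
        rw [← frameBasis_apply, Module.Basis.repr_self, Finsupp.single_apply]
      simp [w, Module.Basis.toMatrix_apply, h]
    rw [this, Matrix.det_transpose, Matrix.det_nonsing_inv, Ring.inverse_eq_inv']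
  have hσ : ∀ σ : Equiv.Perm (Fin n), ((μ.toFun x (fun i ↦ frame x (σ i)) : ℝ) : ℂ) •
      (List.ofFn fun i ↦ γ.act x (coframe x (σ i))).prod = μ.toFun x (frame x) •
        ((Equiv.Perm.sign σ : ℤ) : ℝ) • (List.ofFn fun i ↦ γ.cl x (w (σ i))).prod := fun σ ↦ by
    have h1 : μ.toFun x (fun i ↦ frame x (σ i))
        = ((Equiv.Perm.sign σ : ℤ) : ℝ) * μ.toFun x (frame x) := by
      have := (μ.toFun x).map_perm (frame x) σ
      rw [Units.smul_def, ← Int.cast_smul_eq_zsmul ℝ, smul_eq_mul] at this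
      exact this
    rw [Complex.coe_smul, h1, mul_comm, mul_smul]
    simp only [hw]
  rw [volume, Finset.sum_congr rfl fun σ _ ↦ hσ σ, ← Finset.smul_sum, ← clAlt_apply, hdet,
    ← Complex.ofReal_natCast, ← Complex.ofReal_inv, Complex.coe_smul, smul_smul, smul_smul,
    mul_assoc]

/-- The Clifford action of the volume form in an arbitrary basis. -/
theorem volume_eq (b : Module.Basis (Fin n) ℝ (TangentSpace (𝓡 n) x)) :
    γ.volume μ x = ((n.factorial : ℝ)⁻¹ * (μ.toFun x b * (g.gramOf b).det⁻¹)) • γ.clAlt x b := by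
  have h := g.det_gramOf_eq_mul b (frameBasis x)
  have h0 := g.det_gramOf_ne_zero (frameBasis x)
  have hb : b.det (frameBasis x) ≠ 0 := fun h1 ↦ h0 (by rw [h, h1]; simp)
  -- The two alternating maps each scale by the determinant of the change of basis and the Gram
  -- determinant by its square, so the factors cancel.
  rw [volume_eq_frame, SemiRiemannianMetric.gram_eq_gramOf,
    ← coe_frameBasis, h, alternating_eq_det_smul (γ.clAlt x) b (frameBasis x),
    alternating_eq_det_smul (μ.toFun x) b (frameBasis x), smul_smul, smul_eq_mul]
  congr 1
  have := g.det_gramOf_ne_zero b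
  field_simp

/-- The fourth root of unity that normalizes the volume element. -/
def chiralityPhase (g : SemiRiemannianMetric n M) (x : M) : ℂ :=
  if 0 < (g.gram x).det then Complex.I ^ (n / 2) else Complex.I ^ (n / 2 + 1)

theorem chirality_eq (x : M) : γ.chirality μ x = chiralityPhase g x • γ.volume μ x := rfl

theorem cl_anticomm (e : Module.Basis (Fin n) ℝ (TangentSpace (𝓡 n) x)) (d : Fin n → ℝ)
    (he : ∀ i j, g.inner x (e i) (e j) = if i = j then d i else 0) (i j : Fin n) (hij : i ≠ j) :
    γ.cl x (e i) * γ.cl x (e j) = -(γ.cl x (e j) * γ.cl x (e i)) := by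
  have h := γ.cl_mul_add (e i) (e j)
  rw [he, if_neg hij, mul_zero, zero_smul] at h
  exact eq_neg_of_add_eq_zero_left h

/-- Orthogonal vectors anticommute, so all `n!` signed products are equal and their number cancels
the factorial. -/
theorem volume_eq_of_orthogonal (e : Module.Basis (Fin n) ℝ (TangentSpace (𝓡 n) x)) (d : Fin n → ℝ)
    (he : ∀ i j, g.inner x (e i) (e j) = if i = j then d i else 0) :
    γ.volume μ x = (μ.toFun x e * (∏ i, d i)⁻¹) •
    (List.ofFn fun i ↦ γ.cl x (e i)).prod := by
  have hG : g.gramOf e = Matrix.diagonal d := by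
    ext i j
    rw [SemiRiemannianMetric.gramOf, Matrix.of_apply, he, Matrix.diagonal_apply]
  rw [γ.volume_eq μ e, hG, Matrix.det_diagonal, clAlt_apply]
  simp only [prod_ofFn_perm n (fun i ↦ γ.cl x (e i)) (γ.cl_anticomm e d he), smul_smul]
  have : ∀ σ : Equiv.Perm (Fin n),
      ((Equiv.Perm.sign σ : ℤ) : ℝ) * ((Equiv.Perm.sign σ : ℤ) : ℝ) = 1 := fun σ ↦ by
    rw [← Int.cast_mul, ← Units.val_mul, Int.units_mul_self]
    simp
  simp only [this, one_smul, Finset.sum_const, Finset.card_univ, Fintype.card_perm,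
    Fintype.card_fin]
  rw [← Nat.cast_smul_eq_nsmul ℝ, smul_smul]
  congr 1
  have : (n.factorial : ℝ) ≠ 0 := by positivity
  field_simp

/-- In even dimensions the chirality operator anticommutes with Clifford multiplication. -/
theorem chirality_mul_cl (hn : Even n) (u : TangentSpace (𝓡 n) x) :
    γ.chirality μ x * γ.cl x u = -(γ.cl x u * γ.chirality μ x) := by
  obtain ⟨e, d, hd, he⟩ := g.exists_orthogonal_basis x
  -- A factor commutes with itself and anticommutes with the other `n - 1` factors, an odd number.
  have h : ∀ k, γ.cl x (e k) * (List.ofFn fun i ↦ γ.cl x (e i)).prod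
      = -((List.ofFn fun i ↦ γ.cl x (e i)).prod * γ.cl x (e k)) := fun k ↦ by
    have := mul_prod_ofFn_add n (fun i ↦ γ.cl x (e i)) (γ.cl_anticomm e d he) k
    rw [hn.neg_one_pow, one_smul] at this
    exact eq_neg_of_add_eq_zero_left this
  have h1 : ∀ k, γ.chirality μ x * γ.cl x (e k) = -(γ.cl x (e k) * γ.chirality μ x) := fun k ↦ by
    rw [chirality_eq, γ.volume_eq_of_orthogonal μ e d he, mul_smul_comm, mul_smul_comm, h,
      smul_mul_assoc, smul_mul_assoc]
    simp
  rw [← e.sum_repr u]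
  simp only [map_sum, map_smul, Finset.mul_sum, Finset.sum_mul, mul_smul_comm, smul_mul_assoc, h1,
    smul_neg, Finset.sum_neg_distrib]

/-- Let `n = 2k`. In an orthogonal basis the product of the Clifford vectors squares to `(-1)^k ∏ d
i`, because `k (2k - 1)` has the parity of `k` and the sign of the Clifford relation enters to an
even power. With `μ(e)^2 = |∏ d i|`, the square of γ(μ) is `(-1)^k` times the sign of the Gram
determinant, which the phase compensates. -/
theorem chirality_mul_self (hn : Even n) (x : M) : γ.chirality μ x * γ.chirality μ x = 1 := by
  obtain ⟨e, d, hd, he⟩ := g.exists_orthogonal_basis x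
  obtain ⟨k, hk⟩ := hn
  have hG : g.gramOf e = Matrix.diagonal d := by
    ext i j
    rw [SemiRiemannianMetric.gramOf, Matrix.of_apply, he, Matrix.diagonal_apply]
  have hdet : (g.gramOf e).det = ∏ i, d i := by rw [hG, Matrix.det_diagonal]
  have hp : ∏ i, d i ≠ 0 := Finset.prod_ne_zero_iff.2 fun i _ ↦ hd i
  have hsq : μ.toFun x e ^ 2 = |∏ i, d i| := by
    rw [← hdet]
    exact μ.sq_eq x e
  have hprod := prod_ofFn_mul_self n (fun i ↦ γ.cl x (e i)) (γ.cl_anticomm e d he)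
    (fun i ↦ γ.sgn * d i) fun i ↦ by rw [cl_mul_self, he, if_pos rfl]
  have hch : (-1 : ℝ) ^ n.choose 2 = (-1) ^ k := by
    have h2 : n.choose 2 = k * (2 * k - 1) := by
      rw [Nat.choose_two_right, hk, ← two_mul, mul_assoc, Nat.mul_div_cancel_left _ (by norm_num)]
    -- At `k = 0` the subtraction in `2 * k - 1` truncates.
    rcases k with _ | k
    · simp [h2]
    · rw [h2, mul_comm, pow_mul, Odd.neg_one_pow ⟨k, by omega⟩]
  have hs : γ.sgn ^ n = 1 := by
    have h := congrArg (γ.sgn ^ ·) hk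
    simp only [← two_mul, pow_mul, pow_two, sgn_mul_self, one_pow] at h
    exact h
  rw [Finset.prod_mul_distrib, Finset.prod_const, Finset.card_univ, Fintype.card_fin, hs, hch,
    one_mul] at hprod
  have hv : γ.volume μ x * γ.volume μ x
      = ((-1) ^ k * (|∏ i, d i| * (∏ i, d i)⁻¹)) • (1 : Module.End ℂ (V x)) := by
    rw [γ.volume_eq_of_orthogonal μ e d he, smul_mul_assoc, mul_smul_comm, hprod, smul_smul,
      smul_smul, ← hsq]
    congr 1
    field_simp
  have hn2 : n / 2 = k := by omega
  have hI : ∀ m : ℕ, (Complex.I ^ m) * (Complex.I ^ m) = (-1) ^ m := fun m ↦ by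
    rw [← mul_pow, Complex.I_mul_I]
  have hk1 : ((-1 : ℂ)) ^ k * (-1) ^ k = 1 := by rw [← mul_pow]; simp
  rw [chirality_eq, smul_mul_assoc, mul_smul_comm, hv, smul_smul, ← Complex.coe_smul, smul_smul,
    chiralityPhase, hn2]
  conv_rhs => rw [← one_smul ℂ (1 : Module.End ℂ (V x))]
  congr 1
  have hpos := g.det_gramOf_pos_iff e
  rw [hdet] at hpos
  by_cases h : 0 < ∏ i, d i
  · rw [if_pos (hpos.1 h), hI, abs_of_pos h, mul_inv_cancel₀ hp]
    push_cast
    rw [mul_one, hk1]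
  · have hneg : ∏ i, d i < 0 := lt_of_le_of_ne (not_lt.1 h) hp
    rw [if_neg (fun h' ↦ h (hpos.2 h')), hI, abs_of_neg hneg, neg_mul, mul_inv_cancel₀ hp]
    push_cast
    rw [pow_succ]
    linear_combination hk1

end CliffordAction

end Chirality

/-! ## Smooth sections -/

section SmoothSections

open Filter
open scoped Topology

variable {n : ℕ} {M : Type*} [TopologicalSpace M] [ChartedSpace (EuclideanSpace ℝ (Fin n)) M]
  {F : Type*} [NormedAddCommGroup F] [NormedSpace ℂ F]
  {V : M → Type*} [TopologicalSpace (TotalSpace F V)]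
  [∀ x, AddCommGroup (V x)] [∀ x, Module ℂ (V x)] [∀ x, TopologicalSpace (V x)]
  [FiberBundle F V]

theorem SmoothSection.mdifferentiableAt {s : ∀ x : M, V x} (hs : SmoothSection (n := n) F s)
    (x : M) : MDifferentiableAt (𝓡 n) ((𝓡 n).prod 𝓘(ℝ, F)) (fun y ↦ TotalSpace.mk' F y (s y)) x :=
  ContMDiff.mdifferentiableAt hs (by simp)

theorem contMDiffAt_const_smul_section [VectorBundle ℂ F V] (c : ℂ) {s : ∀ x : M, V x} {x : M}
    (hs : ContMDiffAt (𝓡 n) ((𝓡 n).prod 𝓘(ℝ, F)) ∞ (fun y ↦ TotalSpace.mk' F y (s y)) x) :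
    ContMDiffAt (𝓡 n) ((𝓡 n).prod 𝓘(ℝ, F)) ∞ (fun y ↦ TotalSpace.mk' F y (c • s y)) x := by
  rw [contMDiffAt_section] at hs ⊢
  have h1 : ContMDiffAt (𝓡 n) 𝓘(ℝ, F) ∞
      (fun y ↦ c • (trivializationAt F V x (TotalSpace.mk' F y (s y))).2) x :=
    ContMDiffAt.comp x (I' := 𝓘(ℝ, F)) (g := fun v : F ↦ c • v)
      (contDiff_const_smul (𝕜 := ℝ) c).contMDiff.contMDiffAt hs
  refine h1.congr_of_eventuallyEq ?_
  filter_upwards [(trivializationAt F V x).open_baseSet.mem_nhds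
    (FiberBundle.mem_baseSet_trivializationAt' x)] with y hy
  exact ((trivializationAt F V x).linear ℂ hy).map_smul c (s y)

theorem smoothSection_const_smul [VectorBundle ℂ F V] (c : ℂ) {s : ∀ x : M, V x}
    (hs : SmoothSection (n := n) F s) : SmoothSection (n := n) F fun x ↦ c • s x :=
  fun x ↦ contMDiffAt_const_smul_section c (hs x)

theorem smoothSection_add [VectorBundle ℝ F V] {s t : ∀ x : M, V x}
    (hs : SmoothSection (n := n) F s)
    (ht : SmoothSection (n := n) F t) : SmoothSection (n := n) F fun x ↦ s x + t x :=
  ContMDiff.add_section hs ht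

theorem smoothSection_sub [VectorBundle ℝ F V] {s t : ∀ x : M, V x}
    (hs : SmoothSection (n := n) F s)
    (ht : SmoothSection (n := n) F t) : SmoothSection (n := n) F fun x ↦ s x - t x :=
  ContMDiff.sub_section hs ht

theorem smoothSection_smul [VectorBundle ℝ F V] {f : M → ℝ} (hf : ContMDiff (𝓡 n) 𝓘(ℝ) ∞ f)
    {s : ∀ x : M, V x} (hs : SmoothSection (n := n) F s) :
    SmoothSection (n := n) F fun x ↦ f x • s x :=
  ContMDiff.smul_section hf hs

section Connection

variable [∀ x, IsTopologicalAddGroup (V x)] [∀ x, ContinuousSMul ℝ (V x)]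
  {s t : ∀ x : M, V x} {x : M}

theorem connection_add (A : CovariantDerivative (𝓡 n) F V) (hs : SmoothSection (n := n) F s)
    (ht : SmoothSection (n := n) F t) (u : TangentSpace (𝓡 n) x) :
    A (fun y ↦ s y + t y) x u = A s x u + A t x u :=
  congrFun (congrArg DFunLike.coe (A.isCovariantDerivativeOnUniv.add (hs.mdifferentiableAt x)
    (ht.mdifferentiableAt x))) u

theorem connection_smul (A : CovariantDerivative (𝓡 n) F V) {f : M → ℝ}
    (hf : ContMDiff (𝓡 n) 𝓘(ℝ) ∞ f) (hs : SmoothSection (n := n) F s)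
    (u : TangentSpace (𝓡 n) x) :
    A (fun y ↦ f y • s y) x u = f x • A s x u + mvfderiv (𝓡 n) f x u • s x :=
  congrFun (congrArg DFunLike.coe (A.isCovariantDerivativeOnUniv.leibniz (hs.mdifferentiableAt x)
    (hf.mdifferentiableAt (by simp)))) u

theorem connection_const_smul (A : CovariantDerivative (𝓡 n) F V) (c : ℝ)
    (hs : SmoothSection (n := n) F s) (u : TangentSpace (𝓡 n) x) :
    A (fun y ↦ c • s y) x u = c • A s x u := by
  rw [connection_smul A contMDiff_const hs, mvfderiv_const]
  simp

theorem connection_neg (A : CovariantDerivative (𝓡 n) F V)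
    (hs : SmoothSection (n := n) F s) (u : TangentSpace (𝓡 n) x) :
    A (fun y ↦ -s y) x u = -A s x u := by
  simpa using connection_const_smul A (-1) hs u

end Connection

variable [IsManifold (𝓡 n) ∞ M]

namespace CliffordAction

variable {g : SemiRiemannianMetric n M} (γ : CliffordAction F V g) (μ : g.VolumeForm) {x : M}

theorem smoothSection_cl {X : ∀ x : M, TangentSpace (𝓡 n) x} {s : ∀ x : M, V x}
    (hX : SmoothField X) (hs : SmoothSection (n := n) F s) :
    SmoothSection (n := n) F fun x ↦ γ.cl x (X x) (s x) :=
  γ.smooth X s hX hs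

theorem smoothSection_prod_cl {s : ∀ x : M, V x} (hs : SmoothSection (n := n) F s) {m : ℕ}
    (X : Fin m → ∀ x : M, TangentSpace (𝓡 n) x) (hX : ∀ i, SmoothField (X i)) :
    SmoothSection (n := n) F fun x ↦ (List.ofFn fun i ↦ γ.cl x (X i x)).prod (s x) := by
  induction m with
  | zero => simpa using hs
  | succ m ih =>
    have := γ.smoothSection_cl (hX 0) (ih (fun i ↦ X i.succ) fun i ↦ hX i.succ)
    simpa [List.ofFn_succ] using this

/-- The volume element is rewritten in a smooth local frame. The phase is locally constant, since
the Gram determinant of that frame keeps its sign near `x`. -/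
theorem smoothEnd_chirality [VectorBundle ℂ F V] [VectorBundle ℝ F V] [T2Space M] :
    SmoothEnd (n := n) F (γ.chirality μ) := by
  intro s hs x
  obtain ⟨X, hX, hXx, hdet⟩ := g.exists_smooth_frame x
  have hdetx := hdet.self_of_nhds
  have hdetc : ContMDiffAt (𝓡 n) 𝓘(ℝ) ∞ (fun y ↦ (g.gramOf fun i ↦ X i y).det) x :=
    contMDiffAt_det _ fun i j ↦ g.contMDiffAt_inner (hX i x) (hX j x)
  have hpos : ∀ᶠ y in 𝓝 x, (0 < (g.gramOf fun i ↦ X i y).det ↔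
      0 < (g.gramOf fun i ↦ X i x).det) := by
    rcases lt_or_gt_of_ne hdetx with h | h
    · filter_upwards [hdetc.continuousAt.eventually_lt_const h] with y hy
      exact ⟨fun h' ↦ absurd hy h'.asymm, fun h' ↦ absurd h h'.asymm⟩
    · filter_upwards [hdetc.continuousAt.eventually_const_lt h] with y hy
      exact ⟨fun _ ↦ h, fun _ ↦ hy⟩
  have hev : ∀ᶠ y in 𝓝 x, γ.chirality μ y (s y) = chiralityPhase g x •
      ((n.factorial : ℝ)⁻¹ * (μ.toFun y (fun i ↦ X i y) * (g.gramOf fun i ↦ X i y).det⁻¹)) •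
        ∑ σ : Equiv.Perm (Fin n), ((Equiv.Perm.sign σ : ℤ) : ℝ) •
          (List.ofFn fun i ↦ γ.cl y (X (σ i) y)).prod (s y) := by
    filter_upwards [hdet, hpos] with y hy hpy
    obtain ⟨b, hb⟩ := g.exists_basis_of_det_ne_zero _ hy
    obtain ⟨b', hb'⟩ := g.exists_basis_of_det_ne_zero _ hdetx
    have h1 : chiralityPhase g y = chiralityPhase g x := by
      have h2 := g.det_gramOf_pos_iff b
      have h3 := g.det_gramOf_pos_iff b'
      rw [hb, hpy] at h2
      rw [hb'] at h3
      simp only [chiralityPhase, ← h2, ← h3]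
    rw [chirality_eq, h1, γ.volume_eq μ b, hb, clAlt_apply]
    simp [LinearMap.sum_apply]
  refine ContMDiffAt.congr_of_eventuallyEq ?_ (hev.mono fun y hy ↦ congrArg (TotalSpace.mk' F y) hy)
  refine contMDiffAt_const_smul_section _ (ContMDiffAt.smul_section ?_
    (ContMDiffAt.sum_section fun σ _ ↦ ContMDiffAt.smul_section contMDiffAt_const
      (γ.smoothSection_prod_cl hs (fun i ↦ X (σ i)) (fun i ↦ hX (σ i)) x)))
  exact contMDiffAt_const.mul ((μ.smooth X hX x).mul (hdetc.inv₀ hdetx))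

end CliffordAction

end SmoothSections

/-! ## Connections and the Bochner-Laplacian -/

section Connections

open Filter
open scoped Topology

variable {n : ℕ} {M : Type*} [TopologicalSpace M] [ChartedSpace (EuclideanSpace ℝ (Fin n)) M]
  [IsManifold (𝓡 n) ∞ M]

theorem SmoothField.fieldDiffAt {X : ∀ x : M, TangentSpace (𝓡 n) x} (hX : SmoothField X) (x : M) :
    FieldDiffAt X x :=
  ContMDiff.mdifferentiableAt hX (by simp)

theorem smoothField_add {X Y : ∀ x : M, TangentSpace (𝓡 n) x} (hX : SmoothField X)
    (hY : SmoothField Y) : SmoothField (X + Y) :=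
  ContMDiff.add_section hX hY

theorem smoothField_smul {f : M → ℝ} (hf : ContMDiff (𝓡 n) 𝓘(ℝ) ∞ f)
    {X : ∀ x : M, TangentSpace (𝓡 n) x} (hX : SmoothField X) : SmoothField (f • X) :=
  ContMDiff.smul_section hf hX

/-- A tensorial expression in smooth vector fields is given by a linear map. -/
theorem exists_linearMap_of_tensorial_field [T2Space M] {W : Type*} [AddCommGroup W] [Module ℝ W]
    (x : M) (P : (∀ y : M, TangentSpace (𝓡 n) y) → W)
    (hadd : ∀ X Y, SmoothField X → SmoothField Y → P (X + Y) = P X + P Y)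
    (hsmul : ∀ (f : M → ℝ) X, ContMDiff (𝓡 n) 𝓘(ℝ) ∞ f → SmoothField X → P (f • X) = f x • P X) :
    ∃ L : TangentSpace (𝓡 n) x →ₗ[ℝ] W, ∀ X, SmoothField X → P X = L (X x) := by
  have h0 := eq_zero_of_tensorial (n := n) (F := EuclideanSpace ℝ (Fin n)) x P hadd hsmul
  choose E hE _ hEx using fun u : TangentSpace (𝓡 n) x ↦
    exists_contMDiff_extend (n := n) (F := EuclideanSpace ℝ (Fin n)) x u
  have hneg : ∀ X, SmoothField X → P ((fun _ : M ↦ (-1 : ℝ)) • X) = -P X := fun X hX ↦ by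
    rw [hsmul _ _ contMDiff_const hX, neg_one_smul]
  have hcongr : ∀ X Y, SmoothField X → SmoothField Y → X x = Y x → P X = P Y := by
    intro X Y hX hY hXY
    have hY' : SmoothField ((fun _ : M ↦ (-1 : ℝ)) • Y) := smoothField_smul contMDiff_const hY
    have := h0 (X + (fun _ : M ↦ (-1 : ℝ)) • Y) (smoothField_add hX hY') (by simp [hXY])
    rw [hadd _ _ hX hY', hneg _ hY, ← sub_eq_add_neg, sub_eq_zero] at this
    exact this
  refine ⟨{ toFun := fun u ↦ P (E u), map_add' := fun u v ↦ ?_, map_smul' := fun c u ↦ ?_ },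
    fun X hX ↦ hcongr _ _ hX (hE _) (hEx _).symm⟩
  · rw [← hadd _ _ (hE u) (hE v)]
    exact hcongr _ _ (hE _) (smoothField_add (hE u) (hE v)) (by simp [hEx])
  · have := hsmul (fun _ ↦ c) _ contMDiff_const (hE u)
    simp only [RingHom.id_apply]
    rw [← this]
    exact hcongr _ _ (hE _) (smoothField_smul contMDiff_const (hE u)) (by simp [hEx])

/-- Locality follows from metric compatibility: the inner products with a test field have equal
germs at `x`, and the terms that differentiate the test field agree because `Y x = Y' x`. -/
theorem SemiRiemannianMetric.leviCivita_congr (g : SemiRiemannianMetric n M) {x : M}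
    {Y Y' : ∀ y : M, TangentSpace (𝓡 n) y} (hY : FieldDiffAt Y x) (hY' : FieldDiffAt Y' x)
    (h : ∀ᶠ y in 𝓝 x, Y y = Y' y) (u : TangentSpace (𝓡 n) x) :
    g.leviCivita Y x u = g.leviCivita Y' x u := by
  refine g.ext_inner fun w ↦ ?_
  obtain ⟨Z, hZ, rfl⟩ := exists_field x w
  have h1 := g.mvfderiv_inner hY hZ u
  have h2 := g.mvfderiv_inner hY' hZ u
  have h3 : (fun y ↦ g.inner y (Y y) (Z y)) =ᶠ[𝓝 x] fun y ↦ g.inner y (Y' y) (Z y) := by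
    filter_upwards [h] with y hy
    rw [hy]
  have h4 : mvfderiv (𝓡 n) (fun y ↦ g.inner y (Y y) (Z y)) x u
      = mvfderiv (𝓡 n) (fun y ↦ g.inner y (Y' y) (Z y)) x u := by
    have h5 := congrFun (congrArg DFunLike.coe (h3.mfderiv_eq (I := 𝓡 n) (I' := 𝓘(ℝ)))) u
    exact h5
  rw [h.self_of_nhds] at h1
  linarith

variable {F : Type*} [NormedAddCommGroup F] [NormedSpace ℂ F]
  {V : M → Type*} [TopologicalSpace (TotalSpace F V)]
  [∀ x, AddCommGroup (V x)] [∀ x, Module ℂ (V x)] [∀ x, TopologicalSpace (V x)]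
  [∀ x, IsTopologicalAddGroup (V x)] [∀ x, ContinuousSMul ℝ (V x)]
  [FiberBundle F V] [VectorBundle ℝ F V]

variable {A : CovariantDerivative (𝓡 n) F V} {s t : ∀ x : M, V x} {x : M}

theorem IsConnection.smoothSection (hA : IsConnection A) {X : ∀ x : M, TangentSpace (𝓡 n) x}
    (hX : SmoothField X) (hs : SmoothSection (n := n) F s) :
    SmoothSection (n := n) F fun y ↦ A s y (X y) := by
  have h := hA.smooth.contMDiff.contMDiff (σ := s)
    (by rw [show (∞ : WithTop ℕ∞) + 1 = ∞ from rfl]; exact ContMDiff.contMDiffOn hs)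
  rw [contMDiffOn_univ] at h
  exact ContMDiff.clm_bundle_apply (F₁ := EuclideanSpace ℝ (Fin n)) h hX

variable {g : SemiRiemannianMetric n M} [T2Space M]

/-- The second covariant derivative may be computed with any smooth extension. -/
theorem hessian_eq (hA : IsConnection A) (hs : SmoothSection (n := n) F s)
    {Y : ∀ x : M, TangentSpace (𝓡 n) x} (hY : SmoothField Y) (u : TangentSpace (𝓡 n) x) :
    hessian g A s x u (Y x) = A (fun y ↦ A s y (Y y)) x u - A s x (g.leviCivita Y x u) := by
  obtain ⟨L, hL⟩ := exists_linearMap_of_tensorial_field (n := n) x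
    (fun Y ↦ A (fun y ↦ A s y (Y y)) x u - A s x (g.leviCivita Y x u))
    (fun X Y hX hY ↦ by
      have h1 := connection_add A (hA.smoothSection hX hs) (hA.smoothSection hY hs) u
      simp only [Pi.add_apply, map_add, h1, g.leviCivita_add (hX.fieldDiffAt x) (hY.fieldDiffAt x)]
      abel)
    (fun f X hf hX ↦ by
      have h1 := connection_smul A hf (hA.smoothSection hX hs) u
      simp only [Pi.smul_apply', map_smul, h1, map_add,
        g.leviCivita_smul (hf.mdifferentiableAt (by simp)) (hX.fieldDiffAt x)]
      module)
  -- `hessian` uses `FiberBundle.extend`, whereas tensoriality was shown for globally smooth fields;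
  -- `t` is global and has the same germ at `x`.
  obtain ⟨t, ht, hte, htx⟩ :=
    exists_contMDiff_extend (n := n) (F := EuclideanSpace ℝ (Fin n)) x (Y x)
  have h2 := hL t ht
  rw [htx, ← hL Y hY] at h2
  rw [← h2, hessian]
  have hext := FiberBundle.mdifferentiableAt_extend (𝓡 n) (EuclideanSpace ℝ (Fin n)) (Y x)
  have h3 : ∀ᶠ y in 𝓝 x, A s y (FiberBundle.extend (EuclideanSpace ℝ (Fin n)) (Y x) y)
      = A s y (t y) := by
    filter_upwards [hte] with y hy
    rw [hy]
  have h4 := (hA.smoothSection ht hs).mdifferentiableAt x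
  rw [g.leviCivita_congr (SmoothField.fieldDiffAt ht x) hext hte,
    A.isCovariantDerivativeOnUniv.congr_of_eventuallyEq (h4.congr_of_eventuallyEq
      (h3.mono fun y hy ↦ congrArg (TotalSpace.mk' F y) hy)) h4 univ_mem h3]

theorem exists_smoothField (x : M) (u : TangentSpace (𝓡 n) x) :
    ∃ X : ∀ y : M, TangentSpace (𝓡 n) y, SmoothField X ∧ X x = u := by
  obtain ⟨t, ht, -, htx⟩ := exists_contMDiff_extend (n := n) (F := EuclideanSpace ℝ (Fin n)) x u
  exact ⟨t, ht, htx⟩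

/-- The second covariant derivative as a bilinear map. -/
theorem exists_hessian_eq (g : SemiRiemannianMetric n M) (hA : IsConnection A)
    (hs : SmoothSection (n := n) F s) (x : M) :
    ∃ B : TangentSpace (𝓡 n) x →ₗ[ℝ] TangentSpace (𝓡 n) x →ₗ[ℝ] V x,
      ∀ u v, B u v = hessian g A s x u v := by
  refine ⟨LinearMap.mk₂ ℝ (hessian g A s x) ?_ ?_ ?_ ?_, fun u v ↦ rfl⟩
  · intro u u' v
    obtain ⟨Y, hY, rfl⟩ := exists_smoothField x v
    simp only [hessian_eq hA hs hY, map_add, g.leviCivita_add_left (hY.fieldDiffAt x)]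
    abel
  · intro c u v
    obtain ⟨Y, hY, rfl⟩ := exists_smoothField x v
    simp only [hessian_eq hA hs hY, map_smul, g.leviCivita_smul_left (hY.fieldDiffAt x)]
    module
  · intro u v v'
    obtain ⟨Y, hY, rfl⟩ := exists_smoothField x v
    obtain ⟨Y', hY', rfl⟩ := exists_smoothField x v'
    have h := hessian_eq (g := g) (x := x) hA hs (smoothField_add hY hY') u
    have h1 := connection_add A (hA.smoothSection hY hs) (hA.smoothSection hY' hs) u
    simp only [Pi.add_apply, map_add, h1,
      g.leviCivita_add (hY.fieldDiffAt x) (hY'.fieldDiffAt x)] at h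
    rw [h, hessian_eq hA hs hY, hessian_eq hA hs hY']
    abel
  · intro c u v
    obtain ⟨Y, hY, rfl⟩ := exists_smoothField x v
    have h := hessian_eq (g := g) (x := x) hA hs
      (smoothField_smul (f := fun _ ↦ c) contMDiff_const hY) u
    have h1 := connection_const_smul A c (hA.smoothSection hY hs) u
    simp only [Pi.smul_apply', map_smul, h1,
      g.leviCivita_smul (f := fun _ ↦ c) mdifferentiableAt_const (hY.fieldDiffAt x),
      mvfderiv_const] at h
    rw [h, hessian_eq hA hs hY]
    simp [smul_sub]

theorem hessian_add (hA : IsConnection A) (hs : SmoothSection (n := n) F s)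
    (ht : SmoothSection (n := n) F t) (u v : TangentSpace (𝓡 n) x) :
    hessian g A (fun y ↦ s y + t y) x u v = hessian g A s x u v + hessian g A t x u v := by
  obtain ⟨Y, hY, rfl⟩ := exists_smoothField x v
  rw [hessian_eq hA hs hY, hessian_eq hA ht hY, hessian_eq hA (smoothSection_add hs ht) hY]
  simp only [connection_add A hs ht]
  rw [connection_add A (hA.smoothSection hY hs) (hA.smoothSection hY ht)]
  abel

theorem hessian_const_smul [VectorBundle ℂ F V] (hA : IsConnection A) (c : ℂ)
    (hs : SmoothSection (n := n) F s) (u v : TangentSpace (𝓡 n) x) :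
    hessian g A (fun y ↦ c • s y) x u v = c • hessian g A s x u v := by
  obtain ⟨Y, hY, rfl⟩ := exists_smoothField x v
  rw [hessian_eq hA hs hY, hessian_eq hA (smoothSection_const_smul c hs) hY]
  simp only [hA.map_smul c s hs]
  rw [hA.map_smul c _ (hA.smoothSection hY hs), smul_sub]

/-- The second order Leibniz rule. Writing `df` as `g(grad f, ·)` makes its covariant derivative
that of the gradient, by metric compatibility. -/
theorem hessian_smul (hA : IsConnection A) {f : M → ℝ} (hf : ContMDiff (𝓡 n) 𝓘(ℝ) ∞ f)
    (hs : SmoothSection (n := n) F s) (u v : TangentSpace (𝓡 n) x) :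
    hessian g A (fun y ↦ f y • s y) x u v = f x • hessian g A s x u v
      + (g.inner x (g.grad f x) u • A s x v + g.inner x (g.grad f x) v • A s x u
      + g.inner x (g.leviCivita (g.grad f) x u) v • s x) := by
  obtain ⟨Y, hY, rfl⟩ := exists_smoothField x v
  have hdf : ContMDiff (𝓡 n) 𝓘(ℝ) ∞ fun y ↦ g.inner y (g.grad f y) (Y y) :=
    g.contMDiff_inner (g.smoothField_grad hf) hY
  rw [hessian_eq hA hs hY, hessian_eq hA (smoothSection_smul hf hs) hY]
  simp only [connection_smul A hf hs, ← g.inner_grad]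
  rw [connection_add A (smoothSection_smul hf (hA.smoothSection hY hs))
    (smoothSection_smul hdf hs), connection_smul A hf (hA.smoothSection hY hs),
    connection_smul A hdf hs, g.mvfderiv_inner ((g.smoothField_grad hf).fieldDiffAt x)
      (hY.fieldDiffAt x), ← g.inner_grad]
  module

end Connections

/-! ## The Weitzenböck identity -/

section Weitzenboeck

open Filter
open scoped Topology

variable {n : ℕ} {M : Type*} [TopologicalSpace M] [ChartedSpace (EuclideanSpace ℝ (Fin n)) M]
  [IsManifold (𝓡 n) ∞ M] {g : SemiRiemannianMetric n M} {x : M}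

/-- The data of an orthogonal basis of `T_x M`. -/
structure IsOrthogonal (g : SemiRiemannianMetric n M)
    (e : Module.Basis (Fin n) ℝ (TangentSpace (𝓡 n) x)) (d : Fin n → ℝ) : Prop where
  ne_zero (i) : d i ≠ 0
  inner_eq (i j) : g.inner x (e i) (e j) = if i = j then d i else 0

variable (x) in
theorem exists_isOrthogonal (g : SemiRiemannianMetric n M) :
    ∃ (e : Module.Basis (Fin n) ℝ (TangentSpace (𝓡 n) x)) (d : Fin n → ℝ), IsOrthogonal g e d := by
  obtain ⟨e, d, hd, he⟩ := g.exists_orthogonal_basis x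
  exact ⟨e, d, hd, he⟩

theorem sum_inner_smul {W : Type*} [AddCommGroup W] [Module ℝ W]
    {e : Module.Basis (Fin n) ℝ (TangentSpace (𝓡 n) x)} {d : Fin n → ℝ}
    (he : IsOrthogonal g e d) (a : TangentSpace (𝓡 n) x →ₗ[ℝ] W) (w : TangentSpace (𝓡 n) x) :
    ∑ i, (d i)⁻¹ • g.inner x (e i) w • a (e i) = a w := by
  conv_rhs => rw [g.eq_sum_of_orthogonal e d he.ne_zero he.inner_eq w]
  simp [smul_smul]

namespace SemiRiemannianMetric

/-- The trace of the Hessian of a function. -/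
def hessianTrace (g : SemiRiemannianMetric n M) (f : M → ℝ) (x : M) : ℝ :=
  ∑ i, ∑ j, (g.gram x)⁻¹ i j • g.inner x (g.leviCivita (g.grad f) x (frame x i)) (frame x j)

variable [T2Space M]

theorem hessianTrace_eq_of_orthogonal {e : Module.Basis (Fin n) ℝ (TangentSpace (𝓡 n) x)}
    {d : Fin n → ℝ} (he : IsOrthogonal g e d) {f : M → ℝ} (hf : ContMDiff (𝓡 n) 𝓘(ℝ) ∞ f) :
    g.hessianTrace f x
      = ∑ i, (d i)⁻¹ • g.inner x (g.leviCivita (g.grad f) x (e i)) (e i) := by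
  have hd := (g.smoothField_grad hf).fieldDiffAt x
  exact g.contract_eq_of_orthogonal e d he.ne_zero he.inner_eq
    (LinearMap.mk₂ ℝ (fun u v ↦ g.inner x (g.leviCivita (g.grad f) x u) v)
      (fun u u' v ↦ by simp [g.leviCivita_add_left hd])
      (fun c u v ↦ by simp [g.leviCivita_smul_left hd]) (by simp) (by simp))

/-- The Hessian of a function is symmetric. -/
theorem inner_leviCivita_grad_comm {f : M → ℝ} (hf : ContMDiff (𝓡 n) 𝓘(ℝ) ∞ f)
    (u v : TangentSpace (𝓡 n) x) : g.inner x (g.leviCivita (g.grad f) x u) v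
      = g.inner x (g.leviCivita (g.grad f) x v) u := by
  obtain ⟨X, hX, rfl⟩ := exists_smoothField x u
  obtain ⟨Y, hY, rfl⟩ := exists_smoothField x v
  have hd := (g.smoothField_grad hf).fieldDiffAt x
  have h1 := g.mvfderiv_inner hd (hX.fieldDiffAt x) (Y x)
  have h2 := g.mvfderiv_inner hd (hY.fieldDiffAt x) (X x)
  have h3 := mvfderiv_mlieBracket hf hX hY x
  rw [← g.leviCivita_sub_leviCivita (hX.fieldDiffAt x) (hY.fieldDiffAt x)] at h3
  simp only [← g.inner_grad f] at h3
  rw [map_sub] at h3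
  linarith

end SemiRiemannianMetric

variable {F : Type*} [NormedAddCommGroup F] [NormedSpace ℂ F]
  {V : M → Type*} [TopologicalSpace (TotalSpace F V)]
  [∀ x, AddCommGroup (V x)] [∀ x, Module ℂ (V x)] [∀ x, TopologicalSpace (V x)]
  [FiberBundle F V]

namespace CliffordAction

variable (γ : CliffordAction F V g)

theorem cl_smul (u : TangentSpace (𝓡 n) x) (c : ℝ) (v : V x) :
    γ.cl x u (c • v) = c • γ.cl x u v := by
  rw [← Complex.coe_smul, map_smul, Complex.coe_smul]

/-- Clifford contraction of a one-form, in an orthogonal basis. -/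
theorem sum_act_coframe {e : Module.Basis (Fin n) ℝ (TangentSpace (𝓡 n) x)} {d : Fin n → ℝ}
    (he : IsOrthogonal g e d) (a : TangentSpace (𝓡 n) x →ₗ[ℝ] V x) :
    ∑ i, γ.act x (coframe x i) (a (frame x i)) = ∑ i, (d i)⁻¹ • γ.cl x (e i) (a (e i)) := by
  have h := g.contract_eq_of_orthogonal e d he.ne_zero he.inner_eq
    (LinearMap.mk₂ ℝ (fun u v ↦ γ.cl x v (a u)) (by simp) (by simp)
      (by simp) (by simp))
  simp only [LinearMap.mk₂_apply] at h
  rw [← h, SemiRiemannianMetric.contract]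
  refine Finset.sum_congr rfl fun i _ ↦ ?_
  rw [g.coframe_eq_sum]
  simp [cl_apply]

/-- The Hessian of `f` is symmetric, so only the symmetric part of the product of two Clifford
vectors contributes, and that part is ε times the metric. -/
theorem sum_cl_leviCivita_grad [T2Space M] {e : Module.Basis (Fin n) ℝ (TangentSpace (𝓡 n) x)}
    {d : Fin n → ℝ} (he : IsOrthogonal g e d) {f : M → ℝ} (hf : ContMDiff (𝓡 n) 𝓘(ℝ) ∞ f) :
    ∑ i, (d i)⁻¹ • (γ.cl x (e i) * γ.cl x (g.leviCivita (g.grad f) x (e i)))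
      = (γ.sgn * g.hessianTrace f x) • (1 : Module.End ℂ (V x)) := by
  let h : Fin n → Fin n → ℝ := fun i j ↦ g.inner x (g.leviCivita (g.grad f) x (e i)) (e j)
  have hsymm : ∀ i j, h i j = h j i := fun i j ↦ g.inner_leviCivita_grad_comm hf _ _
  have h1 : ∀ i, g.leviCivita (g.grad f) x (e i) = ∑ j, ((d j)⁻¹ * h i j) • e j := fun i ↦ by
    conv_lhs => rw [g.eq_sum_of_orthogonal e d he.ne_zero he.inner_eq
      (g.leviCivita (g.grad f) x (e i))]
    simp only [h, g.symm x (e _)]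
  have h2 : ∑ i, (d i)⁻¹ • (γ.cl x (e i) * γ.cl x (g.leviCivita (g.grad f) x (e i)))
      = ∑ i, ∑ j, ((d i)⁻¹ * (d j)⁻¹ * h i j) • (γ.cl x (e i) * γ.cl x (e j)) := by
    refine Finset.sum_congr rfl fun i _ ↦ ?_
    rw [h1]
    simp only [map_sum, map_smul, Finset.mul_sum, mul_smul_comm, Finset.smul_sum, smul_smul,
      mul_assoc]
  have h3 : ∑ i, ∑ j, ((d i)⁻¹ * (d j)⁻¹ * h i j) • (γ.cl x (e i) * γ.cl x (e j))
      = ∑ i, ∑ j, ((d i)⁻¹ * (d j)⁻¹ * h i j) • (γ.cl x (e j) * γ.cl x (e i)) := by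
    rw [Finset.sum_comm]
    refine Finset.sum_congr rfl fun i _ ↦ Finset.sum_congr rfl fun j _ ↦ ?_
    rw [hsymm j i, mul_comm (d j)⁻¹]
  refine smul_right_injective _ (two_ne_zero (α := ℝ)) ?_
  simp only
  rw [h2, two_smul]
  nth_rewrite 2 [h3]
  rw [← Finset.sum_add_distrib, g.hessianTrace_eq_of_orthogonal he hf, smul_smul, Finset.mul_sum,
    Finset.mul_sum, Finset.sum_smul]
  refine Finset.sum_congr rfl fun i _ ↦ ?_
  rw [← Finset.sum_add_distrib, Finset.sum_eq_single i]
  · rw [← smul_add, cl_mul_add, he.inner_eq, if_pos rfl, smul_smul]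
    congr 1
    have := he.ne_zero i
    simp only [h, smul_eq_mul]
    field_simp
  · intro j _ hj
    rw [← smul_add, cl_mul_add, he.inner_eq, if_neg hj.symm]
    simp
  · simp

variable [∀ x, IsTopologicalAddGroup (V x)] [∀ x, ContinuousSMul ℝ (V x)] [VectorBundle ℝ F V]
  {A : CovariantDerivative (𝓡 n) F V} {s t : ∀ x : M, V x}

theorem dirac_eq {e : Module.Basis (Fin n) ℝ (TangentSpace (𝓡 n) x)} {d : Fin n → ℝ}
    (he : IsOrthogonal g e d) (A : CovariantDerivative (𝓡 n) F V) (s : ∀ x : M, V x) :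
    γ.dirac A s x = ∑ i, (d i)⁻¹ • γ.cl x (e i) (A s x (e i)) :=
  γ.sum_act_coframe he (A s x).toLinearMap

theorem dirac_add (A : CovariantDerivative (𝓡 n) F V) (hs : SmoothSection (n := n) F s)
    (ht : SmoothSection (n := n) F t) (x : M) :
    γ.dirac A (fun y ↦ s y + t y) x = γ.dirac A s x + γ.dirac A t x := by
  simp [dirac, connection_add A hs ht, Finset.sum_add_distrib]

theorem dirac_const_smul (hA : IsConnection A) (c : ℂ) (hs : SmoothSection (n := n) F s) (x : M) :
    γ.dirac A (fun y ↦ c • s y) x = c • γ.dirac A s x := by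
  simp [dirac, hA.map_smul c s hs, Finset.smul_sum]

theorem dirac_smul (A : CovariantDerivative (𝓡 n) F V) {f : M → ℝ}
    (hf : ContMDiff (𝓡 n) 𝓘(ℝ) ∞ f) (hs : SmoothSection (n := n) F s) (x : M) :
    γ.dirac A (fun y ↦ f y • s y) x = f x • γ.dirac A s x + γ.cl x (g.grad f x) (s x) := by
  obtain ⟨e, d, he⟩ := exists_isOrthogonal x g
  have h := sum_inner_smul he ((γ.cl x).flip.flip) (g.grad f x)
  have h' := congrArg (fun T : Module.End ℂ (V x) ↦ T (s x)) h
  simp only [LinearMap.flip_flip, LinearMap.sum_apply, LinearMap.smul_apply] at h'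
  simp only [dirac_eq γ he, connection_smul A hf hs, map_add, cl_smul, smul_add,
    Finset.sum_add_distrib, ← g.inner_grad, Finset.smul_sum]
  rw [← h']
  congr 1
  · exact Finset.sum_congr rfl fun i _ ↦ smul_comm _ _ _
  · exact Finset.sum_congr rfl fun i _ ↦ by rw [g.symm]

variable [T2Space M]

theorem smoothSection_dirac (hA : IsConnection A) (hs : SmoothSection (n := n) F s) :
    SmoothSection (n := n) F (γ.dirac A s) := by
  let B := fun y : M ↦ LinearMap.mk₂ ℝ (fun u v : TangentSpace (𝓡 n) y ↦ γ.cl y v (A s y u))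
    (by simp) (by simp) (by simp) (by simp)
  have h := g.contMDiff_contract (F := F) B fun X Y hX hY ↦
    γ.smoothSection_cl hY (hA.smoothSection hX hs)
  have h2 : γ.dirac A s = fun y ↦ g.contract y (B y) := by
    funext y
    obtain ⟨e, d, he⟩ := exists_isOrthogonal y g
    rw [γ.dirac_eq he, g.contract_eq_of_orthogonal e d he.ne_zero he.inner_eq]
    rfl
  rw [h2]
  exact h

theorem smoothSection_bochnerLaplacian [VectorBundle ℂ F V] (hA : IsConnection A)
    (hs : SmoothSection (n := n) F s) : SmoothSection (n := n) F (γ.bochnerLaplacian A s) := by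
  choose B hB using fun y ↦ exists_hessian_eq g hA hs y
  have h := g.contMDiff_contract (F := F) B fun X Y hX hY ↦ by
    simp only [hB, fun y ↦ hessian_eq (g := g) (x := y) hA hs hY (X y)]
    exact smoothSection_sub (hA.smoothSection hX (hA.smoothSection hY hs))
      (hA.smoothSection (g.smoothField_leviCivita hX hY) hs)
  simp only [SemiRiemannianMetric.contract, hB] at h
  exact smoothSection_smul (f := fun _ ↦ γ.sgn) contMDiff_const h

theorem bochnerLaplacian_eq {e : Module.Basis (Fin n) ℝ (TangentSpace (𝓡 n) x)} {d : Fin n → ℝ}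
    (he : IsOrthogonal g e d) (hA : IsConnection A) (hs : SmoothSection (n := n) F s) :
    γ.bochnerLaplacian A s x = γ.sgn • ∑ i, (d i)⁻¹ • hessian g A s x (e i) (e i) := by
  obtain ⟨B, hB⟩ := exists_hessian_eq g hA hs x
  have h := g.contract_eq_of_orthogonal e d he.ne_zero he.inner_eq B
  simp only [SemiRiemannianMetric.contract, hB] at h
  rw [← h]
  rfl

theorem bochnerLaplacian_add (hA : IsConnection A) (hs : SmoothSection (n := n) F s)
    (ht : SmoothSection (n := n) F t) (x : M) : γ.bochnerLaplacian A (fun y ↦ s y + t y) x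
      = γ.bochnerLaplacian A s x + γ.bochnerLaplacian A t x := by
  simp only [bochnerLaplacian, hessian_add hA hs ht, smul_add, Finset.sum_add_distrib]

theorem bochnerLaplacian_const_smul [VectorBundle ℂ F V] (hA : IsConnection A) (c : ℂ)
    (hs : SmoothSection (n := n) F s) (x : M) :
    γ.bochnerLaplacian A (fun y ↦ c • s y) x = c • γ.bochnerLaplacian A s x := by
  simp only [bochnerLaplacian, hessian_const_smul hA c hs, Finset.smul_sum]
  exact Finset.sum_congr rfl fun i _ ↦ Finset.sum_congr rfl fun j _ ↦ by
    rw [smul_comm _ c, smul_comm _ c]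

/-- The commutator of the Bochner-Laplacian with a function. -/
theorem bochnerLaplacian_smul (hA : IsConnection A) {f : M → ℝ} (hf : ContMDiff (𝓡 n) 𝓘(ℝ) ∞ f)
    (hs : SmoothSection (n := n) F s) (x : M) :
    γ.bochnerLaplacian A (fun y ↦ f y • s y) x = f x • γ.bochnerLaplacian A s x
      + ((2 * γ.sgn) • A s x (g.grad f x) + (γ.sgn * g.hessianTrace f x) • s x) := by
  obtain ⟨e, d, he⟩ := exists_isOrthogonal x g
  -- The two mixed terms of `hessian_smul` have the same trace, the derivative along `grad f`; hence
  -- the factor 2.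
  have h := sum_inner_smul he (A s x).toLinearMap (g.grad f x)
  simp only [ContinuousLinearMap.coe_coe] at h
  simp only [γ.bochnerLaplacian_eq he hA hs, γ.bochnerLaplacian_eq he hA (smoothSection_smul hf hs),
    hessian_smul hA hf hs, smul_add, Finset.sum_add_distrib,
    g.hessianTrace_eq_of_orthogonal he hf, ← h, Finset.mul_sum, Finset.sum_smul, Finset.smul_sum]
  rw [← Finset.sum_add_distrib, ← Finset.sum_add_distrib, ← Finset.sum_add_distrib,
    ← Finset.sum_add_distrib, ← Finset.sum_add_distrib]
  refine Finset.sum_congr rfl fun i _ ↦ ?_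
  rw [g.symm x (g.grad f x) (e i), smul_eq_mul]
  module

/-- The defect of a connection from being a Clifford connection. -/
def defect (A : CovariantDerivative (𝓡 n) F V) (Y : ∀ x : M, TangentSpace (𝓡 n) x)
    (s : ∀ x : M, V x) (x : M) (u : TangentSpace (𝓡 n) x) : V x :=
  A (fun y ↦ γ.cl y (Y y) (s y)) x u - γ.cl x (Y x) (A s x u) - γ.cl x (g.leviCivita Y x u) (s x)

/-- The anticommutator of the Dirac operator of a connection with a gradient. -/
theorem dirac_cl_grad (A : CovariantDerivative (𝓡 n) F V) (s : ∀ x : M, V x)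
    {e : Module.Basis (Fin n) ℝ (TangentSpace (𝓡 n) x)} {d : Fin n → ℝ}
    (he : IsOrthogonal g e d) {f : M → ℝ} (hf : ContMDiff (𝓡 n) 𝓘(ℝ) ∞ f) :
    γ.dirac A (fun y ↦ γ.cl y (g.grad f y) (s y)) x + γ.cl x (g.grad f x) (γ.dirac A s x)
      = (2 * γ.sgn) • A s x (g.grad f x) + (γ.sgn * g.hessianTrace f x) • s x
        + ∑ i, (d i)⁻¹ • γ.cl x (e i) (γ.defect A (g.grad f) s x (e i)) := by
  have h1 := congrArg (fun T : Module.End ℂ (V x) ↦ T (s x)) (γ.sum_cl_leviCivita_grad he hf)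
  simp only [LinearMap.sum_apply, LinearMap.smul_apply, Module.End.mul_apply,
    Module.End.one_apply] at h1
  have h2 := sum_inner_smul he (A s x).toLinearMap (g.grad f x)
  simp only [ContinuousLinearMap.coe_coe] at h2
  rw [← h1, ← h2, γ.dirac_eq he, γ.dirac_eq he, map_sum, Finset.smul_sum,
    ← Finset.sum_add_distrib, ← Finset.sum_add_distrib, ← Finset.sum_add_distrib]
  refine Finset.sum_congr rfl fun i _ ↦ ?_
  -- The first order part is this anticommutator; the term containing the derivative of `grad f` is
  -- the Hessian trace, and the rest is the defect.
  have h3 := congrArg (fun T : Module.End ℂ (V x) ↦ T (A s x (e i)))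
    (γ.cl_mul_add (e i) (g.grad f x))
  simp only [LinearMap.add_apply, LinearMap.smul_apply, Module.End.mul_apply,
    Module.End.one_apply] at h3
  have h4 : (2 * γ.sgn) • (d i)⁻¹ • g.inner x (e i) (g.grad f x) • A s x (e i)
      = (d i)⁻¹ • (2 * γ.sgn * g.inner x (e i) (g.grad f x)) • A s x (e i) := by module
  rw [h4, ← h3, defect, map_sub, map_sub, cl_smul]
  module

end CliffordAction

end Weitzenboeck

/-! ## Operators of simple type -/

section SimpleTypeOperators

open Filter
open scoped Topology

variable {n : ℕ} {M : Type*} [TopologicalSpace M] [ChartedSpace (EuclideanSpace ℝ (Fin n)) M]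
  [IsManifold (𝓡 n) ∞ M] {g : SemiRiemannianMetric n M} {x : M}
  {F : Type*} [NormedAddCommGroup F] [NormedSpace ℂ F]
  {V : M → Type*} [TopologicalSpace (TotalSpace F V)]
  [∀ x, AddCommGroup (V x)] [∀ x, Module ℂ (V x)] [∀ x, TopologicalSpace (V x)]
  [FiberBundle F V]

/-- A one-form that commutes or anticommutes with the Clifford action, and whose contraction does
the opposite, vanishes. -/
theorem CliffordAction.eq_zero_of_sum_cl_mul (γ : CliffordAction F V g)
    {e : Module.Basis (Fin n) ℝ (TangentSpace (𝓡 n) x)} {d : Fin n → ℝ} (he : IsOrthogonal g e d)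
    (a : TangentSpace (𝓡 n) x →ₗ[ℝ] Module.End ℂ (V x)) (c : ℝ) (hc : c ≠ 0)
    (ha : ∀ u v, a u * γ.cl x v = c • (γ.cl x v * a u))
    (hS : ∀ v, (∑ i, (d i)⁻¹ • (γ.cl x (e i) * a (e i))) * γ.cl x v
      = -c • (γ.cl x v * ∑ i, (d i)⁻¹ • (γ.cl x (e i) * a (e i)))) : a = 0 := by
  ext1 v
  have h1 := hS v
  -- Carrying γ(v) to the front costs the factor `c` from `ha` and the Clifford term `2 c ε a(v)`.
  -- By `hS` that term must vanish.
  have h2 : (∑ i, (d i)⁻¹ • (γ.cl x (e i) * a (e i))) * γ.cl x v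
      = (2 * c * γ.sgn) • a v
        + -c • (γ.cl x v * ∑ i, (d i)⁻¹ • (γ.cl x (e i) * a (e i))) := by
    rw [← sum_inner_smul he a v, Finset.sum_mul, Finset.mul_sum, Finset.smul_sum, Finset.smul_sum,
      ← Finset.sum_add_distrib]
    refine Finset.sum_congr rfl fun i _ ↦ ?_
    have h3 : γ.cl x (e i) * γ.cl x v
        = (2 * γ.sgn * g.inner x (e i) v) • 1 - γ.cl x v * γ.cl x (e i) :=
      eq_sub_of_add_eq (γ.cl_mul_add _ _)
    rw [smul_mul_assoc, mul_assoc, ha, mul_smul_comm, ← mul_assoc, h3, sub_mul, mul_smul_comm,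
      mul_assoc, smul_mul_assoc, one_mul]
    module
  rw [h2, add_eq_right] at h1
  refine (smul_eq_zero.1 h1).resolve_left ?_
  have := γ.sgn_ne_zero
  positivity

variable [VectorBundle ℂ F V] [VectorBundle ℝ F V] [FiniteDimensional ℂ F] [T2Space M]
  [ContMDiffVectorBundle ∞ F V (𝓡 n)]

variable (F) in
theorem exists_smoothSection (x : M) (v : V x) :
    ∃ s : ∀ y : M, V y, SmoothSection (n := n) F s ∧ s x = v := by
  obtain ⟨t, ht, -, htx⟩ := exists_contMDiff_extend (n := n) (F := F) x v
  exact ⟨t, ht, htx⟩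

/-- A tensorial expression in smooth sections is given by a linear map. -/
theorem exists_linearMap_of_tensorial {W : Type*} [AddCommGroup W] [Module ℂ W]
    (x : M) (P : (∀ y : M, V y) → W)
    (hadd : ∀ s t, SmoothSection (n := n) F s → SmoothSection (n := n) F t →
      P (fun y ↦ s y + t y) = P s + P t)
    (hconst : ∀ (c : ℂ) s, SmoothSection (n := n) F s → P (fun y ↦ c • s y) = c • P s)
    (hsmul : ∀ (f : M → ℝ) s, ContMDiff (𝓡 n) 𝓘(ℝ) ∞ f → SmoothSection (n := n) F s →
      P (fun y ↦ f y • s y) = f x • P s) :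
    ∃ L : V x →ₗ[ℂ] W, ∀ s, SmoothSection (n := n) F s → P s = L (s x) := by
  have h0 := eq_zero_of_tensorial (n := n) (F := F) x P hadd hsmul
  choose E hE hEx using fun v : V x ↦ exists_smoothSection (n := n) F x v
  have hcongr : ∀ s t, SmoothSection (n := n) F s → SmoothSection (n := n) F t → s x = t x →
      P s = P t := by
    intro s t hs ht hst
    have ht' := smoothSection_const_smul (-1) ht
    have := h0 (fun y ↦ s y + (-1 : ℂ) • t y) (smoothSection_add hs ht') (by simp [hst])
    rw [hadd _ _ hs ht', hconst _ _ ht, neg_one_smul, ← sub_eq_add_neg, sub_eq_zero] at this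
    exact this
  refine ⟨{ toFun := fun u ↦ P (E u), map_add' := fun u v ↦ ?_, map_smul' := fun c u ↦ ?_ },
    fun s hs ↦ hcongr _ _ hs (hE _) (hEx _).symm⟩
  · rw [← hadd _ _ (hE u) (hE v)]
    exact hcongr _ _ (hE _) (smoothSection_add (hE u) (hE v)) (by simp [hEx])
  · simp only [RingHom.id_apply]
    rw [← hconst _ _ (hE u)]
    exact hcongr _ _ (hE _) (smoothSection_const_smul c (hE u)) (by simp [hEx])

/-- Two fields of endomorphisms that agree on smooth sections are equal. -/
theorem end_ext {R S : Module.End ℂ (V x)}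
    (h : ∀ s : ∀ y : M, V y, SmoothSection (n := n) F s → R (s x) = S (s x)) : R = S := by
  ext v
  obtain ⟨s, hs, rfl⟩ := exists_smoothSection (n := n) F x v
  exact h s hs

/-- Every tangent vector is the value of a gradient. -/
theorem exists_grad_eq (g : SemiRiemannianMetric n M) (u : TangentSpace (𝓡 n) x) :
    ∃ f : M → ℝ, ContMDiff (𝓡 n) 𝓘(ℝ) ∞ f ∧ g.grad f x = u := by
  obtain ⟨f, hf, hfx⟩ := exists_contMDiff_mvfderiv_eq (n := n) x (g.inner x u)
  refine ⟨f, hf, g.ext_inner fun w ↦ ?_⟩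
  rw [g.inner_grad, hfx]

variable [∀ x, IsTopologicalAddGroup (V x)] [∀ x, ContinuousSMul ℝ (V x)]

namespace CliffordAction

variable {γ : CliffordAction F V g} {μ : g.VolumeForm} {χ φ : ∀ x : M, Module.End ℂ (V x)}
  {D : (∀ x : M, V x) → ∀ x : M, V x} {A A' : CovariantDerivative (𝓡 n) F V} {s : ∀ x : M, V x}

theorem IsDiracType.smul (hD : γ.IsDiracType μ χ D) {f : M → ℝ} (hf : ContMDiff (𝓡 n) 𝓘(ℝ) ∞ f)
    (hs : SmoothSection (n := n) F s) :
    D (fun y ↦ f y • s y) = fun y ↦ f y • D s y + γ.cl y (g.grad f y) (s y) := by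
  rw [hD.symbol f s hf hs]
  funext y
  rw [cl_apply, g.inner_grad]

theorem IsDiracType.sq_smul (hD : γ.IsDiracType μ χ D) {f : M → ℝ}
    (hf : ContMDiff (𝓡 n) 𝓘(ℝ) ∞ f) (hs : SmoothSection (n := n) F s) (x : M) :
    D (D (fun y ↦ f y • s y)) x = f x • D (D s) x + (γ.cl x (g.grad f x) (D s x)
      + D (fun y ↦ γ.cl y (g.grad f y) (s y)) x) := by
  rw [hD.smul hf hs, hD.map_add _ _ (smoothSection_smul hf (hD.smooth s hs))
    (γ.smoothSection_cl (g.smoothField_grad hf) hs), hD.smul hf (hD.smooth s hs)]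
  exact add_assoc _ _ _

/-- The anticommutator of an operator with a gradient determines its Bochner connection. -/
theorem IsBochnerConnection.cl_grad (hD : γ.IsDiracType μ χ D) (hB : γ.IsBochnerConnection D A)
    {f : M → ℝ} (hf : ContMDiff (𝓡 n) 𝓘(ℝ) ∞ f) (hs : SmoothSection (n := n) F s) (x : M) :
    γ.cl x (g.grad f x) (D s x) + D (fun y ↦ γ.cl y (g.grad f y) (s y)) x
      = (2 * γ.sgn) • A s x (g.grad f x) + (γ.sgn * g.hessianTrace f x) • s x := by
  obtain ⟨hA, R, -, hR⟩ := hB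
  -- The zero order remainder `R` commutes with `f`, so `D²` and the Laplacian have equal
  -- commutators with `f`.
  have h1 := hR _ (smoothSection_smul hf hs) x
  rw [hD.sq_smul hf hs, γ.bochnerLaplacian_smul hA hf hs, ← Complex.coe_smul (f x) (s x),
    map_smul, ← hR s hs x, Complex.coe_smul] at h1
  rw [← sub_eq_zero] at h1 ⊢
  rw [← h1]
  module

/-- By `cl_grad`, differentiation along `grad f` is expressed through `D` alone, and gradients
exhaust the tangent space. -/
theorem IsBochnerConnection.unique (hD : γ.IsDiracType μ χ D) (hB : γ.IsBochnerConnection D A)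
    (hB' : γ.IsBochnerConnection D A') (hs : SmoothSection (n := n) F s) : A s = A' s := by
  funext x
  ext u
  obtain ⟨f, hf, rfl⟩ := exists_grad_eq g u
  have h := (hB.cl_grad hD hf hs x).symm.trans (hB'.cl_grad hD hf hs x)
  rw [add_left_inj] at h
  exact smul_right_injective _ (mul_ne_zero two_ne_zero γ.sgn_ne_zero) h

theorem IsCliffordConnection.defect_eq_zero (hA : γ.IsCliffordConnection A)
    {Y : ∀ x : M, TangentSpace (𝓡 n) x} (hY : SmoothField Y) (hs : SmoothSection (n := n) F s)
    (x : M) (u : TangentSpace (𝓡 n) x) : γ.defect A Y s x u = 0 := by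
  have := hA.compatible Y s hY hs x u
  simp only [defect, cl_apply]
  rw [this]
  abel

/-- The difference of a Dirac type operator and the Dirac operator of a connection is a field of
endomorphisms. -/
theorem IsDiracType.exists_sub_dirac_eq (hD : γ.IsDiracType μ χ D) (hA : IsConnection A) :
    ∃ Φ : ∀ x : M, Module.End ℂ (V x), SmoothEnd (n := n) F Φ ∧
      ∀ s, SmoothSection (n := n) F s → ∀ x, D s x = γ.dirac A s x + Φ x (s x) := by
  -- Both operators have commutator γ(df) with `f`, so their difference is linear over functions.
  choose Φ hΦ using fun x ↦ exists_linearMap_of_tensorial (n := n) (F := F) (V := V) x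
    (fun s ↦ D s x - γ.dirac A s x)
    (fun s t hs ht ↦ by
      rw [hD.map_add s t hs ht, γ.dirac_add A hs ht]
      exact add_sub_add_comm _ _ _ _)
    (fun c s hs ↦ by
      rw [hD.map_smul c s hs, γ.dirac_const_smul hA c hs, smul_sub])
    (fun f s hf hs ↦ by
      rw [hD.smul hf hs, γ.dirac_smul A hf hs]
      module)
  refine ⟨Φ, fun s hs ↦ ?_, fun s hs x ↦ by rw [← hΦ x s hs]; abel⟩
  have := smoothSection_sub (hD.smooth s hs) (γ.smoothSection_dirac hA hs)
  simpa only [hΦ _ s hs] using this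

/-- The anticommutator of the zero order part with the Clifford action is the contracted defect. -/
theorem IsBochnerConnection.anticomm_add_defect (hD : γ.IsDiracType μ χ D)
    (hB : γ.IsBochnerConnection D A) {Φ : ∀ x : M, Module.End ℂ (V x)}
    (hΦ : ∀ s, SmoothSection (n := n) F s → ∀ x, D s x = γ.dirac A s x + Φ x (s x))
    {e : Module.Basis (Fin n) ℝ (TangentSpace (𝓡 n) x)} {d : Fin n → ℝ} (he : IsOrthogonal g e d)
    {f : M → ℝ} (hf : ContMDiff (𝓡 n) 𝓘(ℝ) ∞ f) (hs : SmoothSection (n := n) F s) :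
    γ.cl x (g.grad f x) (Φ x (s x)) + Φ x (γ.cl x (g.grad f x) (s x))
      + ∑ i, (d i)⁻¹ • γ.cl x (e i) (γ.defect A (g.grad f) s x (e i)) = 0 := by
  -- `cl_grad` and `dirac_cl_grad` share the derivative along `grad f` and the Hessian trace; their
  -- difference is the claim.
  have h1 := hB.cl_grad hD hf hs x
  rw [hΦ s hs, hΦ _ (γ.smoothSection_cl (g.smoothField_grad hf) hs), map_add] at h1
  have h2 := γ.dirac_cl_grad A s he hf
  rw [← sub_eq_zero] at h1 h2
  rw [← sub_zero (0 : V x)]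
  nth_rewrite 1 [← h1]
  rw [← h2]
  abel

/-- Operators `γ ∘ ∇^A + Φ` with `Φ` anticommuting with the Clifford action have Bochner
connection `A`. -/
theorem IsCliffordConnection.isBochnerConnection (hD : γ.IsDiracType μ χ D)
    (hA : γ.IsCliffordConnection A) {Φ : ∀ x : M, Module.End ℂ (V x)}
    (hΦ : ∀ s, SmoothSection (n := n) F s → ∀ x, D s x = γ.dirac A s x + Φ x (s x))
    (hanti : ∀ (x : M) (u : TangentSpace (𝓡 n) x), Φ x * γ.cl x u = -(γ.cl x u * Φ x)) :
    γ.IsBochnerConnection D A := by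
  have hA' := hA.isConnection
  refine ⟨hA', ?_⟩
  choose R hR using fun x ↦ exists_linearMap_of_tensorial (n := n) (F := F) (V := V) x
    (fun s ↦ D (D s) x - γ.bochnerLaplacian A s x)
    (fun s t hs ht ↦ by
      rw [hD.map_add s t hs ht, hD.map_add _ _ (hD.smooth s hs) (hD.smooth t ht),
        γ.bochnerLaplacian_add hA' hs ht]
      exact add_sub_add_comm _ _ _ _)
    (fun c s hs ↦ by
      rw [hD.map_smul c s hs, hD.map_smul c _ (hD.smooth s hs),
        γ.bochnerLaplacian_const_smul hA' c hs, smul_sub])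
    (fun f s hf hs ↦ by
      obtain ⟨e, d, he⟩ := exists_isOrthogonal x g
      -- Without defect this is exactly the commutator of the Laplacian with `f`, and the
      -- contributions of `Φ` to that of `D²` cancel by `hanti`.
      have h1 := γ.dirac_cl_grad A s he hf
      simp only [hA.defect_eq_zero (g.smoothField_grad hf) hs, map_zero, smul_zero,
        Finset.sum_const_zero, add_zero] at h1
      have h2 := congrArg (fun T : Module.End ℂ (V x) ↦ T (s x)) (hanti x (g.grad f x))
      simp only [Module.End.mul_apply, LinearMap.neg_apply] at h2
      rw [hD.sq_smul hf hs, γ.bochnerLaplacian_smul hA' hf hs, ← h1, hΦ s hs,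
        hΦ _ (γ.smoothSection_cl (g.smoothField_grad hf) hs), h2, map_add]
      module)
  refine ⟨R, fun s hs ↦ ?_, fun s hs x ↦ hR x s hs⟩
  have := smoothSection_sub (hD.smooth _ (hD.smooth s hs))
    (γ.smoothSection_bochnerLaplacian hA' hs)
  simpa only [hR _ s hs] using this

end CliffordAction

end SimpleTypeOperators

/-! ### Oddness of the zero order part and uniqueness of the decomposition. -/

section Characterization

open Filter
open scoped Topology

variable {n : ℕ} {M : Type*} [TopologicalSpace M] [ChartedSpace (EuclideanSpace ℝ (Fin n)) M]
  [IsManifold (𝓡 n) ∞ M] {g : SemiRiemannianMetric n M} {x : M}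
  {F : Type*} [NormedAddCommGroup F] [NormedSpace ℂ F]
  {V : M → Type*} [TopologicalSpace (TotalSpace F V)]
  [∀ x, AddCommGroup (V x)] [∀ x, Module ℂ (V x)] [∀ x, TopologicalSpace (V x)]
  [FiberBundle F V] [VectorBundle ℂ F V] [VectorBundle ℝ F V] [FiniteDimensional ℂ F] [T2Space M]
  [ContMDiffVectorBundle ∞ F V (𝓡 n)]

/-- An expression that is linear in a tangent vector and tensorial in smooth sections is given by an
endomorphism-valued one-form. -/
theorem exists_form_of_tensorial (x : M) (P : TangentSpace (𝓡 n) x → (∀ y : M, V y) → V x)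
    (hPadd : ∀ u v s, SmoothSection (n := n) F s → P (u + v) s = P u s + P v s)
    (hPsmul : ∀ (c : ℝ) u s, SmoothSection (n := n) F s → P (c • u) s = c • P u s)
    (hadd : ∀ u s t, SmoothSection (n := n) F s → SmoothSection (n := n) F t →
      P u (fun y ↦ s y + t y) = P u s + P u t)
    (hconst : ∀ u (c : ℂ) s, SmoothSection (n := n) F s → P u (fun y ↦ c • s y) = c • P u s)
    (hsmul : ∀ u (f : M → ℝ) s, ContMDiff (𝓡 n) 𝓘(ℝ) ∞ f → SmoothSection (n := n) F s →
      P u (fun y ↦ f y • s y) = f x • P u s) :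
    ∃ a : TangentSpace (𝓡 n) x →ₗ[ℝ] Module.End ℂ (V x),
      ∀ u s, SmoothSection (n := n) F s → P u s = a u (s x) := by
  choose L hL using fun u ↦ exists_linearMap_of_tensorial (n := n) (F := F) (V := V) x (P u)
    (hadd u) (hconst u) (hsmul u)
  refine ⟨{ toFun := L, map_add' := fun u v ↦ ?_, map_smul' := fun c u ↦ ?_ }, hL⟩
  · refine end_ext (n := n) (F := F) fun s hs ↦ ?_
    rw [LinearMap.add_apply, ← hL _ s hs, ← hL _ s hs, ← hL _ s hs, hPadd u v s hs]
  · refine end_ext (n := n) (F := F) fun s hs ↦ ?_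
    rw [RingHom.id_apply, LinearMap.smul_apply, ← hL _ s hs, ← hL _ s hs, hPsmul c u s hs]

variable [∀ x, IsTopologicalAddGroup (V x)] [∀ x, ContinuousSMul ℝ (V x)]

theorem smul_apply_end (T : Module.End ℂ (V x)) (c : ℝ) (v : V x) : T (c • v) = c • T v := by
  rw [← Complex.coe_smul, map_smul, Complex.coe_smul]

namespace CliffordAction

variable {γ : CliffordAction F V g} {μ : g.VolumeForm} {χ φ φ' : ∀ x : M, Module.End ℂ (V x)}
  {D : (∀ x : M, V x) → ∀ x : M, V x} {A A' : CovariantDerivative (𝓡 n) F V} {s : ∀ x : M, V x}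

theorem CommutesWithClifford.mul_cl (hφ : γ.CommutesWithClifford φ) (u : TangentSpace (𝓡 n) x) :
    φ x * γ.cl x u = γ.cl x u * φ x :=
  (hφ x (g.inner x u)).eq.symm

/-- The product of the chirality operator with an element of `End_Cl(V)` anticommutes with the
Clifford action. -/
theorem CommutesWithClifford.chirality_mul_mul_cl (hn : Even n) (hφ : γ.CommutesWithClifford φ)
    (μ : g.VolumeForm) (u : TangentSpace (𝓡 n) x) :
    γ.chirality μ x * φ x * γ.cl x u = -(γ.cl x u * (γ.chirality μ x * φ x)) := by
  rw [mul_assoc, hφ.mul_cl, ← mul_assoc, γ.chirality_mul_cl μ hn, neg_mul, mul_assoc]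

/-- An element of `End_Cl(V)` commutes with the chirality operator. -/
theorem CommutesWithClifford.commute_chirality (hφ : γ.CommutesWithClifford φ) (μ : g.VolumeForm)
    (x : M) : Commute (φ x) (γ.chirality μ x) := by
  refine Commute.smul_right (Commute.smul_right (Commute.sum_right _ _ _ fun σ _ ↦
    Commute.smul_right ?_ _) _) _
  refine Commute.list_prod_right _ _ fun T hT ↦ ?_
  obtain ⟨i, rfl⟩ := List.mem_ofFn.1 hT
  exact (hφ x _).symm

theorem IsTwistInvolution.smoothEnd_grading (hχ : γ.IsTwistInvolution χ) :
    SmoothEnd (n := n) F (γ.grading μ χ) :=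
  fun s hs ↦ γ.smoothEnd_chirality μ _ (hχ.smooth s hs)

/-- The zero order part of an odd operator is odd if it anticommutes with the Clifford action. -/
theorem IsCliffordConnection.mul_grading (hn : Even n) (hχ : γ.IsTwistInvolution χ)
    (hD : γ.IsDiracType μ χ D) (hA : γ.IsCliffordConnection A)
    {Φ : ∀ x : M, Module.End ℂ (V x)}
    (hΦ : ∀ s, SmoothSection (n := n) F s → ∀ x, D s x = γ.dirac A s x + Φ x (s x))
    (hanti : ∀ (x : M) (u : TangentSpace (𝓡 n) x), Φ x * γ.cl x u = -(γ.cl x u * Φ x)) (x : M) :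
    Φ x * γ.grading μ χ x + γ.grading μ χ x * Φ x = 0 := by
  have hA' := hA.isConnection
  have hG : ∀ (y : M) (u : TangentSpace (𝓡 n) y),
      γ.grading μ χ y * γ.cl y u = -(γ.cl y u * γ.grading μ χ y) := fun y u ↦
    hχ.commutes.chirality_mul_mul_cl hn μ u
  have hG' : ∀ (y : M) (u : TangentSpace (𝓡 n) y) (v : V y),
      γ.grading μ χ y (γ.cl y u v) = -γ.cl y u (γ.grading μ χ y v) := fun y u v ↦
    congrArg (fun T : Module.End ℂ (V y) ↦ T v) (hG y u)
  have hGs : SmoothEnd (n := n) F (γ.grading μ χ) := hχ.smoothEnd_grading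
  -- `a` is the covariant derivative `[∇_u, Γ]` of the grading.
  obtain ⟨a, ha⟩ := exists_form_of_tensorial (n := n) (F := F) (V := V) x
    (fun u s ↦ A (fun y ↦ γ.grading μ χ y (s y)) x u - γ.grading μ χ x (A s x u))
    (fun u v s hs ↦ by simp only [map_add]; abel)
    (fun c u s hs ↦ by simp only [map_smul, smul_apply_end, smul_sub])
    (fun u s t hs ht ↦ by
      simp only [map_add, connection_add A hs ht, connection_add A (hGs s hs) (hGs t ht)]
      abel)
    (fun u c s hs ↦ by
      simp only [map_smul, hA'.map_smul c s hs, hA'.map_smul c _ (hGs s hs), smul_sub])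
    (fun u f s hf hs ↦ by
      simp only [smul_apply_end, connection_smul A hf hs, connection_smul A hf (hGs s hs), map_add]
      module)
  obtain ⟨e, d, he⟩ := exists_isOrthogonal x g
  -- This is `D Γ = -Γ D`, with Γ moved past the Clifford vectors.
  have hS : ∑ i, (d i)⁻¹ • (γ.cl x (e i) * a (e i))
      = -(Φ x * γ.grading μ χ x + γ.grading μ χ x * Φ x) := by
    refine end_ext (n := n) (F := F) fun s hs ↦ ?_
    have h1 := congrFun (hD.odd s hs) x
    rw [hΦ s hs, hΦ _ (hGs s hs), γ.dirac_eq he, γ.dirac_eq he, map_add, map_sum] at h1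
    simp only [smul_apply_end, hG'] at h1
    simp only [LinearMap.sum_apply, LinearMap.smul_apply, Module.End.mul_apply, ← ha _ s hs,
      map_sub, smul_sub, Finset.sum_sub_distrib, LinearMap.neg_apply, LinearMap.add_apply]
    simp only [smul_neg, Finset.sum_neg_distrib] at h1
    rw [← sub_eq_zero] at h1 ⊢
    rw [← h1]
    abel
  -- Differentiate `Γ γ(Y) = -γ(Y) Γ`: for a Clifford connection the terms with the derivative of
  -- `Y` cancel.
  have hcl : ∀ u v, a u * γ.cl x v = (-1 : ℝ) • (γ.cl x v * a u) := fun u v ↦ by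
    refine end_ext (n := n) (F := F) fun s hs ↦ ?_
    obtain ⟨Y, hY, rfl⟩ := exists_smoothField x v
    have h1 := hA.defect_eq_zero hY hs x u
    have h2 := hA.defect_eq_zero hY (hGs s hs) x u
    have hsY := γ.smoothSection_cl hY hs
    have h3 : A (fun y ↦ γ.grading μ χ y (γ.cl y (Y y) (s y))) x u
        = -A (fun y ↦ γ.cl y (Y y) (γ.grading μ χ y (s y))) x u := by
      simp only [hG']
      exact connection_neg A (γ.smoothSection_cl hY (hGs s hs)) u
    rw [defect, sub_sub, sub_eq_zero] at h1 h2
    have h4 := ha u _ hsY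
    beta_reduce at h4
    rw [h3, h1, h2] at h4
    rw [neg_one_smul, LinearMap.neg_apply, Module.End.mul_apply, Module.End.mul_apply, ← h4,
      ← ha _ s hs]
    simp only [map_add, hG', map_sub]
    abel
  -- `Φ` and Γ each anticommute with γ(v), so their anticommutator commutes with it, whereas `a`
  -- anticommutes. Thus Γ is parallel, and the contraction is zero too.
  have ha0 : a = 0 := γ.eq_zero_of_sum_cl_mul he a (-1) (by norm_num) hcl fun v ↦ by
    rw [hS, neg_neg, one_smul]
    have h1 := hanti x v
    have h2 := hG x v
    rw [neg_mul, mul_neg, add_mul, mul_assoc, h2, mul_neg, ← mul_assoc, h1,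
      mul_assoc (γ.grading μ χ x), h1,
      mul_neg, ← mul_assoc, h2]
    noncomm_ring
  rw [ha0] at hS
  refine neg_eq_zero.1 (hS.symm.trans ?_)
  simp

/-- The zero order part of an operator of simple type. -/
theorem IsCliffordConnection.exists_isOddTwist (hn : Even n) (hχ : γ.IsTwistInvolution χ)
    (hD : γ.IsDiracType μ χ D) (hA : γ.IsCliffordConnection A) (hB : γ.IsBochnerConnection D A) :
    ∃ φ : ∀ x : M, Module.End ℂ (V x), γ.IsOddTwist μ χ φ ∧ γ.IsSum μ D A φ := by
  obtain ⟨Φ, hΦs, hΦ⟩ := hD.exists_sub_dirac_eq hA.isConnection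
  have hanti : ∀ (x : M) (u : TangentSpace (𝓡 n) x), Φ x * γ.cl x u = -(γ.cl x u * Φ x) := by
    intro x u
    refine end_ext (n := n) (F := F) fun s hs ↦ ?_
    obtain ⟨f, hf, rfl⟩ := exists_grad_eq g u
    obtain ⟨e, d, he⟩ := exists_isOrthogonal x g
    have h1 := hB.anticomm_add_defect hD hΦ he hf hs
    simp only [hA.defect_eq_zero (g.smoothField_grad hf) hs, map_zero, smul_zero,
      Finset.sum_const_zero, add_zero] at h1
    exact eq_neg_of_add_eq_zero_right h1
  have hodd := hA.mul_grading hn hχ hD hΦ hanti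
  -- Since γ_M squares to 1, `Φ = γ_M φ` forces `φ = γ_M Φ`. Two factors that anticommute with γ
  -- give a product that commutes with it.
  refine ⟨fun x ↦ γ.chirality μ x * Φ x, ⟨fun s hs ↦ γ.smoothEnd_chirality μ _ (hΦs s hs), ?_, ?_⟩,
    ?_⟩
  · intro x α
    obtain ⟨u, hu⟩ := γ.act_eq_cl α
    rw [hu]
    change γ.cl x u * (γ.chirality μ x * Φ x) = γ.chirality μ x * Φ x * γ.cl x u
    rw [mul_assoc, hanti, mul_neg, ← mul_assoc, ← mul_assoc, γ.chirality_mul_cl μ hn]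
    noncomm_ring
  · intro x
    have hc : γ.grading μ χ x * γ.chirality μ x = γ.chirality μ x * γ.grading μ χ x := by
      rw [grading, mul_assoc, (hχ.commutes.commute_chirality μ x).eq]
    rw [← mul_assoc, hc, mul_assoc, eq_neg_of_add_eq_zero_right (hodd x), mul_neg, mul_assoc]
  · intro s hs x
    rw [hΦ s hs, ← Module.End.mul_apply, ← mul_assoc, γ.chirality_mul_self μ hn, one_mul]

/-- A sum of the Dirac operator of a Clifford connection and `γ_M ⊗ φ` is of simple type. -/
theorem IsSum.isBochnerConnection (hn : Even n) (hD : γ.IsDiracType μ χ D)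
    (hA : γ.IsCliffordConnection A) (hφ : γ.CommutesWithClifford φ) (h : γ.IsSum μ D A φ) :
    γ.IsBochnerConnection D A :=
  hA.isBochnerConnection hD (Φ := fun x ↦ γ.chirality μ x * φ x) h
    fun _ _ ↦ hφ.chirality_mul_mul_cl hn μ _

/-- The decomposition of an operator of simple type is unique. -/
theorem IsSum.unique (hn : Even n) (hA : γ.IsCliffordConnection A)
    (hφ : γ.CommutesWithClifford φ) (h : γ.IsSum μ D A φ) (hA' : γ.IsCliffordConnection A')
    (hφ' : γ.CommutesWithClifford φ') (h' : γ.IsSum μ D A' φ') :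
    φ = φ' ∧ ∀ s : ∀ x : M, V x, SmoothSection (n := n) F s → A s = A' s := by
  have key : ∀ x, φ x = φ' x ∧ ∀ s, SmoothSection (n := n) F s → A s x = A' s x := by
    intro x
    -- `a` is the difference of the two connections; equality of the two decompositions identifies
    -- its contraction.
    obtain ⟨a, ha⟩ := exists_form_of_tensorial (n := n) (F := F) (V := V) x
      (fun u s ↦ A s x u - A' s x u)
      (fun u v s hs ↦ by simp only [map_add]; abel)
      (fun c u s hs ↦ by simp only [map_smul, smul_sub])
      (fun u s t hs ht ↦ by simp only [connection_add _ hs ht]; abel)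
      (fun u c s hs ↦ by
        simp only [hA.isConnection.map_smul c s hs, hA'.isConnection.map_smul c s hs, smul_sub])
      (fun u f s hf hs ↦ by simp only [connection_smul _ hf hs]; module)
    obtain ⟨e, d, he⟩ := exists_isOrthogonal x g
    have hS : ∑ i, (d i)⁻¹ • (γ.cl x (e i) * a (e i))
        = γ.chirality μ x * φ' x - γ.chirality μ x * φ x := by
      refine end_ext (n := n) (F := F) fun s hs ↦ ?_
      have h1 := (h s hs x).symm.trans (h' s hs x)
      rw [γ.dirac_eq he, γ.dirac_eq he] at h1
      simp only [LinearMap.sum_apply, LinearMap.smul_apply, Module.End.mul_apply, ← ha _ s hs,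
        map_sub, smul_sub, Finset.sum_sub_distrib, LinearMap.sub_apply]
      rw [← sub_eq_zero] at h1 ⊢
      rw [← h1]
      abel
    have hcl : ∀ u v, a u * γ.cl x v = (1 : ℝ) • (γ.cl x v * a u) := fun u v ↦ by
      refine end_ext (n := n) (F := F) fun s hs ↦ ?_
      obtain ⟨Y, hY, rfl⟩ := exists_smoothField x v
      have h1 := hA.defect_eq_zero hY hs x u
      have h2 := hA'.defect_eq_zero hY hs x u
      have hsY := γ.smoothSection_cl hY hs
      rw [defect, sub_sub, sub_eq_zero] at h1 h2
      simp only [one_smul, Module.End.mul_apply, ← ha _ s hs, ← ha _ _ hsY, h1, h2, map_sub]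
      abel
    -- The difference of two Clifford connections commutes with γ, but its contraction carries a
    -- factor γ_M and anticommutes.
    have ha0 : a = 0 := γ.eq_zero_of_sum_cl_mul he a 1 one_ne_zero hcl fun v ↦ by
      rw [hS, sub_mul, hφ.chirality_mul_mul_cl hn, hφ'.chirality_mul_mul_cl hn, neg_one_smul,
        mul_sub]
      abel
    constructor
    · rw [ha0] at hS
      have h1 : γ.chirality μ x * φ x = γ.chirality μ x * φ' x := by
        refine (sub_eq_zero.1 ?_).symm
        rw [← hS]
        simp
      have h2 := congrArg (γ.chirality μ x * ·) h1
      simpa only [← mul_assoc, γ.chirality_mul_self μ hn, one_mul] using h2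
    · intro s hs
      ext u
      have h1 := ha u s hs
      rw [ha0] at h1
      exact sub_eq_zero.1 h1
  exact ⟨funext fun x ↦ (key x).1, fun s hs ↦ funext fun x ↦ (key x).2 s hs⟩

end CliffordAction

end Characterization

/-! ### Vanishing of the defect and recovery of a Clifford connection from the Dirac form. -/

section DiracForm

variable {n : ℕ} {M : Type*} [TopologicalSpace M] [ChartedSpace (EuclideanSpace ℝ (Fin n)) M]
  [IsManifold (𝓡 n) ∞ M] {g : SemiRiemannianMetric n M} {x : M}
  {F : Type*} [NormedAddCommGroup F] [NormedSpace ℂ F]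
  {V : M → Type*} [TopologicalSpace (TotalSpace F V)]
  [∀ x, AddCommGroup (V x)] [∀ x, Module ℂ (V x)] [∀ x, TopologicalSpace (V x)]
  [FiberBundle F V] [VectorBundle ℂ F V] [VectorBundle ℝ F V] [FiniteDimensional ℂ F] [T2Space M]
  [ContMDiffVectorBundle ∞ F V (𝓡 n)]
  [∀ x, IsTopologicalAddGroup (V x)] [∀ x, ContinuousSMul ℝ (V x)]

namespace CliffordAction

variable {γ : CliffordAction F V g} {μ : g.VolumeForm} {χ φ φ' : ∀ x : M, Module.End ℂ (V x)}
  {D : (∀ x : M, V x) → ∀ x : M, V x} {A A' : CovariantDerivative (𝓡 n) F V} {s : ∀ x : M, V x}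

/-- The defect depends tensorially on the vector field. -/
theorem exists_defect_eq_of_field (γ : CliffordAction F V g) (A : CovariantDerivative (𝓡 n) F V)
    (hs : SmoothSection (n := n) F s) (u : TangentSpace (𝓡 n) x) :
    ∃ L : TangentSpace (𝓡 n) x →ₗ[ℝ] V x, ∀ Y, SmoothField Y → γ.defect A Y s x u = L (Y x) := by
  refine exists_linearMap_of_tensorial_field x _ (fun X Y hX hY ↦ ?_) fun f X hf hX ↦ ?_
  · have h1 := connection_add A (γ.smoothSection_cl hX hs) (γ.smoothSection_cl hY hs) u
    simp only [defect, Pi.add_apply, map_add, LinearMap.add_apply, h1,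
      g.leviCivita_add (hX.fieldDiffAt x) (hY.fieldDiffAt x)]
    abel
  · have h1 := connection_smul A hf (γ.smoothSection_cl hX hs) u
    simp only [defect, Pi.smul_apply', map_smul, LinearMap.smul_apply, h1, map_add,
      g.leviCivita_smul (hf.mdifferentiableAt (by simp)) (hX.fieldDiffAt x), LinearMap.add_apply]
    module

/-- The defect is an endomorphism-valued one-form. -/
theorem exists_defect_eq_of_section (γ : CliffordAction F V g) (hA : IsConnection A)
    {Y : ∀ x : M, TangentSpace (𝓡 n) x} (hY : SmoothField Y) (x : M) :
    ∃ a : TangentSpace (𝓡 n) x →ₗ[ℝ] Module.End ℂ (V x),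
      ∀ u s, SmoothSection (n := n) F s → γ.defect A Y s x u = a u (s x) := by
  have hd := hY.fieldDiffAt x
  refine exists_form_of_tensorial (n := n) (F := F) (V := V) x (fun u s ↦ γ.defect A Y s x u)
    (fun u v s hs ↦ ?_) (fun c u s hs ↦ ?_) (fun u s t hs ht ↦ ?_) (fun u c s hs ↦ ?_)
    (fun u f s hf hs ↦ ?_)
  · simp only [defect, map_add, g.leviCivita_add_left hd, LinearMap.add_apply]
    abel
  · simp only [defect, map_smul, g.leviCivita_smul_left hd, LinearMap.smul_apply, smul_apply_end,
      smul_sub]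
  · simp only [defect, map_add, connection_add A hs ht,
      connection_add A (γ.smoothSection_cl hY hs) (γ.smoothSection_cl hY ht)]
    abel
  · simp only [defect, map_smul, hA.map_smul c s hs, hA.map_smul c _ (γ.smoothSection_cl hY hs),
      smul_sub]
  · simp only [defect, smul_apply_end, connection_smul A hf hs,
      connection_smul A hf (γ.smoothSection_cl hY hs), map_add]
    module

/-- The symmetry of the defect that follows from the Clifford relation and the compatibility of the
Levi-Civita connection with the metric. -/
theorem defect_anticomm (γ : CliffordAction F V g) (A : CovariantDerivative (𝓡 n) F V)
    {Y Z : ∀ x : M, TangentSpace (𝓡 n) x} (hY : SmoothField Y) (hZ : SmoothField Z)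
    (hs : SmoothSection (n := n) F s) (u : TangentSpace (𝓡 n) x) :
    γ.cl x (Y x) (γ.defect A Z s x u) + γ.defect A Z (fun y ↦ γ.cl y (Y y) (s y)) x u
      + (γ.cl x (Z x) (γ.defect A Y s x u) + γ.defect A Y (fun y ↦ γ.cl y (Z y) (s y)) x u)
      = 0 := by
  have hYs := γ.smoothSection_cl hY hs
  have hZs := γ.smoothSection_cl hZ hs
  have hrel : ∀ (y : M) (v w : TangentSpace (𝓡 n) y) (ψ : V y),
      γ.cl y v (γ.cl y w ψ) + γ.cl y w (γ.cl y v ψ) = (2 * γ.sgn * g.inner y v w) • ψ :=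
    fun y v w ψ ↦ congrArg (fun T : Module.End ℂ (V y) ↦ T ψ) (γ.cl_mul_add v w)
  have hf : ContMDiff (𝓡 n) 𝓘(ℝ) ∞ fun y ↦ g.inner y (Y y) (Z y) := g.contMDiff_inner hY hZ
  -- Differentiate the Clifford relation for `Y` and `Z` applied to `s`; metric compatibility
  -- expands the derivative of `g(Y, Z)`.
  have h1 := connection_add A (γ.smoothSection_cl hY hZs) (γ.smoothSection_cl hZ hYs) u
  simp only [hrel, mul_smul] at h1
  rw [connection_const_smul A 2 (smoothSection_smul contMDiff_const (smoothSection_smul hf hs)),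
    connection_const_smul A γ.sgn (smoothSection_smul hf hs), connection_smul A hf hs,
    g.mvfderiv_inner (hY.fieldDiffAt x) (hZ.fieldDiffAt x)] at h1
  have h2 := hrel x (Y x) (Z x) (A s x u)
  have h3 := hrel x (g.leviCivita Y x u) (Z x) (s x)
  have h4 := hrel x (Y x) (g.leviCivita Z x u) (s x)
  simp only [defect, map_sub]
  -- The mixed terms, γ of one field times the derivative of γ of the other, cancel; the others
  -- group into Clifford anticommutators.
  have h5 : γ.cl x (Y x) (A (fun y ↦ γ.cl y (Z y) (s y)) x u)
        - γ.cl x (Y x) (γ.cl x (Z x) (A s x u))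
        - γ.cl x (Y x) (γ.cl x (g.leviCivita Z x u) (s x))
      + (A (fun y ↦ γ.cl y (Z y) (γ.cl y (Y y) (s y))) x u
        - γ.cl x (Z x) (A (fun y ↦ γ.cl y (Y y) (s y)) x u)
        - γ.cl x (g.leviCivita Z x u) (γ.cl x (Y x) (s x)))
      + (γ.cl x (Z x) (A (fun y ↦ γ.cl y (Y y) (s y)) x u)
        - γ.cl x (Z x) (γ.cl x (Y x) (A s x u))
        - γ.cl x (Z x) (γ.cl x (g.leviCivita Y x u) (s x))
      + (A (fun y ↦ γ.cl y (Y y) (γ.cl y (Z y) (s y))) x u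
        - γ.cl x (Y x) (A (fun y ↦ γ.cl y (Z y) (s y)) x u)
        - γ.cl x (g.leviCivita Y x u) (γ.cl x (Z x) (s x))))
      = (A (fun y ↦ γ.cl y (Y y) (γ.cl y (Z y) (s y))) x u
          + A (fun y ↦ γ.cl y (Z y) (γ.cl y (Y y) (s y))) x u)
        - (γ.cl x (Y x) (γ.cl x (Z x) (A s x u)) + γ.cl x (Z x) (γ.cl x (Y x) (A s x u)))
        - (γ.cl x (g.leviCivita Y x u) (γ.cl x (Z x) (s x))
          + γ.cl x (Z x) (γ.cl x (g.leviCivita Y x u) (s x)))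
        - (γ.cl x (Y x) (γ.cl x (g.leviCivita Z x u) (s x))
          + γ.cl x (g.leviCivita Z x u) (γ.cl x (Y x) (s x))) := by
    abel
  rw [h5, ← h1, h2, h3, h4]
  module

/-- If the zero order part anticommutes with the Clifford action, then the Bochner connection is a
Clifford connection. -/
theorem IsBochnerConnection.isCliffordConnection (hD : γ.IsDiracType μ χ D)
    (hB : γ.IsBochnerConnection D A) {Φ : ∀ x : M, Module.End ℂ (V x)}
    (hΦ : ∀ s, SmoothSection (n := n) F s → ∀ x, D s x = γ.dirac A s x + Φ x (s x))
    (hanti : ∀ (x : M) (u : TangentSpace (𝓡 n) x), Φ x * γ.cl x u = -(γ.cl x u * Φ x)) :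
    γ.IsCliffordConnection A := by
  refine ⟨hB.1, fun Y s hY hs x u ↦ ?_⟩
  obtain ⟨e, d, he⟩ := exists_isOrthogonal x g
  -- `T k (e i)` is the defect in direction `e i` for a smooth field `E k` through `e k`; this is
  -- the family for `eq_zero_of_clifford_contraction`.
  choose E hE hEx using fun k ↦ exists_smoothField x (e k)
  choose T hT using fun k ↦ exists_defect_eq_of_section γ hB.1 (hE k) x
  have hT0 : ∀ i k, T k (e i) = 0 := by
    refine eq_zero_of_clifford_contraction (fun i ↦ γ.cl x (e i)) (fun i ↦ γ.sgn * d i)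
      (fun i ↦ mul_ne_zero γ.sgn_ne_zero (he.ne_zero i)) (fun i j ↦ ?_) (fun i k ↦ T k (e i))
      (fun k ↦ ?_) fun i j k ↦ ?_
    · rw [cl_mul_add, he.inner_eq]
      congr 1
      split_ifs <;> ring
    · refine end_ext (n := n) (F := F) fun s hs ↦ ?_
      obtain ⟨f, hf, hfx⟩ := exists_grad_eq g (e k)
      have h1 := hB.anticomm_add_defect hD hΦ he hf hs
      have h2 := congrArg (fun T : Module.End ℂ (V x) ↦ T (s x)) (hanti x (g.grad f x))
      simp only [Module.End.mul_apply, LinearMap.neg_apply] at h2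
      rw [h2, add_neg_cancel, zero_add] at h1
      -- The contraction identity is available for gradients only. The defect depends on the field
      -- only through its value at `x`, so a gradient through `e k` may replace `E k`.
      have h3 : ∀ i, γ.defect A (g.grad f) s x (e i) = T k (e i) (s x) := fun i ↦ by
        obtain ⟨L, hL⟩ := exists_defect_eq_of_field γ A hs (e i)
        rw [hL _ (g.smoothField_grad hf), hfx, ← hEx k, ← hL _ (hE k), hT k _ s hs]
      simp only [h3] at h1
      have h4 := congrArg (γ.sgn⁻¹ • ·) h1
      simp only [Finset.smul_sum, smul_zero, smul_smul] at h4
      simpa [LinearMap.sum_apply, mul_comm] using h4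
    · refine end_ext (n := n) (F := F) fun s hs ↦ ?_
      have h1 := defect_anticomm γ A (x := x) (hE j) (hE k) hs (e i)
      have h2 := hT k (e i) _ (γ.smoothSection_cl (hE j) hs)
      have h3 := hT j (e i) _ (γ.smoothSection_cl (hE k) hs)
      beta_reduce at h2 h3
      rw [h2, h3, hT k _ s hs, hT j _ s hs, hEx, hEx] at h1
      exact h1
  have hT1 : ∀ k, T k = 0 := fun k ↦ e.ext fun i ↦ hT0 i k
  obtain ⟨L, hL⟩ := exists_defect_eq_of_field γ A hs u
  have hL0 : L = 0 := e.ext fun k ↦ by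
    rw [← hEx k, ← hL _ (hE k), hT k _ s hs, hT1]
    rfl
  have h1 := hL Y hY
  rw [hL0, LinearMap.zero_apply, defect, sub_sub, sub_eq_zero] at h1
  exact h1

/-- A member `e` of an orthogonal basis is not null, so γ(e) squares to a nonzero scalar. Hence the
Dirac form determines the zero order part; positive dimension provides both `e` and a nonzero factor
`1 / n`. -/
theorem exists_theta_injective (hn0 : 0 < n) (γ : CliffordAction F V g) (x : M) :
    ∃ u, Function.Injective (γ.theta x u) := by
  obtain ⟨e, d, he⟩ := exists_isOrthogonal x g
  refine ⟨e ⟨0, hn0⟩, ?_⟩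
  have hc : ((γ.sgn / n : ℝ) : ℂ) ≠ 0 := by
    rw [Complex.ofReal_ne_zero]
    exact div_ne_zero γ.sgn_ne_zero (Nat.cast_ne_zero.2 hn0.ne')
  have h2 := γ.cl_mul_self (e ⟨0, hn0⟩)
  rw [he.inner_eq, if_pos rfl] at h2
  intro v w hvw
  have h3 : γ.cl x (e ⟨0, hn0⟩) v = γ.cl x (e ⟨0, hn0⟩) w := smul_right_injective _ hc hvw
  have h4 : ∀ v : V x, γ.cl x (e ⟨0, hn0⟩) (γ.cl x (e ⟨0, hn0⟩) v) = (γ.sgn * d ⟨0, hn0⟩) • v :=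
    fun v ↦ congrArg (fun T : Module.End ℂ (V x) ↦ T v) h2
  refine smul_right_injective _ (mul_ne_zero γ.sgn_ne_zero (he.ne_zero ⟨0, hn0⟩)) ?_
  simp only
  rw [← h4, ← h4, h3]

/-- An operator with Dirac form `Θ ∧ (γ_M ⊗ φ)` is of simple type. -/
theorem HasDiracForm.exists_isSum (hn : Even n) (hn0 : 0 < n) (hD : γ.IsDiracType μ χ D)
    (hφ : γ.CommutesWithClifford φ)
    (h : γ.HasDiracForm D fun x u ↦ γ.theta x u * (γ.chirality μ x * φ x)) :
    ∃ A : CovariantDerivative (𝓡 n) F V, γ.IsCliffordConnection A ∧ γ.IsSum μ D A φ := by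
  obtain ⟨⟨A, hB⟩, h⟩ := h
  have hsum : γ.IsSum μ D A φ := fun s hs x ↦ by
    obtain ⟨u, hu⟩ := exists_theta_injective hn0 γ x
    exact sub_eq_iff_eq_add'.1 (hu (h A hB s hs x u))
  exact ⟨A, hB.isCliffordConnection hD (Φ := fun x ↦ γ.chirality μ x * φ x) hsum
    fun _ _ ↦ hφ.chirality_mul_mul_cl hn μ _, hsum⟩

/-- The Dirac form refers to every Bochner connection; by uniqueness each of them acts on smooth
sections as `A`. -/
theorem IsSum.hasDiracForm (hn : Even n) (hD : γ.IsDiracType μ χ D) (hA : γ.IsCliffordConnection A)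
    (hφ : γ.CommutesWithClifford φ) (h : γ.IsSum μ D A φ) :
    γ.HasDiracForm D fun x u ↦ γ.theta x u * (γ.chirality μ x * φ x) := by
  have hB := h.isBochnerConnection hn hD hA hφ
  refine ⟨⟨A, hB⟩, fun A' hB' s hs x u ↦ ?_⟩
  have h1 : γ.dirac A' s x = γ.dirac A s x := by
    simp only [dirac, hB'.unique hD hB hs]
  rw [h1, h s hs, add_sub_cancel_left]
  rfl

end CliffordAction

end DiracForm

end SimpleType

end

/-! ### The characterization of operators of simple type. -/

theorem mainTheorem1 {n : ℕ} (hn : Even n) (hn0 : 0 < n)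
    {M : Type*} [TopologicalSpace M] [ChartedSpace (EuclideanSpace ℝ (Fin n)) M]
    [IsManifold (𝓡 n) ∞ M] [T2Space M] [ParacompactSpace M]
    {F : Type*} [NormedAddCommGroup F] [NormedSpace ℂ F] [FiniteDimensional ℂ F]
    {V : M → Type*} [TopologicalSpace (TotalSpace F V)]
    [∀ x, AddCommGroup (V x)] [∀ x, Module ℂ (V x)] [∀ x, TopologicalSpace (V x)]
    [∀ x, IsTopologicalAddGroup (V x)] [∀ x, ContinuousSMul ℝ (V x)]
    [FiberBundle F V] [VectorBundle ℂ F V] [VectorBundle ℝ F V]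
    [ContMDiffVectorBundle ∞ F V (𝓡 n)]
    (g : SimpleType.SemiRiemannianMetric n M) (μ : g.VolumeForm)
    (γ : SimpleType.CliffordAction F V g)
    (χ : ∀ x : M, Module.End ℂ (V x)) (hχ : γ.IsTwistInvolution χ)
    (D : (∀ x : M, V x) → ∀ x : M, V x) (hD : γ.IsDiracType μ χ D) :
    (γ.IsSimpleType D ↔
      ∃ (A : CovariantDerivative (𝓡 n) F V) (φ : ∀ x : M, Module.End ℂ (V x)),
        γ.IsCliffordConnection A ∧ γ.IsOddTwist μ χ φ ∧ γ.IsSum μ D A φ) ∧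
    (γ.IsSimpleType D ↔
      ∃ φ : ∀ x : M, Module.End ℂ (V x), γ.IsOddTwist μ χ φ ∧
        γ.HasDiracForm D (fun x u ↦ γ.theta x u * (γ.chirality μ x * φ x))) ∧
    (∀ φ : ∀ x : M, Module.End ℂ (V x), γ.IsOddTwist μ χ φ →
      ((∃ A : CovariantDerivative (𝓡 n) F V, γ.IsCliffordConnection A ∧ γ.IsSum μ D A φ) ↔
        γ.HasDiracForm D (fun x u ↦ γ.theta x u * (γ.chirality μ x * φ x)))) ∧
    (γ.IsSimpleType D →
      ∃! φ : ∀ x : M, Module.End ℂ (V x), γ.IsOddTwist μ χ φ ∧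
        γ.HasDiracForm D (fun x u ↦ γ.theta x u * (γ.chirality μ x * φ x))) ∧
    (∀ (A A' : CovariantDerivative (𝓡 n) F V) (φ φ' : ∀ x : M, Module.End ℂ (V x)),
      γ.IsCliffordConnection A → γ.IsOddTwist μ χ φ → γ.IsSum μ D A φ →
      γ.IsCliffordConnection A' → γ.IsOddTwist μ χ φ' → γ.IsSum μ D A' φ' →
      φ = φ' ∧ ∀ s : ∀ x : M, V x, SimpleType.SmoothSection (n := n) F s → A s = A' s) := by
  have h12 : γ.IsSimpleType D ↔
      ∃ (A : CovariantDerivative (𝓡 n) F V) (φ : ∀ x : M, Module.End ℂ (V x)),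
        γ.IsCliffordConnection A ∧ γ.IsOddTwist μ χ φ ∧ γ.IsSum μ D A φ := by
    constructor
    · rintro ⟨A, hA, hB⟩
      obtain ⟨φ, hφ, hsum⟩ := hA.exists_isOddTwist hn hχ hD hB
      exact ⟨A, φ, hA, hφ, hsum⟩
    · rintro ⟨A, φ, hA, hφ, hsum⟩
      exact ⟨A, hA, hsum.isBochnerConnection hn hD hA hφ.commutes⟩
  have h23 : ∀ φ : ∀ x : M, Module.End ℂ (V x), γ.IsOddTwist μ χ φ →
      ((∃ A : CovariantDerivative (𝓡 n) F V, γ.IsCliffordConnection A ∧ γ.IsSum μ D A φ) ↔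
        γ.HasDiracForm D (fun x u ↦ γ.theta x u * (γ.chirality μ x * φ x))) := fun φ hφ ↦
    ⟨fun ⟨A, hA, hsum⟩ ↦ hsum.hasDiracForm hn hD hA hφ.commutes,
      fun h ↦ h.exists_isSum hn hn0 hD hφ.commutes⟩
  refine ⟨h12, ?_, h23, fun h ↦ ?_, fun A A' φ φ' hA hφ h hA' hφ' h' ↦
    h.unique hn hA hφ.commutes hA' hφ'.commutes h'⟩
  · rw [h12]
    constructor
    · rintro ⟨A, φ, hA, hφ, hsum⟩
      exact ⟨φ, hφ, (h23 φ hφ).1 ⟨A, hA, hsum⟩⟩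
    · rintro ⟨φ, hφ, h⟩
      obtain ⟨A, hA, hsum⟩ := (h23 φ hφ).2 h
      exact ⟨A, φ, hA, hφ, hsum⟩
  · obtain ⟨A, φ, hA, hφ, hsum⟩ := h12.1 h
    refine ⟨φ, ⟨hφ, (h23 φ hφ).1 ⟨A, hA, hsum⟩⟩, ?_⟩
    -- A competing `φ'` also comes from a Clifford connection, so uniqueness of the decomposition
    -- applies.
    rintro φ' ⟨hφ', h'⟩
    obtain ⟨A', hA', hsum'⟩ := (h23 φ' hφ').2 h'
    exact (hsum'.unique hn hA' hφ'.commutes hA hφ.commutes hsum).1
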